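/- Let $n\ge 1$, $0<p<1$, $\delta=\frac np-\frac{n+1}2$, and suppose that $n(1/p-1)$ is not a positive integer. Let $w$ be a nonnegative locally integrable function on $\mathbb R^n$, not almost everywhere zero, in the Muckenhoupt class $A_1$: there is a constant $C_w$ with $\frac1{|Q|}\int_Q w\,dx\le C_w\,\operatorname{ess\,inf}_Q w$ for every cube $Q$ with sides parallel to the axes. Write $w(E)=\int_E w\,dx$ and $\varphi_t(x)=t^{-n}\varphi(x/t)$. Fix $\varphi\in\mathscr S(\mathbb R^n)$ with $\int\varphi=1$. The weighted Hardy space $H^p_w$ consists of the tempered distributions $f$ with $$\|f\|_{H^p_w}=\Big(\int_{\mathbb R^n}\sup_{t>0}|(\varphi_t*f)(x)|^p\,w(x)\,dx\Big)^{1/p}<\infty .$$ Let $q_w=\inf\{q>1: w\in A_q\}$, where $w \in A_q$ means that $\big(\frac1{|Q|}\int_Q w\big)\big(\frac1{|Q|}\int_Q w^{-1/(q-1)}\big)^{q-1}$ is bounded over all cubes $Q$; let $N=[n(q_w/p-1)]$, and let $\mathscr A_{N,w}$ be the set of all $\psi\in\mathscr S(\mathbb R^n)$ with $(1+|x|)^{N+n+1}|D^\alpha\psi(x)|\le1$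 for all $x$ and all $|\alpha|\le N+1$. The weighted weak Hardy space $WH^p_w$ consists of the tempered distributions $g$ with $$\|g\|_{WH^p_w}=\sup_{\lambda>0}\lambda\, w\big(\{x: G_wg(x)>\lambda\}\big)^{1/p}<\infty,\qquad G_wg(x)=\sup_{\psi\in\mathscr A_{N,w}}\ \sup_{|y-x|<t}|(\psi_t*g)(y)| .$$ For $0<R<\infty$ the Bochner–Riesz operator is $\widehat{T^\delta_Rf}=m_R\hat f$ with $m_R(\xi)=(1-|\xi|^2/R^2)_+^\delta$. For a Schwartz function $f$ this is a product of functions; for a tempered distribution $f$ the product $m_R\hat f$ means the limit in $\mathscr S'$ of $(m_R*\rho_\varepsilon)\hat f$ as $\varepsilon\to0^+$, if it exists and is the same for all $\rho\in C_c^\infty(\mathbb R^n)$ with $\int\rho=1$ (equivalently, $T^\delta_Rf$ is the convolution of $f$ with the kernel $\check m_R$, understood as the limit of convolutions with smooth truncations of $\check m_R$). Then $T^\delta_Rf$ exists for every $f\in H^p_w$ and $R>0$, and there is a constant $C>0$, independent of $f$ and $R$, such that $$\|T^\delta_Rf\|_{WH^p_w}\le C\,\|f\|_{H^p_w}\qquad\text{for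 all } f\in H^p_w,\ R>0 .$$ -/

import Mathlib

open MeasureTheory Filter Topology FourierTransform
open scoped SchwartzMap ENNReal NNReal ContDiff Convolution

noncomputable section

namespace BochnerRiesz

/-- Euclidean space `ℝⁿ`. -/
abbrev Rn (n : ℕ) := EuclideanSpace ℝ (Fin n)

variable {n : ℕ}

/-! ### Muckenhoupt weights -/

/-- The closed cube with centre `x₀`, side length `r`, and sides parallel to the axes. -/
def cube (x₀ : Rn n) (r : ℝ) : Set (Rn n) := {y | ∀ i, |y i - x₀ i| ≤ r / 2}

/-- A nonnegative, locally integrable function. -/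
def IsWeight (w : Rn n → ℝ) : Prop := (∀ x, 0 ≤ w x) ∧ LocallyIntegrable w volume

/-- The measure `w(E) = ∫_E w(x) dx`. -/
def weightMeasure (w : Rn n → ℝ) : Measure (Rn n) :=
  volume.withDensity fun x => ENNReal.ofReal (w x)

/-- The Muckenhoupt class `A_1`. -/
def IsA1 (w : Rn n → ℝ) : Prop :=
  IsWeight w ∧ ∃ C : ℝ≥0, ∀ (x₀ : Rn n) (r : ℝ), 0 < r →
    (∫⁻ x in cube x₀ r, ENNReal.ofReal (w x)) / volume (cube x₀ r) ≤
      C * essInf (fun x => ENNReal.ofReal (w x)) (volume.restrict (cube x₀ r))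

/-- The Muckenhoupt class `A_q`, for `1 < q < ∞`. The power is that of `[0,∞]`, so that
`0 ^ (-1 / (q - 1)) = ∞`. -/
def IsAq (q : ℝ) (w : Rn n → ℝ) : Prop :=
  IsWeight w ∧ ∃ C : ℝ≥0, ∀ (x₀ : Rn n) (r : ℝ), 0 < r →
    (∫⁻ x in cube x₀ r, ENNReal.ofReal (w x)) / volume (cube x₀ r) *
      ((∫⁻ x in cube x₀ r, ENNReal.ofReal (w x) ^ (-1 / (q - 1))) /
        volume (cube x₀ r)) ^ (q - 1) ≤ C

/-- The critical index `q_w = inf {q > 1 : w ∈ A_q}`. -/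
def criticalIndex (w : Rn n → ℝ) : ℝ := sInf {q : ℝ | 1 < q ∧ IsAq q w}

/-! ### Maximal functions and function spaces -/

/-- The Schwartz function `y ↦ t⁻ⁿ φ((x - y) / t)`. -/
def dilTrans (φ : 𝓢(Rn n, ℂ)) (t : ℝ) (ht : 0 < t) (x : Rn n) : 𝓢(Rn n, ℂ) :=
  ((t : ℂ) ^ n)⁻¹ • SchwartzMap.compSubConstCLM ℂ x
    (SchwartzMap.compCLMOfContinuousLinearEquiv ℂ
      (ContinuousLinearEquiv.smulLeft (R₁ := ℝ) (M₁ := Rn n)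
        (Units.mk0 (-t⁻¹) (neg_ne_zero.2 (inv_ne_zero ht.ne')))) φ)

theorem dilTrans_apply (φ : 𝓢(Rn n, ℂ)) (t : ℝ) (ht : 0 < t) (x y : Rn n) :
    dilTrans φ t ht x y = ((t : ℂ) ^ n)⁻¹ * φ (t⁻¹ • (x - y)) := by
  have h : -(t⁻¹ • (y - x)) = t⁻¹ • (x - y) := by rw [← smul_neg, neg_sub]
  simp [dilTrans, Units.smul_def, h]

/-- The convolution `(φ_t * f)(x)` of `φ_t = t⁻ⁿ φ(· / t)` with a tempered distribution `f`. -/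
def convDil (φ : 𝓢(Rn n, ℂ)) (t : ℝ) (ht : 0 < t) (f : 𝓢'(Rn n, ℂ)) (x : Rn n) : ℂ :=
  f (dilTrans φ t ht x)

/-- The radial maximal function `M⁺_φ f(x) = sup_{t > 0} |(φ_t * f)(x)|`. -/
def radialMax (φ : 𝓢(Rn n, ℂ)) (f : 𝓢'(Rn n, ℂ)) (x : Rn n) : ℝ≥0∞ :=
  ⨆ (t : ℝ) (ht : 0 < t), ‖convDil φ t ht f x‖ₑ

/-- The norm of `H^p_w`: `‖f‖ = (∫ (M⁺_φ f)^p w dx)^{1/p}`, with value `∞` off `H^p_w`. -/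
def hardyNorm (φ : 𝓢(Rn n, ℂ)) (p : ℝ) (w : Rn n → ℝ) (f : 𝓢'(Rn n, ℂ)) : ℝ≥0∞ :=
  (∫⁻ x, radialMax φ f x ^ p ∂weightMeasure w) ^ (1 / p)

/-- The class of Schwartz functions `φ` with `(1 + |x|)^{N+n+1} |D^α φ(x)| ≤ 1` for all `x` and all
`|α| ≤ N + 1`. A derivative `D^α` of order `k` is written as the iterated derivative along
coordinate vectors `e_{i 0}, …, e_{i (k-1)}`. -/
def grandClass (n N : ℕ) : Set 𝓢(Rn n, ℂ) :=
  {φ | ∀ k ≤ N + 1, ∀ (i : Fin k → Fin n) (x : Rn n),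
    (1 + ‖x‖) ^ (N + n + 1) *
      ‖iteratedFDeriv ℝ k φ x (fun j => EuclideanSpace.single (i j) (1 : ℝ))‖ ≤ 1}

/-- The integer `N = [n (q_w / p - 1)]`. -/
def grandOrder (p : ℝ) (w : Rn n → ℝ) : ℕ := ⌊(n : ℝ) * (criticalIndex w / p - 1)⌋₊

/-- The nontangential grand maximal function
`G_w f(x) = sup_{φ ∈ 𝒜_{N,w}} sup_{|y - x| < t} |(φ_t * f)(y)|`. -/
def grandMax (p : ℝ) (w : Rn n → ℝ) (f : 𝓢'(Rn n, ℂ)) (x : Rn n) : ℝ≥0∞ :=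
  ⨆ φ ∈ grandClass n (grandOrder p w), ⨆ (t : ℝ) (ht : 0 < t) (y : Rn n) (_ : ‖y - x‖ < t),
    ‖convDil φ t ht f y‖ₑ

/-- The norm of weighted weak `L^p`: `sup_{λ > 0} λ · w({g > λ})^{1/p}`, for `g ≥ 0`. -/
def weakLpNorm (p : ℝ) (w : Rn n → ℝ) (g : Rn n → ℝ≥0∞) : ℝ≥0∞ :=
  ⨆ (l : ℝ≥0) (_ : 0 < l), l * weightMeasure w {x | (l : ℝ≥0∞) < g x} ^ (1 / p)

/-- The norm of the weighted weak Hardy space, `‖f‖_{WH^p_w} = ‖G_w f‖_{WL^p_w}`, with value `∞`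
off the space. -/
def weakHardyNorm (p : ℝ) (w : Rn n → ℝ) (f : 𝓢'(Rn n, ℂ)) : ℝ≥0∞ :=
  weakLpNorm p w (grandMax p w f)

/-! ### Bochner–Riesz operators -/

/-- The symbol `(1 - |ξ|² / R²)_+^δ`. -/
def symbol (δ R : ℝ) (ξ : Rn n) : ℝ := (max (1 - ‖ξ‖ ^ 2 / R ^ 2) 0) ^ δ

/-- A mollifier: a smooth compactly supported function with integral one. -/
def IsMollifier (ρ : Rn n → ℂ) : Prop :=
  ContDiff ℝ ∞ ρ ∧ HasCompactSupport ρ ∧ ∫ x, ρ x = 1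

/-- The mollified symbol `m * ρ_ε`, where `ρ_ε = ε⁻ⁿ ρ(· / ε)`. -/
def mollSymbol (δ R : ℝ) (ρ : Rn n → ℂ) (ε : ℝ) : Rn n → ℂ :=
  (fun ξ => (symbol δ R ξ : ℂ)) ⋆[ContinuousLinearMap.mul ℝ ℂ, volume]
    (fun ξ => ((ε : ℂ) ^ n)⁻¹ * ρ (ε⁻¹ • ξ))

/-- `g = T^δ_R f`, that is `ĝ = (1 - |ξ|² / R²)_+^δ f̂`, for tempered distributions `f`, `g`.
Since the symbol `m` is not smooth, the product `m f̂` of a function and a distribution is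
understood by regularization, as the limit in `𝓢'` of `(m * ρ_ε) f̂` as `ε → 0`, which has to exist
and to be the same for all mollifiers `ρ`. In other words, `g = K_R * f` is the limit of the
convolutions of `f` with the truncations `χ(ε ·) K_R` of the Bochner–Riesz kernel, `χ(0) = 1`.
Such a `g` is unique, and for a Schwartz function `f` it is given by the classical formula: see
`IsBochnerRiesz.unique` and `isBochnerRiesz_schwartz_iff`. -/
def IsBochnerRiesz (δ R : ℝ) (f g : 𝓢'(Rn n, ℂ)) : Prop :=
  ∀ ρ : Rn n → ℂ, IsMollifier ρ → ∀ u : 𝓢(Rn n, ℂ),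
    Tendsto (fun ε : ℝ =>
      TemperedDistribution.fourierMultiplierCLM ℂ (mollSymbol δ R ρ ε) f u) (𝓝[>] 0) (𝓝 (g u))

theorem exists_isMollifier (n : ℕ) : ∃ ρ : Rn n → ℂ, IsMollifier ρ := by
  let b : ContDiffBump (0 : Rn n) := ⟨1, 2, one_pos, one_lt_two⟩
  refine ⟨fun x => ((b.normed volume x : ℝ) : ℂ), ?_, ?_, ?_⟩
  · exact Complex.ofRealCLM.contDiff.comp b.contDiff_normed
  · exact b.hasCompactSupport_normed.comp_left (g := Complex.ofReal) Complex.ofReal_zero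
  · rw [integral_complex_ofReal, b.integral_normed, Complex.ofReal_one]

theorem IsBochnerRiesz.unique {δ R : ℝ} {f g h : 𝓢'(Rn n, ℂ)} (hg : IsBochnerRiesz δ R f g)
    (hh : IsBochnerRiesz δ R f h) : g = h := by
  obtain ⟨ρ, hρ⟩ := exists_isMollifier n
  ext u
  exact tendsto_nhds_unique (hg ρ hρ u) (hh ρ hρ u)

theorem continuous_symbol {δ : ℝ} (hδ : 0 < δ) (R : ℝ) : Continuous (symbol (n := n) δ R) := by
  unfold symbol
  exact Continuous.rpow_const (by fun_prop) fun _ => Or.inr hδ.le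

theorem norm_symbol_le {δ : ℝ} (hδ : 0 < δ) (R : ℝ) (ξ : Rn n) :
    ‖(symbol δ R ξ : ℂ)‖ ≤ 1 := by
  have h0 : (0 : ℝ) ≤ max (1 - ‖ξ‖ ^ 2 / R ^ 2) 0 := le_max_right _ _
  rw [Complex.norm_real, symbol, Real.norm_of_nonneg (Real.rpow_nonneg h0 _)]
  refine Real.rpow_le_one h0 (max_le ?_ zero_le_one) hδ.le
  have : 0 ≤ ‖ξ‖ ^ 2 / R ^ 2 := by positivity
  linarith

theorem hasCompactSupport_symbol {δ : ℝ} (hδ : 0 < δ) {R : ℝ} (hR : 0 < R) :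
    HasCompactSupport (fun ξ : Rn n => (symbol δ R ξ : ℂ)) := by
  refine HasCompactSupport.intro (isCompact_closedBall 0 R) fun ξ hξ => ?_
  have hξ' : R < ‖ξ‖ := by simpa using hξ
  have : 1 ≤ ‖ξ‖ ^ 2 / R ^ 2 := by
    rw [one_le_div (by positivity)]
    gcongr
  simp only [symbol]
  rw [max_eq_right (by linarith), Real.zero_rpow hδ.ne', Complex.ofReal_zero]

theorem hasCompactSupport_dil {ρ : Rn n → ℂ} (hρ : HasCompactSupport ρ) {ε : ℝ} (hε : 0 < ε) :
    HasCompactSupport (fun ξ : Rn n => ((ε : ℂ) ^ n)⁻¹ * ρ (ε⁻¹ • ξ)) :=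
  HasCompactSupport.mul_left (hρ.comp_smul (inv_ne_zero hε.ne'))

theorem hasTemperateGrowth_mollSymbol {δ : ℝ} (hδ : 0 < δ) {R : ℝ} (hR : 0 < R) {ρ : Rn n → ℂ}
    (hρ : IsMollifier ρ) {ε : ℝ} (hε : 0 < ε) :
    (mollSymbol δ R ρ ε).HasTemperateGrowth := by
  have hc := hasCompactSupport_dil hρ.2.1 hε
  have hm : Continuous (fun ξ : Rn n => (symbol δ R ξ : ℂ)) :=
    Complex.continuous_ofReal.comp (continuous_symbol hδ R)
  refine HasCompactSupport.hasTemperateGrowth ?_ ?_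
  · exact HasCompactSupport.convolution _ (hasCompactSupport_symbol hδ hR) hc
  · refine hc.contDiff_convolution_right (n := ⊤) _ hm.locallyIntegrable ?_
    exact contDiff_const.mul (hρ.1.comp (contDiff_const_smul _))

theorem mollSymbol_eq (δ R : ℝ) (ρ : Rn n → ℂ) {ε : ℝ} (hε : 0 < ε) (ξ : Rn n) :
    mollSymbol δ R ρ ε ξ = ∫ z, (symbol δ R (ξ - ε • z) : ℂ) * ρ z := by
  have h := Measure.integral_comp_inv_smul_of_nonneg (volume : Measure (Rn n))
    (fun z => (symbol δ R (ξ - ε • z) : ℂ) * ρ z) hε.le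
  rw [finrank_euclideanSpace_fin] at h
  have h2 : mollSymbol δ R ρ ε ξ = ∫ z, ((ε : ℂ) ^ n)⁻¹ *
      ((symbol δ R (ξ - ε • ε⁻¹ • z) : ℂ) * ρ (ε⁻¹ • z)) := by
    rw [mollSymbol, convolution_eq_swap]
    refine integral_congr_ae (Eventually.of_forall fun z => ?_)
    simp only [ContinuousLinearMap.mul_apply', smul_inv_smul₀ hε.ne']
    ring
  rw [h2, integral_const_mul, h, Complex.real_smul]
  have : (ε : ℂ) ≠ 0 := by exact_mod_cast hε.ne'
  push_cast
  field_simp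

/-- For a Schwartz function `f`, `T^δ_R f` is the inverse Fourier transform of the function
`(1 - |ξ|² / R²)_+^δ f̂(ξ)`. -/
theorem isBochnerRiesz_schwartz_iff {δ : ℝ} (hδ : 0 < δ) {R : ℝ} (hR : 0 < R)
    (f : 𝓢(Rn n, ℂ)) (g : 𝓢'(Rn n, ℂ)) :
    IsBochnerRiesz δ R (SchwartzMap.toTemperedDistributionCLM (Rn n) ℂ volume f) g ↔
      ∀ u : 𝓢(Rn n, ℂ),
        g u = ∫ x, 𝓕⁻ (fun ξ => (symbol δ R ξ : ℂ) * 𝓕 (f : Rn n → ℂ) ξ) x * u x := by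
  have hm : Continuous (fun ξ : Rn n => (symbol δ R ξ : ℂ)) :=
    Complex.continuous_ofReal.comp (continuous_symbol hδ R)
  have key : ∀ ρ : Rn n → ℂ, IsMollifier ρ → ∀ u : 𝓢(Rn n, ℂ),
      Tendsto (fun ε : ℝ => TemperedDistribution.fourierMultiplierCLM ℂ (mollSymbol δ R ρ ε)
        (SchwartzMap.toTemperedDistributionCLM (Rn n) ℂ volume f) u) (𝓝[>] 0)
        (𝓝 (∫ x, 𝓕⁻ (fun ξ => (symbol δ R ξ : ℂ) * 𝓕 (f : Rn n → ℂ) ξ) x * u x)) := by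
    intro ρ hρ u
    have hρi : Integrable ρ volume := hρ.1.continuous.integrable_of_hasCompactSupport hρ.2.1
    have hb : ∀ ε : ℝ, 0 < ε → ∀ ξ, ‖mollSymbol δ R ρ ε ξ‖ ≤ ∫ z, ‖ρ z‖ := by
      intro ε hε ξ
      rw [mollSymbol_eq δ R ρ hε]
      refine norm_integral_le_of_norm_le hρi.norm (Eventually.of_forall fun z => ?_)
      rw [norm_mul]
      exact mul_le_of_le_one_left (norm_nonneg _) (norm_symbol_le hδ R _)
    have hlim : ∀ ξ, Tendsto (fun ε : ℝ => mollSymbol δ R ρ ε ξ) (𝓝[>] 0)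
        (𝓝 (symbol δ R ξ : ℂ)) := by
      intro ξ
      have h1 : Tendsto (fun ε : ℝ => ∫ z, (symbol δ R (ξ - ε • z) : ℂ) * ρ z) (𝓝[>] 0)
          (𝓝 (∫ z, (symbol δ R ξ : ℂ) * ρ z)) := by
        refine tendsto_integral_filter_of_dominated_convergence (fun z => ‖ρ z‖) ?_ ?_
          hρi.norm ?_
        · refine Eventually.of_forall fun ε => Continuous.aestronglyMeasurable ?_
          exact (hm.comp (by fun_prop)).mul hρ.1.continuous
        · refine Eventually.of_forall fun ε => Eventually.of_forall fun z => ?_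
          rw [norm_mul]
          exact mul_le_of_le_one_left (norm_nonneg _) (norm_symbol_le hδ R _)
        · refine Eventually.of_forall fun z => Tendsto.mul_const _ ?_
          have hc : Continuous (fun ε : ℝ => (symbol δ R (ξ - ε • z) : ℂ)) :=
            hm.comp (by fun_prop)
          have := (hc.tendsto 0).mono_left (nhdsWithin_le_nhds (s := Set.Ioi 0))
          simpa using this
      rw [integral_const_mul, hρ.2.2, mul_one] at h1
      refine h1.congr' ?_
      filter_upwards [self_mem_nhdsWithin] with ε hε
      exact (mollSymbol_eq δ R ρ hε ξ).symm
    have hprod : Integrable (fun ξ => (𝓕⁻ u) ξ * (𝓕 f) ξ) volume := by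
      refine ((𝓕⁻ u).integrable (μ := volume)).mul_bdd (c := SchwartzMap.seminorm ℝ 0 0 (𝓕 f))
        (𝓕 f).continuous.aestronglyMeasurable (Eventually.of_forall fun x => ?_)
      exact SchwartzMap.norm_le_seminorm ℝ (𝓕 f) x
    have h2 : Tendsto (fun ε : ℝ => ∫ ξ, mollSymbol δ R ρ ε ξ * ((𝓕⁻ u) ξ * (𝓕 f) ξ)) (𝓝[>] 0)
        (𝓝 (∫ ξ, (symbol δ R ξ : ℂ) * ((𝓕⁻ u) ξ * (𝓕 f) ξ))) := by
      refine tendsto_integral_filter_of_dominated_convergence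
        (fun ξ => (∫ z, ‖ρ z‖) * ‖(𝓕⁻ u) ξ * (𝓕 f) ξ‖) ?_ ?_ (hprod.norm.const_mul _) ?_
      · filter_upwards [self_mem_nhdsWithin] with ε hε
        have := (hasTemperateGrowth_mollSymbol hδ hR hρ hε).1.continuous
        exact (this.mul ((𝓕⁻ u).continuous.mul (𝓕 f).continuous)).aestronglyMeasurable
      · filter_upwards [self_mem_nhdsWithin] with ε hε
        refine Eventually.of_forall fun ξ => ?_
        rw [norm_mul]
        exact mul_le_mul_of_nonneg_right (hb ε hε ξ) (norm_nonneg _)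
      · exact Eventually.of_forall fun ξ => (hlim ξ).mul_const _
    have h3 : ∫ x, 𝓕⁻ (fun ξ => (symbol δ R ξ : ℂ) * 𝓕 (f : Rn n → ℂ) ξ) x * u x =
        ∫ ξ, (symbol δ R ξ : ℂ) * ((𝓕⁻ u) ξ * (𝓕 f) ξ) := by
      have hi : Integrable (fun ξ => (symbol δ R ξ : ℂ) * 𝓕 (f : Rn n → ℂ) ξ) volume := by
        rw [← SchwartzMap.fourier_coe]
        refine ((𝓕 f).integrable (μ := volume)).bdd_mul (c := 1) hm.aestronglyMeasurable
          (Eventually.of_forall fun x => norm_symbol_le hδ R x)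
      have h4 := VectorFourier.integral_fourierIntegral_smul_eq_flip (L := -innerₗ (Rn n))
        (e := Real.fourierChar) Real.continuous_fourierChar
        ((continuous_inner (𝕜 := ℝ) (E := Rn n)).fun_neg) hi
        (u.integrable (μ := volume))
      have h5 : ∀ v : Rn n → ℂ, VectorFourier.fourierIntegral Real.fourierChar volume
          (-innerₗ (Rn n)) v = 𝓕⁻ v := by
        intro v
        ext x
        simp [VectorFourier.fourierIntegral, Real.fourierInv_eq]
      have h6 : (-innerₗ (Rn n)).flip = -innerₗ (Rn n) := by
        ext x y
        simp [real_inner_comm]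
      rw [h6, h5, h5, ← SchwartzMap.fourierInv_coe] at h4
      simp only [smul_eq_mul] at h4
      rw [h4, ← SchwartzMap.fourier_coe]
      congr 1
      ext ξ
      ring
    rw [h3]
    refine h2.congr' ?_
    filter_upwards [self_mem_nhdsWithin] with ε hε
    rw [TemperedDistribution.fourierMultiplierCLM_apply_apply,
      SchwartzMap.toTemperedDistributionCLM_apply_apply volume, SchwartzMap.integral_fourier_smul_eq]
    refine integral_congr_ae (Eventually.of_forall fun ξ => ?_)
    simp [SchwartzMap.smulLeftCLM_apply_apply (hasTemperateGrowth_mollSymbol hδ hR hρ hε),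
      mul_assoc]
  constructor
  · intro h u
    obtain ⟨ρ, hρ⟩ := exists_isMollifier n
    exact tendsto_nhds_unique (h ρ hρ u) (key ρ hρ u)
  · intro h ρ hρ u
    rw [h u]
    exact key ρ hρ u

end BochnerRiesz

end

open BochnerRiesz

open MeasureTheory Filter Topology FourierTransform
open scoped SchwartzMap ENNReal NNReal ContDiff Convolution

noncomputable section

namespace BochnerRiesz

variable {n : ℕ}

section

open Metric

/-! ### Weights and the Hardy–Littlewood maximal function -/

/-! Put $s = 1/R$ and $q = n/p$. At the critical index $\delta + (n+1)/2 = q$, so the Bochner–Riesz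
kernel $K_R$ is bounded by $s^{-n}(1+|x|/s)^{-q}$ (`exists_norm_fourierInv_symbol_le`). The symbol
vanishes for $|\xi| \ge R$, hence $T^\delta_R f = K_R * G$ with $G = \eta_s * f$ for any Schwartz
$\eta$ with $\hat\eta = 1$ on $|\xi| \le 2$. Thus $|T^\delta_R f|$ is at most a constant times a
positive potential of $|G|$, and no atomic decomposition is needed.

The input from $H^p_w$ is one maximal function $N$ with $\|N\|_{L^p(w)} \le C\|f\|_{H^p_w}$ that
dominates $|\psi_t * f(y)|$ for $|y-x| \le t$ and every $\psi$ with decay of order $L+n$ and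
controlled derivatives of order $L$, where $n/p < L+n$ (`exists_maximalFunction`). It comes from a
reproducing formula that writes $\psi$ through dyadic dilates of $\varphi$
(`exists_enorm_cv_dil_le`), from the sub-mean value property of the Peetre maximal function
(`dyadicPeetre_rpow_le_dyadicSum`, `peetreMax_rpow_le`), and from the boundedness of the
Hardy–Littlewood operator on $L^{p/r}(w)$ for some $r < p$ (`IsA1Ball.strong_hlMax`). In particular
$|G(z)| \le B\,N(u)$ whenever $|u - z| \le s$.

The weak type bound is `IsA1Ball.weak_potential`. Off the set where the maximal function of $N^p$
exceeds a multiple of $\lambda^p$, which has admissible $w$-measure, $|G(z)|$ is at most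
$\lambda(1+|x-z|/s)^q$ up to constants. So a large value $G(z)$ is only seen from far away, and
there the kernel integrates to less against $w$. The gain turns $|G(z)|$ into
$|G(z)|^p\lambda^{1-p}$, and Chebyshev's inequality finishes.

For the grand maximal function one bounds $\psi_t * T^\delta_R f$
(`exists_enorm_cv_dil_le_potential`). If $t \le s$, averaging the potential at scale $t$ is
harmless. If $t \ge s$, the symbol is split as $m = \hat\kappa + \hat d\,m$ with $\hat\kappa$ smooth
and $\hat d$ zero near the origin. The $\kappa$ part is a convolution of $f$ with an admissible
function and is bounded by $N$; the $d$ part gains $(s/t)^L$ from the smoothness of $\psi$, which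
pays for averaging the potential at the coarse scale $t$ (`lintegral_ker_mul_ker_le`). The order $L
= [n(q_w/p-1)]+1$ suffices because $q_w = 1$.

Existence of $T^\delta_R f$ uses the same potential. The weak bound makes it finite at some point,
hence of polynomial growth, and dominated convergence passes to the limit in the mollified symbols
(`exists_isBochnerRiesz`). -/

/-- The `A_1` condition on balls, with constant `C`. -/
def IsA1Ball (w : Rn n → ℝ) (C : ℝ≥0) : Prop :=
  ∀ (x : Rn n) (ρ : ℝ), 0 < ρ → ∀ᵐ y ∂(volume.restrict (closedBall x ρ)),
    weightMeasure w (closedBall x ρ) ≤ C * ENNReal.ofReal (ρ ^ n) * ENNReal.ofReal (w y)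

theorem cube_eq_preimage (x : Rn n) (r : ℝ) :
    cube x r = (MeasurableEquiv.toLp 2 (Fin n → ℝ)).symm ⁻¹'
      Set.Icc (fun i => x i - r / 2) (fun i => x i + r / 2) := by
  ext y
  simp only [cube, Set.mem_ofPred_eq, Set.mem_preimage, Set.mem_Icc, Pi.le_def, abs_le]
  constructor
  · intro h
    exact ⟨fun i => by have := (h i).1; simp; linarith, fun i => by have := (h i).2; simp; linarith⟩
  · rintro ⟨h1, h2⟩ i
    have h1 := h1 i
    have h2 := h2 i
    simp at h1 h2
    constructor <;> linarith

theorem volume_cube (x : Rn n) {r : ℝ} (hr : 0 < r) :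
    volume (cube x r) = ENNReal.ofReal (r ^ n) := by
  rw [cube_eq_preimage,
    (EuclideanSpace.volume_preserving_symm_measurableEquiv_toLp (Fin n)).measure_preimage
      measurableSet_Icc.nullMeasurableSet, Real.volume_Icc_pi]
  have : ∀ i, x i + r / 2 - (x i - r / 2) = r := fun i => by ring
  simp [this, ENNReal.ofReal_pow hr.le]

theorem closedBall_subset_cube (x : Rn n) (ρ : ℝ) : closedBall x ρ ⊆ cube x (2 * ρ) := by
  intro y hy i
  have h1 : ‖y - x‖ ≤ ρ := by simpa [dist_eq_norm] using hy
  have h2 := (PiLp.norm_apply_le (y - x) i).trans h1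
  simpa [Real.norm_eq_abs] using h2

theorem aemeasurable_weight {w : Rn n → ℝ} (hw : IsWeight w) :
    AEMeasurable (fun x => ENNReal.ofReal (w x)) volume :=
  hw.2.aestronglyMeasurable.aemeasurable.ennreal_ofReal

theorem weightMeasure_apply (w : Rn n → ℝ) {s : Set (Rn n)} (hs : MeasurableSet s) :
    weightMeasure w s = ∫⁻ x in s, ENNReal.ofReal (w x) := withDensity_apply _ hs

theorem lintegral_weightMeasure {w : Rn n → ℝ} (hw : IsWeight w) {g : Rn n → ℝ≥0∞}
    (hg : Measurable g) :
    ∫⁻ x, g x ∂weightMeasure w = ∫⁻ x, ENNReal.ofReal (w x) * g x := by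
  rw [weightMeasure, lintegral_withDensity_eq_lintegral_mul₀ (aemeasurable_weight hw)
    hg.aemeasurable]
  rfl

theorem weightMeasure_closedBall_lt_top {w : Rn n → ℝ} (hw : IsWeight w) (x : Rn n) (ρ : ℝ) :
    weightMeasure w (closedBall x ρ) < ⊤ := by
  rw [weightMeasure_apply w measurableSet_closedBall]
  have h := hw.2.integrableOn_isCompact (isCompact_closedBall x ρ)
  have h2 := h.2
  refine lt_of_le_of_lt (lintegral_mono fun y => ?_) h2
  rw [Real.enorm_eq_ofReal (hw.1 y)]

theorem IsA1.exists_isA1Ball {w : Rn n → ℝ} (hw : IsA1 w) : ∃ C, IsA1Ball w C := by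
  obtain ⟨hw, C, hC⟩ := hw
  refine ⟨C * 2 ^ n, fun x ρ hρ => ?_⟩
  have h1 := hC x (2 * ρ) (by linarith)
  have h2 : ∀ᵐ y ∂(volume.restrict (cube x (2 * ρ))),
      essInf (fun x => ENNReal.ofReal (w x)) (volume.restrict (cube x (2 * ρ))) ≤
        ENNReal.ofReal (w y) := ae_essInf_le
  have h3 := ae_restrict_of_ae_restrict_of_subset (closedBall_subset_cube x ρ) h2
  filter_upwards [h3] with y hy
  rw [volume_cube x (by linarith), ENNReal.div_le_iff (by simp; positivity) (by simp)] at h1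
  calc weightMeasure w (closedBall x ρ)
      ≤ ∫⁻ x in cube x (2 * ρ), ENNReal.ofReal (w x) := by
        rw [weightMeasure_apply w measurableSet_closedBall]
        exact lintegral_mono_set (closedBall_subset_cube x ρ)
    _ ≤ _ := h1
    _ ≤ C * ENNReal.ofReal (w y) * ENNReal.ofReal ((2 * ρ) ^ n) := by gcongr
    _ = _ := by
        rw [mul_pow, ENNReal.ofReal_mul (by positivity), ENNReal.coe_mul, ENNReal.coe_pow]
        simp [ENNReal.ofReal_pow]
        ring

/-- The volume of the unit ball. -/
def unitVol (n : ℕ) : ℝ≥0∞ := volume (closedBall (0 : Rn n) 1)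

theorem unitVol_ne_zero (n : ℕ) : unitVol n ≠ 0 := (measure_closedBall_pos _ _ one_pos).ne'

theorem unitVol_ne_top (n : ℕ) : unitVol n ≠ ⊤ := measure_closedBall_lt_top.ne

theorem volume_closedBall_eq (x : Rn n) {ρ : ℝ} (hρ : 0 ≤ ρ) :
    volume (closedBall x ρ) = ENNReal.ofReal (ρ ^ n) * unitVol n := by
  rw [unitVol, Measure.addHaar_closedBall' _ _ hρ, finrank_euclideanSpace_fin]

/-- Integrate the pointwise bound belonging to the large ball over the small ball. The growth
exponent is exactly $n$, which later balances kernels that decay faster than $|x|^{-n}$. -/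
theorem IsA1Ball.doubling {w : Rn n → ℝ} {C : ℝ≥0} (h : IsA1Ball w C) (x : Rn n)
    {ρ ρ' : ℝ} (hρ : 0 < ρ) (hρ' : ρ ≤ ρ') :
    ENNReal.ofReal (ρ ^ n) * weightMeasure w (closedBall x ρ') ≤
      (C / unitVol n) * ENNReal.ofReal (ρ' ^ n) * weightMeasure w (closedBall x ρ) := by
  have h1 := ae_restrict_of_ae_restrict_of_subset (closedBall_subset_closedBall hρ')
    (h x ρ' (hρ.trans_le hρ'))
  have h2 := lintegral_mono_ae h1
  rw [lintegral_const, lintegral_const_mul' _ _ (by finiteness),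
    ← weightMeasure_apply w measurableSet_closedBall, Measure.restrict_apply_univ,
    volume_closedBall_eq x hρ.le] at h2
  have hv0 := unitVol_ne_zero n
  have hvt := unitVol_ne_top n
  calc _ = (weightMeasure w (closedBall x ρ') * (ENNReal.ofReal (ρ ^ n) * unitVol n))
        / unitVol n := by
        rw [← mul_assoc, ENNReal.mul_div_cancel_right hv0 hvt, mul_comm]
    _ ≤ _ := ENNReal.div_le_div_right h2 _
    _ = _ := by simp only [div_eq_mul_inv]; ring

/-- The (centred) Hardy–Littlewood maximal function, up to the volume of the unit ball. -/
def hlMax (g : Rn n → ℝ≥0∞) (x : Rn n) : ℝ≥0∞ :=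
  ⨆ (ρ : ℝ) (_ : 0 < ρ), ENNReal.ofReal ((ρ ^ n)⁻¹) * ∫⁻ y in closedBall x ρ, g y

theorem lintegral_closedBall_le_hlMax (g : Rn n → ℝ≥0∞) (x : Rn n) {ρ : ℝ} (hρ : 0 < ρ) :
    ∫⁻ y in closedBall x ρ, g y ≤ ENNReal.ofReal (ρ ^ n) * hlMax g x := by
  have h : ENNReal.ofReal ((ρ ^ n)⁻¹) * ∫⁻ y in closedBall x ρ, g y ≤ hlMax g x :=
    le_iSup₂ (f := fun (ρ : ℝ) (_ : 0 < ρ) =>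
      ENNReal.ofReal ((ρ ^ n)⁻¹) * ∫⁻ y in closedBall x ρ, g y) ρ hρ
  calc _ = ENNReal.ofReal (ρ ^ n) * (ENNReal.ofReal ((ρ ^ n)⁻¹) *
        ∫⁻ y in closedBall x ρ, g y) := by
        rw [← mul_assoc, ← ENNReal.ofReal_mul (by positivity), mul_inv_cancel₀ (by positivity)]
        simp
    _ ≤ _ := by gcongr

theorem lt_hlMax_iff {g : Rn n → ℝ≥0∞} {x : Rn n} {l : ℝ≥0∞} :
    l < hlMax g x ↔ ∃ ρ : ℝ, 0 < ρ ∧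
      l < ENNReal.ofReal ((ρ ^ n)⁻¹) * ∫⁻ y in closedBall x ρ, g y := by
  simp [hlMax, lt_iSup_iff]

/-- A radius that works at $x$ works, slightly enlarged, at all nearby centres: the larger ball
contains the old one and the normalizing factor depends continuously on the radius. -/
theorem isOpen_lt_hlMax (g : Rn n → ℝ≥0∞) (l : ℝ≥0∞) : IsOpen {x | l < hlMax g x} := by
  rw [Metric.isOpen_iff]
  intro x hx
  obtain ⟨ρ, hρ, h⟩ := lt_hlMax_iff.1 hx
  have hc : ContinuousAt (fun τ : ℝ => ENNReal.ofReal ((τ ^ n)⁻¹) * ∫⁻ y in closedBall x ρ, g y)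
      ρ := by
    refine ENNReal.Tendsto.mul_const ?_ (Or.inl (by simp; positivity))
    refine ENNReal.tendsto_ofReal ?_
    exact ((continuous_pow n).tendsto ρ).inv₀ (by positivity)
  have h1 := hc.eventually (lt_mem_nhds h)
  obtain ⟨ε, hε, h2⟩ := Metric.eventually_nhds_iff.1 h1
  refine ⟨ε / 2, by positivity, fun z hz => lt_hlMax_iff.2 ⟨ρ + ε / 2, by positivity, ?_⟩⟩
  refine (h2 (y := ρ + ε / 2) (by simp [abs_of_pos hε]; linarith)).trans_le ?_
  gcongr
  refine closedBall_subset_closedBall' ?_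
  rw [dist_comm]
  have := mem_ball.1 hz
  linarith

theorem measurable_hlMax (g : Rn n → ℝ≥0∞) : Measurable (hlMax g) :=
  measurable_of_Ioi fun l => (isOpen_lt_hlMax g l).measurableSet

/-- Vitali covering. On a selected ball $B$ the $A_1$ condition for $5B$ lets $w(5B)$ move under the
integral of $g$ over $B$, where it turns into $w(y)$; disjointness then sums the pieces. -/
theorem IsA1Ball.weak_hlMax {w : Rn n → ℝ} {C : ℝ≥0} (hw : IsWeight w) (h : IsA1Ball w C)
    {g : Rn n → ℝ≥0∞} (hg : Measurable g) (l : ℝ≥0∞) :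
    l * weightMeasure w {x | l < hlMax g x} ≤ (C * 5 ^ n) * ∫⁻ x, g x ∂weightMeasure w := by
  -- The covering lemma needs bounded radii; the bound `k` is removed at the end by monotone
  -- convergence.
  have key : ∀ k : ℕ, l * weightMeasure w {x | ∃ ρ : ℝ, 0 < ρ ∧ ρ ≤ k ∧
      l < ENNReal.ofReal ((ρ ^ n)⁻¹) * ∫⁻ y in closedBall x ρ, g y} ≤
      (C * 5 ^ n) * ∫⁻ x, g x ∂weightMeasure w := by
    intro k
    set t := {x | ∃ ρ : ℝ, 0 < ρ ∧ ρ ≤ k ∧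
      l < ENNReal.ofReal ((ρ ^ n)⁻¹) * ∫⁻ y in closedBall x ρ, g y} with ht
    have hex : ∀ x : Rn n, ∃ ρ : ℝ, x ∈ t → 0 < ρ ∧ ρ ≤ k ∧
        l < ENNReal.ofReal ((ρ ^ n)⁻¹) * ∫⁻ y in closedBall x ρ, g y := by
      intro x
      by_cases hx : x ∈ t
      · obtain ⟨ρ, h⟩ := hx
        exact ⟨ρ, fun _ => h⟩
      · exact ⟨0, fun h => absurd h hx⟩
    choose ρ hρ using hex
    obtain ⟨u, hut, hdisj, hcov⟩ :=
      Vitali.exists_disjoint_subfamily_covering_enlargement_closedBall t id ρ k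
        (fun a ha => (hρ a ha).2.1) 5 (by norm_num)
    have hucount : u.Countable := by
      refine hdisj.countable_of_nonempty_interior fun a ha => ?_
      refine ⟨a, ball_subset_interior_closedBall ?_⟩
      exact mem_ball_self (hρ a (hut ha)).1
    have hsub : t ⊆ ⋃ b ∈ u, closedBall b (5 * ρ b) := by
      intro a ha
      obtain ⟨b, hb, hab⟩ := hcov a ha
      simp only [Set.mem_iUnion]
      exact ⟨b, hb, hab (mem_closedBall_self (hρ a ha).1.le)⟩
    have hone : ∀ b ∈ u, l * weightMeasure w (closedBall b (5 * ρ b)) ≤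
        (C * 5 ^ n) * ∫⁻ y in closedBall b (ρ b), ENNReal.ofReal (w y) * g y := by
      intro b hb
      obtain ⟨h0, -, h2⟩ := hρ b (hut hb)
      have h5 : 0 < 5 * ρ b := by positivity
      have hae := ae_restrict_of_ae_restrict_of_subset
        (closedBall_subset_closedBall (by linarith : ρ b ≤ 5 * ρ b)) (h b (5 * ρ b) h5)
      have h3 : (∫⁻ y in closedBall b (ρ b), g y) * weightMeasure w (closedBall b (5 * ρ b)) ≤
          (C * 5 ^ n) * ENNReal.ofReal (ρ b ^ n) *
            ∫⁻ y in closedBall b (ρ b), ENNReal.ofReal (w y) * g y := by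
        rw [← lintegral_mul_const' _ _ (weightMeasure_closedBall_lt_top hw _ _).ne,
          ← lintegral_const_mul' _ _ (by finiteness)]
        refine lintegral_mono_ae ?_
        filter_upwards [hae] with y hy
        calc _ ≤ g y * (C * ENNReal.ofReal ((5 * ρ b) ^ n) * ENNReal.ofReal (w y)) := by gcongr
          _ = _ := by
            rw [mul_pow, ENNReal.ofReal_mul (by positivity)]
            simp [ENNReal.ofReal_pow]
            ring
      calc _ ≤ (ENNReal.ofReal ((ρ b ^ n)⁻¹) * ∫⁻ y in closedBall b (ρ b), g y) *
            weightMeasure w (closedBall b (5 * ρ b)) := by gcongr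
        _ ≤ ENNReal.ofReal ((ρ b ^ n)⁻¹) * ((C * 5 ^ n) * ENNReal.ofReal (ρ b ^ n) *
            ∫⁻ y in closedBall b (ρ b), ENNReal.ofReal (w y) * g y) := by
            rw [mul_assoc]; gcongr
        _ = (ENNReal.ofReal ((ρ b ^ n)⁻¹) * ENNReal.ofReal (ρ b ^ n)) * ((C * 5 ^ n) *
            ∫⁻ y in closedBall b (ρ b), ENNReal.ofReal (w y) * g y) := by ring
        _ = _ := by
            rw [← ENNReal.ofReal_mul (by positivity), inv_mul_cancel₀ (by positivity)]
            simp
    have := hucount.to_subtype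
    calc _ ≤ l * ∑' b : u, weightMeasure w (closedBall b (5 * ρ b)) := by
          gcongr
          exact (measure_mono hsub).trans (measure_biUnion_le _ hucount _)
      _ = ∑' b : u, l * weightMeasure w (closedBall b (5 * ρ b)) := ENNReal.tsum_mul_left.symm
      _ ≤ ∑' b : u, (C * 5 ^ n) *
          ∫⁻ y in closedBall (b : Rn n) (ρ b), ENNReal.ofReal (w y) * g y :=
          ENNReal.tsum_le_tsum fun b => hone b b.2
      _ = (C * 5 ^ n) * ∑' b : u,
          ∫⁻ y in closedBall (b : Rn n) (ρ b), ENNReal.ofReal (w y) * g y :=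
          ENNReal.tsum_mul_left
      _ = (C * 5 ^ n) *
          ∫⁻ y in ⋃ b ∈ u, closedBall b (ρ b), ENNReal.ofReal (w y) * g y := by
          congr 1
          exact (lintegral_biUnion hucount (fun _ _ => measurableSet_closedBall) hdisj _).symm
      _ ≤ _ := by
          rw [lintegral_weightMeasure hw hg]
          gcongr
          exact Measure.restrict_le_self
  have hset : {x | l < hlMax g x} = ⋃ k : ℕ, {x | ∃ ρ : ℝ, 0 < ρ ∧ ρ ≤ k ∧
      l < ENNReal.ofReal ((ρ ^ n)⁻¹) * ∫⁻ y in closedBall x ρ, g y} := by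
    ext x
    simp only [Set.mem_ofPred_eq, Set.mem_iUnion, lt_hlMax_iff]
    constructor
    · rintro ⟨ρ, h0, h1⟩
      obtain ⟨k, hk⟩ := exists_nat_ge ρ
      exact ⟨k, ρ, h0, hk, h1⟩
    · rintro ⟨k, ρ, h0, -, h1⟩
      exact ⟨ρ, h0, h1⟩
  rw [hset, Monotone.measure_iUnion, ENNReal.mul_iSup]
  · exact iSup_le key
  · intro a b hab x
    rintro ⟨ρ, h0, h1, h2⟩
    exact ⟨ρ, h0, h1.trans (by exact_mod_cast hab), h2⟩

end

/-! ### The strong type maximal inequality and the critical index of an $A_1$ weight. -/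

section

open Metric

/-- The layer cake formula for one value `y`, the value `⊤` included. -/
theorem lintegral_rpow_indicator_lt {a : ℝ} (ha : 0 < a) (y : ℝ≥0∞) :
    ∫⁻ l in Set.Ioi (0 : ℝ), ENNReal.ofReal (l ^ (a - 1)) *
      (if ENNReal.ofReal l < y then 1 else 0) = ENNReal.ofReal a⁻¹ * y ^ a := by
  have fin : ∀ c : ℝ, 0 ≤ c → ∫⁻ l in Set.Ioi (0 : ℝ), ENNReal.ofReal (l ^ (a - 1)) *
      (if ENNReal.ofReal l < ENNReal.ofReal c then 1 else 0) =
      ENNReal.ofReal a⁻¹ * ENNReal.ofReal c ^ a := by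
    intro c hc
    have h1 : ∀ l ∈ Set.Ioi (0 : ℝ), ENNReal.ofReal (l ^ (a - 1)) *
        (if ENNReal.ofReal l < ENNReal.ofReal c then 1 else 0) =
        (Set.Iio c).indicator (fun l => ENNReal.ofReal (l ^ (a - 1))) l := by
      intro l hl
      by_cases h : l < c
      · rw [if_pos ((ENNReal.ofReal_lt_ofReal_iff ((Set.mem_Ioi.1 hl).trans h)).2 h),
          Set.indicator_of_mem (by simpa using h), mul_one]
      · rw [if_neg (not_lt.2 (ENNReal.ofReal_le_ofReal (not_lt.1 h))),
          Set.indicator_of_notMem (by simpa using h), mul_zero]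
    rw [setLIntegral_congr_fun measurableSet_Ioi h1, lintegral_indicator measurableSet_Iio,
      Measure.restrict_restrict measurableSet_Iio, Set.inter_comm, Set.Ioi_inter_Iio,
      setLIntegral_congr Ioo_ae_eq_Ioc]
    have hi : IntervalIntegrable (fun l : ℝ => l ^ (a - 1)) volume 0 c :=
      intervalIntegral.intervalIntegrable_rpow' (by linarith)
    rw [← ofReal_integral_eq_lintegral_ofReal
      ((intervalIntegrable_iff_integrableOn_Ioc_of_le hc).1 hi), ← intervalIntegral.integral_of_le hc,
      integral_rpow (Or.inl (by linarith))]
    · rw [ENNReal.ofReal_rpow_of_nonneg hc ha.le, ← ENNReal.ofReal_mul (by positivity)]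
      simp [Real.zero_rpow ha.ne']
      ring_nf
    · filter_upwards [ae_restrict_mem measurableSet_Ioc] with l hl
      exact Real.rpow_nonneg hl.1.le _
  by_cases hy : y = ⊤
  · subst hy
    rw [ENNReal.top_rpow_of_pos ha, ENNReal.mul_top (by simpa using ha)]
    refine ENNReal.eq_top_of_forall_nnreal_le fun c => ?_
    -- This height makes the finite formula return exactly `c`, so the integral for `⊤` exceeds
    -- every `c`.
    have h2 := fin ((a * c) ^ a⁻¹) (by positivity)
    rw [ENNReal.ofReal_rpow_of_nonneg (by positivity) ha.le, ← ENNReal.ofReal_mul (by positivity),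
      ← Real.rpow_mul (by positivity), inv_mul_cancel₀ ha.ne', Real.rpow_one,
      inv_mul_cancel_left₀ ha.ne', ENNReal.ofReal_coe_nnreal] at h2
    rw [← h2]
    gcongr
    split_ifs <;> simp_all
  · have := fin y.toReal ENNReal.toReal_nonneg
    rwa [ENNReal.ofReal_toReal hy] at this

/-- Truncation at height `c`. The factor `unitVol n` appears because `hlMax` divides by $\rho^n$
instead of the volume of the ball. -/
theorem hlMax_le_add {g : Rn n → ℝ≥0∞} (hg : Measurable g) (c : ℝ≥0∞) (x : Rn n) :
    hlMax g x ≤ hlMax (fun y => g y * (if c < g y then 1 else 0)) x + c * unitVol n := by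
  refine iSup₂_le fun ρ hρ => ?_
  have hm : Measurable fun y => g y * (if c < g y then (1 : ℝ≥0∞) else 0) :=
    hg.mul (Measurable.ite (measurableSet_lt measurable_const hg) measurable_const measurable_const)
  have h1 : ∀ y, g y ≤ g y * (if c < g y then 1 else 0) + c := by
    intro y
    split_ifs with h
    · simp
    · simpa using not_lt.1 h
  calc _ ≤ ENNReal.ofReal ((ρ ^ n)⁻¹) * ∫⁻ y in closedBall x ρ,
        (g y * (if c < g y then 1 else 0) + c) := by
        gcongr with y
        exact h1 y
    _ = (ENNReal.ofReal ((ρ ^ n)⁻¹) * ∫⁻ y in closedBall x ρ,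
        (g y * (if c < g y then 1 else 0))) + c * unitVol n := by
        rw [lintegral_add_left hm, lintegral_const, Measure.restrict_apply_univ,
          volume_closedBall_eq x hρ.le, mul_add]
        congr 1
        rw [mul_left_comm, ← mul_assoc (ENNReal.ofReal _) (ENNReal.ofReal _),
          ← ENNReal.ofReal_mul (by positivity), inv_mul_cancel₀ (by positivity)]
        simp
    _ ≤ _ := by
        gcongr
        exact le_iSup₂ (f := fun (ρ : ℝ) (_ : 0 < ρ) => ENNReal.ofReal ((ρ ^ n)⁻¹) *
          ∫⁻ y in closedBall x ρ, (g y * (if c < g y then 1 else 0))) ρ hρ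

instance (w : Rn n → ℝ) : SFinite (weightMeasure w) := by
  unfold weightMeasure; infer_instance

/-- The Hardy–Littlewood maximal function is bounded on `L^s(w)` for `s > 1` and `w ∈ A_1`. -/
theorem IsA1Ball.strong_hlMax {w : Rn n → ℝ} {C : ℝ≥0} (hw : IsWeight w) (h : IsA1Ball w C)
    {s : ℝ} (hs : 1 < s) :
    ∃ D : ℝ≥0, ∀ g : Rn n → ℝ≥0∞, Measurable g →
      ∫⁻ x, hlMax g x ^ s ∂weightMeasure w ≤ D * ∫⁻ x, g x ^ s ∂weightMeasure w := by
  set v := unitVol n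
  have hv0 : v ≠ 0 := unitVol_ne_zero n
  have hvt : v ≠ ⊤ := unitVol_ne_top n
  set K : ℝ≥0∞ := ENNReal.ofReal s * (2 * (C * 5 ^ n) * (ENNReal.ofReal (s - 1)⁻¹ *
    (2 * v) ^ (s - 1))) with hK
  have hKt : K ≠ ⊤ := by
    have : (2 * v) ^ (s - 1) ≠ ⊤ := ENNReal.rpow_ne_top_of_nonneg (by linarith) (by finiteness)
    finiteness
  refine ⟨K.toNNReal, fun g hg => ?_⟩
  rw [ENNReal.coe_toNNReal hKt]
  have hm := measurable_hlMax g
  have hlev : ∀ l ∈ Set.Ioi (0 : ℝ), weightMeasure w {x | ENNReal.ofReal l < hlMax g x} ≤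
      2 * (C * 5 ^ n) * ENNReal.ofReal l⁻¹ * ∫⁻ x, g x *
        (if ENNReal.ofReal l < 2 * v * g x then 1 else 0) ∂weightMeasure w := by
    intro l hl
    have hl : 0 < l := hl
    -- Marcinkiewicz interpolation with truncation height proportional to the level: the part of `g`
    -- below `c` contributes at most `l / 2`, so the weak type bound is applied to the part above.
    set c : ℝ≥0∞ := ENNReal.ofReal l / (2 * v) with hc
    have hcv : c * v = ENNReal.ofReal (l / 2) := by
      rw [hc, ENNReal.ofReal_div_of_pos two_pos]
      simp only [div_eq_mul_inv]
      rw [ENNReal.mul_inv (by simp) (by simp), mul_assoc, mul_assoc, ENNReal.inv_mul_cancel hv0 hvt]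
      simp
    have hcg : ∀ x, c < g x ↔ ENNReal.ofReal l < 2 * v * g x := by
      intro x
      rw [hc, ENNReal.div_lt_iff (Or.inl (by simpa using hv0)) (Or.inl (by finiteness)), mul_comm]
    have hsub : {x | ENNReal.ofReal l < hlMax g x} ⊆ {x | ENNReal.ofReal (l / 2) <
        hlMax (fun y => g y * (if c < g y then 1 else 0)) x} := by
      intro x hx
      by_contra hcon
      have h1 := hlMax_le_add hg c x
      simp only [Set.mem_ofPred_eq, not_lt] at hcon hx
      have h2 : hlMax g x ≤ ENNReal.ofReal (l / 2) + ENNReal.ofReal (l / 2) := by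
        refine h1.trans ?_
        rw [← hcv]
        gcongr
        rw [hcv]
        exact hcon
      rw [← ENNReal.ofReal_add (by positivity) (by positivity), add_halves] at h2
      exact absurd hx (not_lt.2 h2)
    have hmg : Measurable fun y => g y * (if c < g y then (1 : ℝ≥0∞) else 0) :=
      hg.mul (Measurable.ite (measurableSet_lt measurable_const hg) measurable_const
        measurable_const)
    have hwk := h.weak_hlMax hw hmg (ENNReal.ofReal (l / 2))
    have h3 : (1 : ℝ≥0∞) = 2 * ENNReal.ofReal l⁻¹ * ENNReal.ofReal (l / 2) := by
      rw [mul_assoc, ← ENNReal.ofReal_mul (by positivity)]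
      rw [show l⁻¹ * (l / 2) = 2⁻¹ by field_simp, ENNReal.ofReal_inv_of_pos two_pos]
      simp [ENNReal.mul_inv_cancel]
    calc _ ≤ 1 * weightMeasure w {x | ENNReal.ofReal (l / 2) <
          hlMax (fun y => g y * (if c < g y then 1 else 0)) x} := by
          rw [one_mul]; exact measure_mono hsub
      _ ≤ 2 * ENNReal.ofReal l⁻¹ * ((C * 5 ^ n) *
          ∫⁻ x, g x * (if c < g x then 1 else 0) ∂weightMeasure w) := by
          refine (le_of_eq ?_).trans (mul_le_mul_right hwk (2 * ENNReal.ofReal l⁻¹))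
          rw [← mul_assoc, ← h3]
      _ = _ := by simp only [hcg]; ring
  have hjm : Measurable fun z : Rn n × ℝ => ENNReal.ofReal (z.2 ^ (s - 1)) *
      (if ENNReal.ofReal z.2 < hlMax g z.1 then (1 : ℝ≥0∞) else 0) := by
    refine Measurable.mul (by fun_prop) (Measurable.ite ?_ measurable_const measurable_const)
    exact measurableSet_lt (by fun_prop) (hm.comp measurable_fst)
  have hjm2 : Measurable fun z : ℝ × Rn n => ENNReal.ofReal (z.1 ^ (s - 1 - 1)) *
      (g z.2 * (if ENNReal.ofReal z.1 < 2 * v * g z.2 then (1 : ℝ≥0∞) else 0)) := by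
    refine Measurable.mul (by fun_prop) (Measurable.mul (by fun_prop) (Measurable.ite ?_
      measurable_const measurable_const))
    exact measurableSet_lt (by fun_prop) (by fun_prop)
  have hs0 : 0 < s := by linarith
  have hself : ∀ y : ℝ≥0∞, y ^ s = ENNReal.ofReal s * (ENNReal.ofReal s⁻¹ * y ^ s) := by
    intro y
    rw [← mul_assoc, ← ENNReal.ofReal_mul hs0.le, mul_inv_cancel₀ hs0.ne']
    simp
  calc ∫⁻ x, hlMax g x ^ s ∂weightMeasure w
      = ENNReal.ofReal s * ∫⁻ x, (∫⁻ l in Set.Ioi (0 : ℝ), ENNReal.ofReal (l ^ (s - 1)) *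
        (if ENNReal.ofReal l < hlMax g x then 1 else 0)) ∂weightMeasure w := by
        rw [← lintegral_const_mul' _ _ (by finiteness)]
        refine lintegral_congr fun x => ?_
        rw [lintegral_rpow_indicator_lt hs0, ← hself]
    _ = ENNReal.ofReal s * ∫⁻ l in Set.Ioi (0 : ℝ), ENNReal.ofReal (l ^ (s - 1)) *
        weightMeasure w {x | ENNReal.ofReal l < hlMax g x} := by
        rw [lintegral_lintegral_swap hjm.aemeasurable]
        congr 1
        refine lintegral_congr fun l => ?_
        rw [lintegral_const_mul' _ _ (by finiteness)]
        congr 1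
        rw [← lintegral_indicator_one (measurableSet_lt measurable_const hm)]
        refine lintegral_congr fun x => ?_
        simp [Set.indicator_apply]
    _ ≤ ENNReal.ofReal s * ∫⁻ l in Set.Ioi (0 : ℝ), 2 * (C * 5 ^ n) *
        ∫⁻ x, ENNReal.ofReal (l ^ (s - 1 - 1)) * (g x *
        (if ENNReal.ofReal l < 2 * v * g x then 1 else 0)) ∂weightMeasure w := by
        gcongr 1
        refine setLIntegral_mono' measurableSet_Ioi fun l hl => ?_
        have hl' : 0 < l := hl
        rw [lintegral_const_mul' _ _ (by finiteness)]
        calc _ ≤ ENNReal.ofReal (l ^ (s - 1)) * (2 * (C * 5 ^ n) * ENNReal.ofReal l⁻¹ *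
              ∫⁻ x, g x * (if ENNReal.ofReal l < 2 * v * g x then 1 else 0)
              ∂weightMeasure w) := by gcongr; exact hlev l hl
          _ = 2 * (C * 5 ^ n) * ((ENNReal.ofReal (l ^ (s - 1)) * ENNReal.ofReal l⁻¹) *
              ∫⁻ x, g x * (if ENNReal.ofReal l < 2 * v * g x then 1 else 0)
              ∂weightMeasure w) := by ring
          _ = _ := by
              rw [← ENNReal.ofReal_mul (by positivity), Real.rpow_sub_one hl'.ne' (s - 1),
                div_eq_mul_inv]
    _ = ENNReal.ofReal s * (2 * (C * 5 ^ n) * ∫⁻ x, (∫⁻ l in Set.Ioi (0 : ℝ),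
        ENNReal.ofReal (l ^ (s - 1 - 1)) * (g x *
        (if ENNReal.ofReal l < 2 * v * g x then 1 else 0))) ∂weightMeasure w) := by
        rw [lintegral_const_mul' _ _ (by finiteness), lintegral_lintegral_swap hjm2.aemeasurable]
    _ ≤ ENNReal.ofReal s * (2 * (C * 5 ^ n) * ∫⁻ x, (ENNReal.ofReal (s - 1)⁻¹ *
        (2 * v) ^ (s - 1)) * g x ^ s ∂weightMeasure w) := by
        gcongr with x
        have : ∀ l, ENNReal.ofReal (l ^ (s - 1 - 1)) * (g x *
            (if ENNReal.ofReal l < 2 * v * g x then 1 else 0)) =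
            (ENNReal.ofReal (l ^ (s - 1 - 1)) *
              (if ENNReal.ofReal l < 2 * v * g x then 1 else 0)) * g x := fun l => by ring
        simp_rw [this]
        rw [lintegral_mul_const, lintegral_rpow_indicator_lt (by linarith),
          ENNReal.mul_rpow_of_nonneg _ _ (by linarith), mul_assoc, mul_assoc, mul_assoc]
        · gcongr
          refine le_of_eq ?_
          conv_lhs => rw [← ENNReal.rpow_one (g x)]
          rw [← ENNReal.rpow_mul, ← ENNReal.rpow_add_of_nonneg _ _ (by linarith) (by linarith)]
          ring_nf
        · refine Measurable.mul (by fun_prop) (Measurable.ite ?_ measurable_const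
            measurable_const)
          exact measurableSet_lt (by fun_prop) (by fun_prop)
    _ = _ := by
        rw [lintegral_const_mul' _ _ (by
          have : (2 * v) ^ (s - 1) ≠ ⊤ := ENNReal.rpow_ne_top_of_nonneg (by linarith) (by finiteness)
          finiteness)]
        simp only [hK]; ring

/-- An `A_1` weight that is not almost everywhere zero has critical index `1`. -/
theorem IsA1.criticalIndex_eq_one {w : Rn n → ℝ} (hw : IsA1 w) (hw0 : ¬ w =ᵐ[volume] 0) :
    criticalIndex w = 1 := by
  obtain ⟨hw, C, hC⟩ := hw
  have hA : ∀ q : ℝ, 1 < q → IsAq q w := by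
    intro q hq
    refine ⟨hw, C, fun x r hr => ?_⟩
    have hvol : volume (cube x r) = ENNReal.ofReal (r ^ n) := volume_cube x hr
    have hv0 : volume (cube x r) ≠ 0 := by rw [hvol]; simp; positivity
    have hvt : volume (cube x r) ≠ ⊤ := by rw [hvol]; simp
    set m := essInf (fun x => ENNReal.ofReal (w x)) (volume.restrict (cube x r)) with hm
    have hae : ∀ᵐ y ∂(volume.restrict (cube x r)), m ≤ ENNReal.ofReal (w y) := ae_essInf_le
    -- If the essential infimum vanishes on one cube, it vanishes on all larger concentric cubes;
    -- $A_1$ then makes the weight zero on each of them, and they exhaust the space.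
    have hm0 : m ≠ 0 := by
      intro hm0
      apply hw0
      have hlarge : ∀ k : ℕ, ∀ᵐ y ∂(volume.restrict (cube x (r + k))),
          ENNReal.ofReal (w y) = 0 := by
        intro k
        have hk := hC x (r + k) (by positivity)
        have hmono : essInf (fun x => ENNReal.ofReal (w x)) (volume.restrict (cube x (r + k)))
            = 0 := by
          refine le_antisymm ?_ zero_le
          rw [← hm0, hm]
          refine essInf_antitone_measure ?_
          refine (Measure.restrict_mono_set _ fun y hy i => (hy i).trans ?_).absolutelyContinuous
          have : (0 : ℝ) ≤ k := by positivity
          linarith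
        rw [hmono, mul_zero, nonpos_iff_eq_zero, ENNReal.div_eq_zero_iff] at hk
        rcases hk with hk | hk
        · exact (lintegral_eq_zero_iff' (aemeasurable_weight hw).restrict).1 hk
        · rw [volume_cube x (by positivity)] at hk; simp at hk
      have hun : (⋃ k : ℕ, cube x (r + k)) = Set.univ := by
        refine Set.eq_univ_of_forall fun y => ?_
        obtain ⟨k, hk⟩ := exists_nat_ge (2 * ‖y - x‖)
        refine Set.mem_iUnion.2 ⟨k, fun i => ?_⟩
        have := PiLp.norm_apply_le (y - x) i
        simp only [PiLp.sub_apply, Real.norm_eq_abs] at this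
        linarith
      have : ∀ᵐ y ∂(volume.restrict (⋃ k : ℕ, cube x (r + k))), ENNReal.ofReal (w y) = 0 :=
        (ae_restrict_iUnion_iff _ _).2 hlarge
      rw [hun, Measure.restrict_univ] at this
      filter_upwards [this] with y hy
      exact le_antisymm (ENNReal.ofReal_eq_zero.1 hy) (hw.1 y)
    have hmt : m ≠ ⊤ := by
      intro hmt
      rw [hmt] at hae
      have : ∀ᵐ y ∂(volume.restrict (cube x r)), False := by
        filter_upwards [hae] with y hy
        simp at hy
      rw [ae_iff] at this
      simp at this
      exact hv0 this
    have hq0 : 0 < q - 1 := by linarith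
    have h2 : ((∫⁻ x in cube x r, ENNReal.ofReal (w x) ^ (-1 / (q - 1))) /
        volume (cube x r)) ^ (q - 1) ≤ m⁻¹ := by
      have h3 : ∫⁻ x in cube x r, ENNReal.ofReal (w x) ^ (-1 / (q - 1)) ≤
          m ^ (-1 / (q - 1)) * volume (cube x r) := by
        rw [← setLIntegral_const]
        refine lintegral_mono_ae ?_
        filter_upwards [hae] with y hy
        rw [neg_div, ENNReal.rpow_neg, ENNReal.rpow_neg]
        exact ENNReal.inv_le_inv.2 (ENNReal.rpow_le_rpow hy (by positivity))
      calc _ ≤ (m ^ (-1 / (q - 1))) ^ (q - 1) := by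
            gcongr
            exact ENNReal.div_le_of_le_mul h3
        _ = _ := by
            rw [← ENNReal.rpow_mul, div_mul_cancel₀ _ hq0.ne', ENNReal.rpow_neg_one]
    calc _ ≤ (C * m) * m⁻¹ := by gcongr; exact hC x r hr
      _ = C := by rw [mul_assoc, ENNReal.mul_inv_cancel hm0 hmt, mul_one]
  have : {q : ℝ | 1 < q ∧ IsAq q w} = Set.Ioi 1 := by
    ext q
    exact ⟨fun h => h.1, fun h => ⟨h, hA q h⟩⟩
  rw [criticalIndex, this, csInf_Ioi]

end

section

open Metric

/-! ### Polynomially decaying kernels -/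

/-- The bracket `1 + |x| / t`. -/
def br (t : ℝ) (x : Rn n) : ℝ := 1 + ‖x‖ / t

/-- The kernel `t⁻ⁿ (1 + |x| / t)^{-B}`. -/
def ker (B t : ℝ) (x : Rn n) : ℝ := (t ^ n)⁻¹ * br t x ^ (-B)

theorem one_le_br {t : ℝ} (ht : 0 < t) (x : Rn n) : 1 ≤ br t x := by
  have : 0 ≤ ‖x‖ / t := by positivity
  unfold br
  linarith

theorem br_pos {t : ℝ} (ht : 0 < t) (x : Rn n) : 0 < br t x := one_pos.trans_le (one_le_br ht x)

theorem ker_pos (B : ℝ) {t : ℝ} (ht : 0 < t) (x : Rn n) : 0 < ker B t x := by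
  have := br_pos ht x
  unfold ker
  positivity

theorem ker_nonneg (B : ℝ) {t : ℝ} (ht : 0 < t) (x : Rn n) : 0 ≤ ker B t x := (ker_pos B ht x).le

theorem br_neg (t : ℝ) (x : Rn n) : br t (-x) = br t x := by simp [br]

theorem ker_neg (B t : ℝ) (x : Rn n) : ker B t (-x) = ker B t x := by simp [ker, br_neg]

theorem br_add_le {t : ℝ} (ht : 0 < t) (x y : Rn n) : br t (x + y) ≤ br t x * br t y := by
  unfold br
  have h1 : ‖x + y‖ / t ≤ ‖x‖ / t + ‖y‖ / t := by
    rw [← add_div]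
    gcongr
    exact norm_add_le x y
  have h2 : 0 ≤ ‖x‖ / t * (‖y‖ / t) := by positivity
  nlinarith

theorem br_sub_le {t : ℝ} (ht : 0 < t) (x y z : Rn n) :
    br t (x - z) ≤ br t (x - y) * br t (y - z) := by
  have := br_add_le ht (x - y) (y - z)
  rwa [sub_add_sub_cancel] at this

theorem br_anti {s t : ℝ} (hs : 0 < s) (hst : s ≤ t) (x : Rn n) : br t x ≤ br s x := by
  unfold br
  gcongr

theorem continuous_br (t : ℝ) : Continuous (br (n := n) t) := by
  unfold br
  fun_prop

theorem continuous_ker (B : ℝ) {t : ℝ} (ht : 0 < t) : Continuous (ker (n := n) B t) := by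
  unfold ker
  refine continuous_const.mul ((continuous_br t).rpow_const fun x => Or.inl (br_pos ht x).ne')

theorem br_rpow_neg_sub_le {t : ℝ} (ht : 0 < t) {A : ℝ} (hA : 0 ≤ A) (x y z : Rn n) :
    br t (x - y) ^ (-A) * br t (y - z) ^ (-A) ≤ br t (x - z) ^ (-A) := by
  rw [← Real.mul_rpow (br_pos ht _).le (br_pos ht _).le]
  exact Real.rpow_le_rpow_of_nonpos (br_pos ht _) (br_sub_le ht x y z) (by linarith)

/-- A shift by at most `t` changes the bracket at scale `t` by at most a factor 2. This is what
makes nontangential suprema as cheap as radial ones. -/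
theorem ker_shift_le {B t : ℝ} (hB : 0 ≤ B) (ht : 0 < t) {x y : Rn n} (hxy : ‖y - x‖ ≤ t)
    (v : Rn n) : ker B t (y - v) ≤ 2 ^ B * ker B t (x - v) := by
  have h1 : br t (x - v) ≤ 2 * br t (y - v) := by
    refine (br_sub_le ht x y v).trans ?_
    gcongr
    · exact (br_pos ht _).le
    · unfold br
      have : ‖x - y‖ / t ≤ 1 := by
        rw [div_le_one ht, norm_sub_rev]
        exact hxy
      linarith
  have h2 : br t (y - v) ^ (-B) ≤ 2 ^ B * br t (x - v) ^ (-B) := by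
    have h3 : (2 * br t (y - v)) ^ (-B) ≤ br t (x - v) ^ (-B) :=
      Real.rpow_le_rpow_of_nonpos (br_pos ht _) h1 (by linarith)
    rw [Real.mul_rpow (by norm_num) (br_pos ht _).le] at h3
    calc _ = 2 ^ B * (2 ^ (-B) * br t (y - v) ^ (-B)) := by
          rw [← mul_assoc, ← Real.rpow_add two_pos]
          simp
      _ ≤ _ := by gcongr
  unfold ker
  calc _ ≤ (t ^ n)⁻¹ * (2 ^ B * br t (x - v) ^ (-B)) := by gcongr
    _ = _ := by ring

/-- Integrals against `ker B t` are controlled by the measures of the balls of radius at least `t`. -/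
theorem lintegral_ker_measure_le {B : ℝ} (hB : n < B) :
    ∃ C : ℝ≥0, ∀ (t : ℝ), 0 < t → ∀ (ν : Measure (Rn n)) (x : Rn n) (K : ℝ≥0∞),
      (∀ ρ, t ≤ ρ → ν (closedBall x ρ) ≤ ENNReal.ofReal (ρ ^ n) * K) →
      ∫⁻ v, ENNReal.ofReal (ker B t (x - v)) ∂ν ≤ C * K := by
  have hB0 : 0 ≤ B := (Nat.cast_nonneg n).trans hB.le
  set a : ℝ := 2 ^ ((n : ℝ) - B) with ha
  have ha0 : 0 < a := by positivity
  have ha1 : a < 1 := by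
    rw [ha]
    exact Real.rpow_lt_one_of_one_lt_of_neg one_lt_two (by linarith)
  have hsum : ∑' k : ℕ, ENNReal.ofReal (2 ^ B) * ENNReal.ofReal a ^ k ≠ ⊤ := by
    rw [ENNReal.tsum_mul_left, ENNReal.tsum_geometric]
    refine ENNReal.mul_ne_top (by finiteness) (ENNReal.inv_ne_top.2 ?_)
    rw [ne_eq, tsub_eq_zero_iff_le, not_le]
    simpa using ha1
  refine ⟨(∑' k : ℕ, ENNReal.ofReal (2 ^ B) * ENNReal.ofReal a ^ k).toNNReal,
    fun t ht ν x K hK => ?_⟩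
  rw [ENNReal.coe_toNNReal hsum]
  have hpt : ∀ v, ENNReal.ofReal (ker B t (x - v)) ≤
      ∑' k : ℕ, ENNReal.ofReal ((t ^ n)⁻¹ * 2 ^ B * (2 ^ (-B)) ^ k) *
        (closedBall x (2 ^ k * t)).indicator 1 v := by
    intro v
    -- The index `k` is the least one whose dyadic ball contains `v`. Outside the previous ball the
    -- bracket is only at least $2^{k-1}$, whence the extra $2^B$. Radii below `t` never occur.
    obtain ⟨k, hk⟩ : ∃ k : ℕ, ‖x - v‖ ≤ 2 ^ k * t ∧ br t (x - v) ^ (-B) ≤ 2 ^ B * (2 ^ (-B)) ^ k := by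
      have hex : ∃ k : ℕ, ‖x - v‖ ≤ 2 ^ k * t := by
        obtain ⟨k, hk⟩ := pow_unbounded_of_one_lt (‖x - v‖ / t) one_lt_two
        exact ⟨k, by rw [div_lt_iff₀ ht] at hk; exact hk.le⟩
      classical
      refine ⟨Nat.find hex, Nat.find_spec hex, ?_⟩
      rcases hN : Nat.find hex with _ | j
      · rw [pow_zero, mul_one]
        calc br t (x - v) ^ (-B) ≤ 1 :=
              Real.rpow_le_one_of_one_le_of_nonpos (one_le_br ht _) (by linarith)
          _ ≤ _ := Real.one_le_rpow one_le_two hB0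
      · have hj : ¬ ‖x - v‖ ≤ 2 ^ j * t := Nat.find_min hex (by omega)
        have h1 : (2 : ℝ) ^ j ≤ br t (x - v) := by
          have : (2 : ℝ) ^ j ≤ ‖x - v‖ / t := by
            rw [le_div_iff₀ ht]
            exact (not_le.1 hj).le
          unfold br
          linarith
        calc br t (x - v) ^ (-B) ≤ ((2 : ℝ) ^ j) ^ (-B) :=
              Real.rpow_le_rpow_of_nonpos (by positivity) h1 (by linarith)
          _ = (2 ^ (-B)) ^ j := by
              rw [← Real.rpow_natCast, ← Real.rpow_natCast, ← Real.rpow_mul (by norm_num),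
                ← Real.rpow_mul (by norm_num), mul_comm]
          _ = 2 ^ B * (2 ^ (-B)) ^ (j + 1) := by
              rw [pow_succ', ← mul_assoc, ← Real.rpow_add two_pos]
              simp
    refine le_trans ?_ (ENNReal.le_tsum k)
    rw [Set.indicator_of_mem (by rw [mem_closedBall, dist_comm, dist_eq_norm]; exact hk.1), Pi.one_apply, mul_one]
    gcongr
    unfold ker
    rw [mul_assoc]
    gcongr
    exact hk.2
  calc _ ≤ ∫⁻ v, ∑' k : ℕ, ENNReal.ofReal ((t ^ n)⁻¹ * 2 ^ B * (2 ^ (-B)) ^ k) *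
        (closedBall x (2 ^ k * t)).indicator 1 v ∂ν := lintegral_mono hpt
    _ = ∑' k : ℕ, ENNReal.ofReal ((t ^ n)⁻¹ * 2 ^ B * (2 ^ (-B)) ^ k) *
        ν (closedBall x (2 ^ k * t)) := by
        rw [lintegral_tsum fun k =>
          ((measurable_one.indicator measurableSet_closedBall).const_mul _).aemeasurable]
        refine tsum_congr fun k => ?_
        rw [lintegral_const_mul' _ _ (by finiteness), lintegral_indicator_one measurableSet_closedBall]
    _ ≤ ∑' k : ℕ, ENNReal.ofReal ((t ^ n)⁻¹ * 2 ^ B * (2 ^ (-B)) ^ k) *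
        (ENNReal.ofReal ((2 ^ k * t) ^ n) * K) := by
        gcongr with k
        refine hK _ (le_mul_of_one_le_left ht.le (one_le_pow₀ one_le_two))
    _ = ∑' k : ℕ, ENNReal.ofReal (2 ^ B) * ENNReal.ofReal a ^ k * K := by
        refine tsum_congr fun k => ?_
        rw [← mul_assoc, ← ENNReal.ofReal_mul (by positivity), ← ENNReal.ofReal_pow (by positivity),
          ← ENNReal.ofReal_mul (by positivity)]
        congr 2
        have : a ^ k = (2 ^ (-B)) ^ k * (2 ^ k) ^ n := by
          rw [ha, ← pow_mul, mul_comm k n, pow_mul, ← mul_pow, sub_eq_add_neg, add_comm,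
            Real.rpow_add two_pos, Real.rpow_natCast]
        rw [this, mul_pow]
        field_simp
    _ = _ := ENNReal.tsum_mul_right

theorem lintegral_ker_mul_le {B : ℝ} (hB : n < B) :
    ∃ C : ℝ≥0, ∀ (t : ℝ), 0 < t → ∀ g : Rn n → ℝ≥0∞, Measurable g → ∀ x,
      ∫⁻ v, ENNReal.ofReal (ker B t (x - v)) * g v ≤ C * hlMax g x := by
  obtain ⟨C, hC⟩ := lintegral_ker_measure_le hB
  refine ⟨C, fun t ht g hg x => ?_⟩
  have h := hC t ht (volume.withDensity g) x (hlMax g x) fun ρ hρ => by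
    rw [withDensity_apply _ measurableSet_closedBall]
    exact lintegral_closedBall_le_hlMax g x (ht.trans_le hρ)
  have hm : Measurable fun v => ENNReal.ofReal (ker B t (x - v)) :=
    ((continuous_ker B ht).measurable.comp (measurable_const.sub measurable_id)).ennreal_ofReal
  rw [lintegral_withDensity_eq_lintegral_mul _ hg hm] at h
  simpa only [Pi.mul_apply, mul_comm] using h

theorem lintegral_ker_le {B : ℝ} (hB : n < B) :
    ∃ C : ℝ≥0, ∀ (t : ℝ), 0 < t → ∀ x : Rn n,
      ∫⁻ v, ENNReal.ofReal (ker B t (x - v)) ≤ C := by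
  obtain ⟨C, hC⟩ := lintegral_ker_mul_le hB
  have h1 : ∀ x : Rn n, hlMax (fun _ => 1) x ≤ unitVol n := by
    intro x
    refine iSup₂_le fun ρ hρ => ?_
    rw [setLIntegral_one, volume_closedBall_eq x hρ.le, ← mul_assoc,
      ← ENNReal.ofReal_mul (by positivity), inv_mul_cancel₀ (by positivity)]
    simp
  refine ⟨C * (unitVol n).toNNReal, fun t ht x => ?_⟩
  have := hC t ht (fun _ => 1) measurable_const x
  simp only [mul_one] at this
  refine this.trans ?_
  rw [ENNReal.coe_mul, ENNReal.coe_toNNReal (unitVol_ne_top n)]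
  gcongr
  exact h1 x

/-- Composition of two decaying kernels with different scales. -/
theorem lintegral_ker_mul_ker_le {q L : ℝ} (hq : n < q) (hL : 0 < L) (hqL : q ≤ L + n) :
    ∃ C : ℝ≥0, ∀ s t : ℝ, 0 < s → 0 < t → ∀ x z : Rn n,
      ENNReal.ofReal (min 1 ((s / t) ^ L)) *
        ∫⁻ u, ENNReal.ofReal (ker (L + n) t (x - u)) * ENNReal.ofReal (ker q s (u - z)) ≤
      C * ENNReal.ofReal (ker q s (x - z)) := by
  obtain ⟨C₁, h₁⟩ := lintegral_ker_le (n := n) (B := L + n) (by linarith)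
  obtain ⟨C₂, h₂⟩ := lintegral_ker_le (n := n) hq
  have hn0 : (0 : ℝ) ≤ n := Nat.cast_nonneg n
  have hq0 : 0 < q := hn0.trans_lt hq
  refine ⟨(2 ^ q : ℝ).toNNReal * (C₁ + C₂), fun s t hs ht x z => ?_⟩
  set μ : ℝ := min 1 ((s / t) ^ L) with hμ
  have hμ0 : 0 ≤ μ := le_min zero_le_one (by positivity)
  have hbx := br_pos hs (x - z)
  -- The product of two kernels is dominated by the target kernel times the sum of the two, which
  -- integrates to a constant. Multiplying by `br s (x - z) ^ q` splits the bracket: one part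
  -- cancels the kernel at scale `s`, the other is absorbed by the kernel at scale `t`.
  have hpt : ∀ u : Rn n, μ * (ker (L + n) t (x - u) * ker q s (u - z)) ≤
      2 ^ q * ker q s (x - z) * (ker (L + n) t (x - u) + ker q s (u - z)) := by
    intro u
    have hb := br_pos hs (u - z)
    have hbt := br_pos ht (x - u)
    have hk1 := ker_nonneg (L + n) ht (x - u)
    have hk2 := ker_nonneg q hs (u - z)
    have e1 : br s (x - z) ^ q ≤ 2 ^ q * (br s (u - z) ^ q + (‖x - u‖ / s) ^ q) := by
      have h0 : 0 ≤ ‖x - u‖ / s := by positivity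
      have h3 : br s (x - z) ≤ br s (u - z) + ‖x - u‖ / s := by
        unfold br
        rw [add_assoc, ← add_div]
        gcongr
        have := norm_add_le (u - z) (x - u)
        rwa [show u - z + (x - u) = x - z by abel] at this
      have h4 : br s (x - z) ≤ 2 * max (br s (u - z)) (‖x - u‖ / s) := by
        have := le_max_left (br s (u - z)) (‖x - u‖ / s)
        have := le_max_right (br s (u - z)) (‖x - u‖ / s)
        linarith
      calc br s (x - z) ^ q ≤ (2 * max (br s (u - z)) (‖x - u‖ / s)) ^ q := by gcongr
        _ = 2 ^ q * (max (br s (u - z)) (‖x - u‖ / s)) ^ q :=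
            Real.mul_rpow (by norm_num) (h0.trans (le_max_right _ _))
        _ ≤ _ := by
            gcongr
            rcases max_choice (br s (u - z)) (‖x - u‖ / s) with h | h <;> rw [h]
            · have := Real.rpow_nonneg h0 q
              linarith
            · have := Real.rpow_nonneg hb.le q
              linarith
    have e2 : μ * (ker (L + n) t (x - u) * (‖x - u‖ / s) ^ q) ≤ (s ^ n)⁻¹ := by
      have e3 : br t (x - u) ^ (-(L + n)) * (‖x - u‖ / t) ^ q ≤ 1 := by
        calc _ ≤ br t (x - u) ^ (-q) * br t (x - u) ^ q := by
              gcongr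
              · exact one_le_br ht _
              · unfold br; linarith
          _ = 1 := by rw [← Real.rpow_add hbt]; simp
      have e4 : (‖x - u‖ / s) ^ q = (‖x - u‖ / t) ^ q * (t / s) ^ q := by
        rw [← Real.mul_rpow (by positivity) (by positivity)]
        congr 1
        field_simp
      -- For $t \le s$ this uses $q > n$. For $t \ge s$ the factor $(s/t)^L$ brings the exponent
      -- down to $q - L \le n$.
      have e5 : μ * (t / s) ^ q ≤ (t / s) ^ n := by
        rw [← Real.rpow_natCast (t / s) n]
        rcases le_total t s with h | h
        · calc _ ≤ 1 * (t / s) ^ q := by gcongr; exact min_le_left _ _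
            _ ≤ _ := by
              rw [one_mul]
              exact Real.rpow_le_rpow_of_exponent_ge (by positivity) (by rwa [div_le_one hs]) hq.le
        · calc _ ≤ (s / t) ^ L * (t / s) ^ q := by gcongr; exact min_le_right _ _
            _ = (t / s) ^ (q - L) := by
              rw [← inv_div t s, Real.inv_rpow (by positivity), ← Real.rpow_neg (by positivity),
                ← Real.rpow_add (by positivity)]
              ring_nf
            _ ≤ _ := Real.rpow_le_rpow_of_exponent_le (by rwa [one_le_div hs]) (by linarith)
      calc _ = (t ^ n)⁻¹ * (br t (x - u) ^ (-(L + n)) * (‖x - u‖ / t) ^ q) *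
            (μ * (t / s) ^ q) := by rw [e4]; unfold ker; ring
        _ ≤ (t ^ n)⁻¹ * 1 * (t / s) ^ n := by gcongr
        _ = _ := by rw [div_pow]; field_simp
    have e6 : ker q s (u - z) * br s (u - z) ^ q = (s ^ n)⁻¹ := by
      unfold ker
      rw [mul_assoc, ← Real.rpow_add hb]
      simp
    have e7 : ker q s (x - z) * br s (x - z) ^ q = (s ^ n)⁻¹ := by
      unfold ker
      rw [mul_assoc, ← Real.rpow_add hbx]
      simp
    have hpos : 0 < br s (x - z) ^ q := by positivity
    refine le_of_mul_le_mul_right ?_ hpos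
    calc _ ≤ μ * (ker (L + n) t (x - u) * ker q s (u - z)) *
          (2 ^ q * (br s (u - z) ^ q + (‖x - u‖ / s) ^ q)) := by gcongr
      _ = 2 ^ q * (μ * ker (L + n) t (x - u) * (ker q s (u - z) * br s (u - z) ^ q) +
          (μ * (ker (L + n) t (x - u) * (‖x - u‖ / s) ^ q)) * ker q s (u - z)) := by ring
      _ ≤ 2 ^ q * (1 * ker (L + n) t (x - u) * (s ^ n)⁻¹ + (s ^ n)⁻¹ * ker q s (u - z)) := by
          rw [e6]
          gcongr
          exact min_le_left _ _
      _ = 2 ^ q * (s ^ n)⁻¹ * (ker (L + n) t (x - u) + ker q s (u - z)) := by ring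
      _ = _ := by rw [← e7]; ring
  have hc1 : Measurable fun u : Rn n => ENNReal.ofReal (ker (L + n) t (x - u)) :=
    ((continuous_ker (L + n) ht).comp (by fun_prop)).measurable.ennreal_ofReal
  calc _ = ∫⁻ u, ENNReal.ofReal (μ * (ker (L + n) t (x - u) * ker q s (u - z))) := by
        rw [← lintegral_const_mul' _ _ (by finiteness)]
        refine lintegral_congr fun u => ?_
        rw [ENNReal.ofReal_mul hμ0, ENNReal.ofReal_mul (ker_nonneg _ ht _)]
    _ ≤ ∫⁻ u, ENNReal.ofReal (2 ^ q * ker q s (x - z)) * (ENNReal.ofReal (ker (L + n) t (x - u)) +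
        ENNReal.ofReal (ker q s (z - u))) := by
        refine lintegral_mono fun u => ?_
        rw [← ENNReal.ofReal_add (ker_nonneg _ ht _) (ker_nonneg _ hs _),
          ← ENNReal.ofReal_mul (mul_nonneg (by positivity) (ker_nonneg _ hs _))]
        refine ENNReal.ofReal_le_ofReal ?_
        rw [← neg_sub u z, ker_neg]
        exact hpt u
    _ ≤ ENNReal.ofReal (2 ^ q * ker q s (x - z)) * (C₁ + C₂) := by
        rw [lintegral_const_mul' _ _ (by finiteness), lintegral_add_left hc1]
        gcongr
        · exact h₁ t ht x
        · exact h₂ s hs z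
    _ = _ := by
        rw [ENNReal.ofReal_mul (by positivity), ENNReal.coe_mul, ENNReal.coe_add]
        simp only [ENNReal.ofReal]
        ring

end

/-! ### Translations, dilations and convolutions of Schwartz functions -/

/-- The reflection `y ↦ a (-y)`. -/
def reflect (a : 𝓢(Rn n, ℂ)) : 𝓢(Rn n, ℂ) :=
  SchwartzMap.compCLMOfContinuousLinearEquiv ℂ (ContinuousLinearEquiv.neg ℝ (M := Rn n)) a

/-- The reflected translate `y ↦ a (x - y)`. -/
def tr (a : 𝓢(Rn n, ℂ)) (x : Rn n) : 𝓢(Rn n, ℂ) :=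
  SchwartzMap.compSubConstCLM ℂ x (reflect a)

open Classical in
/-- The dilate `y ↦ t⁻ⁿ a (y / t)` for `t > 0`. -/
def dil (a : 𝓢(Rn n, ℂ)) (t : ℝ) : 𝓢(Rn n, ℂ) :=
  if ht : 0 < t then
    ((t : ℂ) ^ n)⁻¹ • SchwartzMap.compCLMOfContinuousLinearEquiv ℂ
      (ContinuousLinearEquiv.smulLeft (R₁ := ℝ) (M₁ := Rn n)
        (Units.mk0 t⁻¹ (inv_ne_zero ht.ne'))) a
  else 0

/-- The convolution of two Schwartz functions. -/
def cnv (a b : 𝓢(Rn n, ℂ)) : 𝓢(Rn n, ℂ) :=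
  SchwartzMap.convolution (ContinuousLinearMap.mul ℂ ℂ) a b

/-- The convolution of a Schwartz function and a tempered distribution. -/
def cv (a : 𝓢(Rn n, ℂ)) (f : 𝓢'(Rn n, ℂ)) (x : Rn n) : ℂ := f (tr a x)

theorem reflect_apply (a : 𝓢(Rn n, ℂ)) (x : Rn n) : reflect a x = a (-x) := rfl

theorem tr_apply (a : 𝓢(Rn n, ℂ)) (x y : Rn n) : tr a x y = a (x - y) := by
  simp [tr, reflect_apply]

theorem dil_apply (a : 𝓢(Rn n, ℂ)) {t : ℝ} (ht : 0 < t) (y : Rn n) :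
    dil a t y = ((t : ℂ) ^ n)⁻¹ * a (t⁻¹ • y) := by
  simp [dil, ht, Units.smul_def]

theorem dilTrans_eq (a : 𝓢(Rn n, ℂ)) (t : ℝ) (ht : 0 < t) (x : Rn n) :
    dilTrans a t ht x = tr (dil a t) x := by
  ext y
  rw [dilTrans_apply, tr_apply, dil_apply a ht]

theorem convDil_eq (a : 𝓢(Rn n, ℂ)) (t : ℝ) (ht : 0 < t) (f : 𝓢'(Rn n, ℂ)) (x : Rn n) :
    convDil a t ht f x = cv (dil a t) f x := by
  rw [convDil, dilTrans_eq, cv]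

theorem cnv_apply (a b : 𝓢(Rn n, ℂ)) (x : Rn n) : cnv a b x = ∫ v, a (x - v) * b v := by
  rw [cnv, SchwartzMap.convolution_apply, convolution_eq_swap]
  rfl

theorem fourier_cnv (a b : 𝓢(Rn n, ℂ)) (ξ : Rn n) : 𝓕 (cnv a b) ξ = 𝓕 a ξ * 𝓕 b ξ := by
  rw [cnv, SchwartzMap.fourier_convolution]
  rfl

/-- Reduces the algebra of convolutions, dilations and derivatives to pointwise products on the
Fourier side. -/
theorem ext_fourier {a b : 𝓢(Rn n, ℂ)} (h : ∀ ξ, 𝓕 a ξ = 𝓕 b ξ) : a = b := by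
  have h1 : 𝓕 a = 𝓕 b := SchwartzMap.ext h
  have h2 := congrArg (fun u : 𝓢(Rn n, ℂ) => (𝓕⁻ u : 𝓢(Rn n, ℂ))) h1
  simpa using h2

theorem cnv_comm (a b : 𝓢(Rn n, ℂ)) : cnv a b = cnv b a :=
  ext_fourier fun ξ => by rw [fourier_cnv, fourier_cnv, mul_comm]

theorem cnv_assoc (a b c : 𝓢(Rn n, ℂ)) : cnv (cnv a b) c = cnv a (cnv b c) :=
  ext_fourier fun ξ => by simp only [fourier_cnv, mul_assoc]

theorem fourier_dil (a : 𝓢(Rn n, ℂ)) {t : ℝ} (ht : 0 < t) (ξ : Rn n) :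
    𝓕 (dil a t) ξ = 𝓕 a (t • ξ) := by
  rw [SchwartzMap.fourier_coe, SchwartzMap.fourier_coe, Real.fourier_eq, Real.fourier_eq]
  have h := Measure.integral_comp_inv_smul_of_nonneg (volume : Measure (Rn n))
    (fun v => Real.fourierChar (-inner ℝ v (t • ξ)) • a v) ht.le
  rw [finrank_euclideanSpace_fin] at h
  have h2 : ∀ v : Rn n, Real.fourierChar (-inner ℝ v ξ) • dil a t v =
      ((t : ℂ) ^ n)⁻¹ * (Real.fourierChar (-inner ℝ (t⁻¹ • v) (t • ξ)) • a (t⁻¹ • v)) := by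
    intro v
    rw [dil_apply a ht, inner_smul_left, inner_smul_right]
    simp only [conj_trivial, inv_mul_cancel_left₀ ht.ne', Circle.smul_def, smul_eq_mul]
    ring
  simp_rw [h2]
  rw [integral_const_mul, h, Complex.real_smul]
  have : (t : ℂ) ≠ 0 := by exact_mod_cast ht.ne'
  push_cast
  field_simp

theorem dil_cnv (a b : 𝓢(Rn n, ℂ)) {t : ℝ} (ht : 0 < t) :
    dil (cnv a b) t = cnv (dil a t) (dil b t) :=
  ext_fourier fun ξ => by simp only [fourier_cnv, fourier_dil _ ht]

theorem dil_dil (a : 𝓢(Rn n, ℂ)) {s t : ℝ} (hs : 0 < s) (ht : 0 < t) :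
    dil (dil a s) t = dil a (s * t) :=
  ext_fourier fun ξ => by
    simp only [fourier_dil _ hs, fourier_dil _ ht, fourier_dil _ (mul_pos hs ht), smul_smul]

theorem dil_add (a b : 𝓢(Rn n, ℂ)) {t : ℝ} (ht : 0 < t) : dil (a + b) t = dil a t + dil b t := by
  ext y
  simp only [dil_apply _ ht, _root_.add_apply]
  ring

theorem dil_one (a : 𝓢(Rn n, ℂ)) : dil a 1 = a := by
  ext y
  simp [dil_apply a one_pos]

theorem cnv_add (a b c : 𝓢(Rn n, ℂ)) : cnv a (b + c) = cnv a b + cnv a c :=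
  ext_fourier fun ξ => by
    simp only [FourierTransform.fourier_add, _root_.add_apply, fourier_cnv]; ring

theorem cv_add (a b : 𝓢(Rn n, ℂ)) (f : 𝓢'(Rn n, ℂ)) (x : Rn n) :
    cv (a + b) f x = cv a f x + cv b f x := by
  have : tr (a + b) x = tr a x + tr b x := by
    ext y
    simp [tr_apply]
  rw [cv, this, map_add]
  rfl

theorem norm_dil_le {a : 𝓢(Rn n, ℂ)} {c B : ℝ} (h : ∀ x, ‖a x‖ ≤ c * ker B 1 x) {t : ℝ}
    (ht : 0 < t) (x : Rn n) : ‖dil a t x‖ ≤ c * ker B t x := by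
  rw [dil_apply a ht, norm_mul, norm_inv, norm_pow, Complex.norm_real, Real.norm_of_nonneg ht.le]
  have h1 := h (t⁻¹ • x)
  have h2 : br 1 (t⁻¹ • x) = br t x := by
    simp only [br, norm_smul, norm_inv, Real.norm_of_nonneg ht.le]
    ring
  rw [ker, h2] at h1
  calc _ ≤ (t ^ n)⁻¹ * (c * ((1 ^ n)⁻¹ * br t x ^ (-B))) := by gcongr
    _ = _ := by simp [ker]; ring

/-- Schwartz functions decay rapidly. -/
theorem exists_norm_le_ker (a : 𝓢(Rn n, ℂ)) (B : ℝ) :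
    ∃ c : ℝ, 0 ≤ c ∧ ∀ x, ‖a x‖ ≤ c * ker B 1 x := by
  obtain ⟨k, hk⟩ := exists_nat_ge B
  have h := SchwartzMap.one_add_le_sup_seminorm_apply (𝕜 := ℂ) (m := (k, 0)) (k := k) (n := 0)
    le_rfl le_rfl a
  refine ⟨2 ^ k * ((Finset.Iic (k, 0)).sup fun m => SchwartzMap.seminorm ℂ m.1 m.2) a,
    by positivity, fun x => ?_⟩
  have h1 := h x
  rw [norm_iteratedFDeriv_zero] at h1
  have hb : br 1 x = 1 + ‖x‖ := by simp [br]
  have hp : 0 < 1 + ‖x‖ := by positivity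
  have h2 : ‖a x‖ * (1 + ‖x‖) ^ B ≤ (1 + ‖x‖) ^ k * ‖a x‖ := by
    rw [mul_comm]
    gcongr
    rw [← Real.rpow_natCast]
    exact Real.rpow_le_rpow_of_exponent_le (by linarith [norm_nonneg x]) hk
  rw [ker, hb, Real.rpow_neg hp.le]
  simp only [one_pow, inv_one, one_mul]
  rw [← div_eq_mul_inv, le_div_iff₀ (by positivity)]
  exact h2.trans h1

section

open LineDeriv

/-! ### Seminorm estimates and the exchange of a distribution with an integral -/

theorem iteratedFDeriv_tr (a : 𝓢(Rn n, ℂ)) (x y : Rn n) (l : ℕ) :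
    iteratedFDeriv ℝ l (tr a x) y = iteratedFDeriv ℝ l (reflect a) (y - x) :=
  iteratedFDeriv_comp_sub (f := reflect a) l x y

theorem norm_iteratedFDeriv_reflect (a : 𝓢(Rn n, ℂ)) (y : Rn n) (l : ℕ) :
    ‖iteratedFDeriv ℝ l (reflect a) y‖ = ‖iteratedFDeriv ℝ l a (-y)‖ :=
  LinearIsometryEquiv.norm_iteratedFDeriv_comp_right (LinearIsometryEquiv.neg ℝ) a y l

theorem norm_iteratedFDeriv_dil (a : 𝓢(Rn n, ℂ)) {t : ℝ} (ht : 0 < t) (y : Rn n) (l : ℕ) :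
    ‖iteratedFDeriv ℝ l (dil a t) y‖ = (t⁻¹) ^ (n + l) * ‖iteratedFDeriv ℝ l a (t⁻¹ • y)‖ := by
  have h1 : ⇑(dil a t) = ((t : ℂ) ^ n)⁻¹ • fun y => a (t⁻¹ • y) := by
    ext y
    simp [dil_apply a ht]
  have h2 : ContDiff ℝ l fun y => a (t⁻¹ • y) := (a.smooth l).comp (contDiff_const_smul _)
  rw [h1, iteratedFDeriv_const_smul_apply h2.contDiffAt,
    iteratedFDeriv_comp_const_smul _ (a.smooth l), norm_smul, norm_smul, pow_add]
  simp [abs_of_pos ht]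
  ring

theorem exists_seminorm_bound (f : 𝓢'(Rn n, ℂ)) : ∃ (s : Finset (ℕ × ℕ)) (C : ℝ≥0),
    ∀ u, ‖f u‖ ≤ C * (s.sup (schwartzSeminormFamily ℂ (Rn n) ℂ)) u := by
  have hf : Continuous fun u => f u := f.cont
  obtain ⟨s, C, -, h⟩ := Seminorm.bound_of_continuous (schwartz_withSeminorms ℂ (Rn n) ℂ)
    ((normSeminorm ℂ ℂ).comp f.toLinearMap) (by exact hf.norm)
  exact ⟨s, C, fun u => h u⟩

/-- With $z = (x-y)/t$, the weight obeys $|y| \le (1+T)(1+|x|)(1+|z|)$, and the decay of the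
derivatives of `a` absorbs the powers of $1+|z|$. Polynomial growth in $x$ and $1/t$ is all that is
known of `f` a priori. -/
theorem seminorm_tr_dil_le (a : 𝓢(Rn n, ℂ)) (k l : ℕ) : ∃ c : ℝ, 0 ≤ c ∧ ∀ T t : ℝ, 0 < t → t ≤ T →
    ∀ x : Rn n, SchwartzMap.seminorm ℂ k l (tr (dil a t) x) ≤
      c * (1 + T) ^ k * (t⁻¹) ^ (n + l) * (1 + ‖x‖) ^ k := by
  have h := SchwartzMap.one_add_le_sup_seminorm_apply (𝕜 := ℂ) (m := (k, l)) (k := k) (n := l)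
    le_rfl le_rfl a
  set c := 2 ^ k * ((Finset.Iic (k, l)).sup fun m => SchwartzMap.seminorm ℂ m.1 m.2) a
  refine ⟨c, by positivity, fun T t ht htT x => ?_⟩
  have hT : 0 < T := ht.trans_le htT
  refine SchwartzMap.seminorm_le_bound ℂ k l _ (by positivity) fun y => ?_
  rw [iteratedFDeriv_tr, norm_iteratedFDeriv_reflect, norm_iteratedFDeriv_dil a ht, neg_sub]
  set z := t⁻¹ • (x - y) with hz
  have h1 : ‖y‖ ≤ (1 + T) * (1 + ‖x‖) * (1 + ‖z‖) := by
    have h2 : x - y = t • z := by rw [hz, smul_inv_smul₀ ht.ne']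
    have h3 : ‖x - y‖ ≤ T * ‖z‖ := by
      rw [h2, norm_smul, Real.norm_of_nonneg ht.le]
      gcongr
    have h4 : ‖y‖ ≤ ‖x‖ + ‖x - y‖ := by
      have := norm_sub_le x (x - y)
      simpa using this
    have := mul_nonneg (mul_nonneg hT.le (norm_nonneg x)) (norm_nonneg z)
    have := mul_nonneg (norm_nonneg x) (norm_nonneg z)
    have := mul_nonneg hT.le (norm_nonneg z)
    have := mul_nonneg hT.le (norm_nonneg x)
    have := norm_nonneg x
    have := norm_nonneg z
    nlinarith
  calc ‖y‖ ^ k * ((t⁻¹) ^ (n + l) * ‖iteratedFDeriv ℝ l a z‖)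
      ≤ ((1 + T) * (1 + ‖x‖) * (1 + ‖z‖)) ^ k * ((t⁻¹) ^ (n + l) *
        ‖iteratedFDeriv ℝ l a z‖) := by gcongr
    _ = (1 + T) ^ k * (t⁻¹) ^ (n + l) * (1 + ‖x‖) ^ k *
        ((1 + ‖z‖) ^ k * ‖iteratedFDeriv ℝ l a z‖) := by rw [mul_pow, mul_pow]; ring
    _ ≤ (1 + T) ^ k * (t⁻¹) ^ (n + l) * (1 + ‖x‖) ^ k * c := by gcongr; exact h z
    _ = _ := by ring

/-- Polynomial bounds for the convolutions of a tempered distribution. -/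
theorem exists_cv_dil_le (a : 𝓢(Rn n, ℂ)) (f : 𝓢'(Rn n, ℂ)) : ∃ k : ℕ, ∀ T : ℝ, 0 < T →
    ∃ c : ℝ, 0 ≤ c ∧ ∀ t, 0 < t → t ≤ T → ∀ x : Rn n,
      ‖cv (dil a t) f x‖ ≤ c * (t⁻¹) ^ k * (1 + ‖x‖) ^ k := by
  obtain ⟨s, C, hC⟩ := exists_seminorm_bound f
  choose c hc0 hc using fun i : ℕ × ℕ => seminorm_tr_dil_le a i.1 i.2
  set k := ∑ i ∈ s, (i.1 + (n + i.2)) with hk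
  refine ⟨k, fun T hT => ⟨C * (∑ i ∈ s, c i) * (1 + T) ^ k * (1 + T) ^ k, ?_, fun t ht htT x => ?_⟩⟩
  · have : 0 ≤ ∑ i ∈ s, c i := Finset.sum_nonneg fun i _ => hc0 i
    positivity
  have hsum : 0 ≤ ∑ i ∈ s, c i := Finset.sum_nonneg fun i _ => hc0 i
  refine (hC _).trans ?_
  have h1 : (s.sup (schwartzSeminormFamily ℂ (Rn n) ℂ)) (tr (dil a t) x) ≤
      (∑ i ∈ s, c i) * (1 + T) ^ k * ((1 + T) ^ k * (t⁻¹) ^ k) * (1 + ‖x‖) ^ k := by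
    refine Seminorm.finset_sup_apply_le (by positivity) fun i hi => ?_
    have hik : i.1 + (n + i.2) ≤ k := Finset.single_le_sum (f := fun i : ℕ × ℕ => i.1 + (n + i.2))
      (fun _ _ => Nat.zero_le _) hi
    refine (hc i T t ht htT x).trans ?_
    have e1 : (t⁻¹) ^ (n + i.2) ≤ (1 + T) ^ k * (t⁻¹) ^ k := by
      have h1T : 1 ≤ (1 + T) * t⁻¹ := by
        rw [← div_eq_mul_inv, le_div_iff₀ ht]
        linarith
      calc (t⁻¹) ^ (n + i.2) ≤ ((1 + T) * t⁻¹) ^ (n + i.2) := by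
            gcongr
            have : 0 ≤ T * t⁻¹ := by positivity
            linarith
        _ ≤ ((1 + T) * t⁻¹) ^ k := pow_le_pow_right₀ h1T (by omega)
        _ = _ := mul_pow _ _ _
    have e2 : c i ≤ ∑ i ∈ s, c i := Finset.single_le_sum (fun i _ => hc0 i) hi
    have e3 : (1 + T) ^ i.1 ≤ (1 + T) ^ k := pow_le_pow_right₀ (by linarith) (by omega)
    have e4 : (1 + ‖x‖) ^ i.1 ≤ (1 + ‖x‖) ^ k :=
      pow_le_pow_right₀ (by linarith [norm_nonneg x]) (by omega)
    have := hc0 i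
    gcongr
  calc _ ≤ (C : ℝ) * ((∑ i ∈ s, c i) * (1 + T) ^ k * ((1 + T) ^ k * (t⁻¹) ^ k) *
        (1 + ‖x‖) ^ k) := by gcongr
    _ = _ := by ring

theorem exists_cv_le (a : 𝓢(Rn n, ℂ)) (f : 𝓢'(Rn n, ℂ)) :
    ∃ (k : ℕ) (c : ℝ), 0 ≤ c ∧ ∀ x : Rn n, ‖cv a f x‖ ≤ c * (1 + ‖x‖) ^ k := by
  obtain ⟨k, h⟩ := exists_cv_dil_le a f
  obtain ⟨c, hc, h⟩ := h 1 one_pos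
  refine ⟨k, c, hc, fun x => ?_⟩
  simpa [dil_one] using h 1 one_pos le_rfl x

/-- For each seminorm, the mean value inequality for the `l`-th derivative, with the weight $|y|^k$
frozen, gives a Lipschitz bound near each point. -/
theorem continuous_tr (a : 𝓢(Rn n, ℂ)) : Continuous (tr a) := by
  refine continuous_iff_continuousAt.2 fun x₀ => ?_
  rw [ContinuousAt, (schwartz_withSeminorms ℂ (Rn n) ℂ).tendsto_nhds]
  rintro ⟨k, l⟩ ε hε
  set b := reflect a with hb
  have h := SchwartzMap.one_add_le_sup_seminorm_apply (𝕜 := ℂ) (m := (k, l + 1)) (k := k)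
    (n := l + 1) le_rfl le_rfl b
  set c := 2 ^ k * ((Finset.Iic (k, l + 1)).sup fun m => SchwartzMap.seminorm ℂ m.1 m.2) b
  have hc : 0 ≤ c := by positivity
  set D := c * (2 + ‖x₀‖) ^ k with hD
  have hD0 : 0 ≤ D := by positivity
  have key : ∀ x, ‖x - x₀‖ ≤ 1 → SchwartzMap.seminorm ℂ k l (tr a x - tr a x₀) ≤
      D * ‖x - x₀‖ := by
    intro x hx
    refine SchwartzMap.seminorm_le_bound ℂ k l _ (by positivity) fun y => ?_
    have h1 : iteratedFDeriv ℝ l (⇑(tr a x - tr a x₀)) y =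
        iteratedFDeriv ℝ l b (y - x) - iteratedFDeriv ℝ l b (y - x₀) := by
      rw [← iteratedFDeriv_tr, ← iteratedFDeriv_tr]
      exact iteratedFDeriv_sub_apply ((tr a x).contDiffAt l) ((tr a x₀).contDiffAt l)
    have hdiff : Differentiable ℝ (iteratedFDeriv ℝ l b) :=
      (b.smooth ⊤).differentiable_iteratedFDeriv (mod_cast ENat.natCast_lt_top l)
    have h2 := Convex.norm_image_sub_le_of_norm_fderiv_le (𝕜 := ℝ)
      (f := fun z => ‖y‖ ^ k • iteratedFDeriv ℝ l b z) (C := D)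
      (s := Metric.closedBall (y - x₀) 1) (x := y - x₀) (y := y - x)
      (fun z _ => (hdiff z).fun_const_smul _) (fun z hz => ?_) (convex_closedBall _ _)
      (by simp) (by simpa [dist_eq_norm, norm_sub_rev] using hx)
    · rw [h1]
      rw [← smul_sub, norm_smul, norm_pow, norm_norm] at h2
      simpa [norm_sub_rev] using h2
    · rw [fderiv_fun_const_smul (hdiff z), norm_smul, norm_fderiv_iteratedFDeriv, norm_pow,
        norm_norm]
      have hy : ‖y‖ ≤ (2 + ‖x₀‖) * (1 + ‖z‖) := by
        have e1 : ‖z - (y - x₀)‖ ≤ 1 := by simpa [dist_eq_norm] using hz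
        have e2 : ‖y‖ ≤ ‖z‖ + ‖x₀‖ + ‖z - (y - x₀)‖ := by
          calc ‖y‖ = ‖z + x₀ - (z - (y - x₀))‖ := by congr 1; abel
            _ ≤ ‖z + x₀‖ + ‖z - (y - x₀)‖ := norm_sub_le _ _
            _ ≤ _ := by gcongr; exact norm_add_le _ _
        have := mul_nonneg (norm_nonneg x₀) (norm_nonneg z)
        have := norm_nonneg z
        nlinarith
      calc _ ≤ ((2 + ‖x₀‖) * (1 + ‖z‖)) ^ k * ‖iteratedFDeriv ℝ (l + 1) b z‖ := by gcongr
        _ = (2 + ‖x₀‖) ^ k * ((1 + ‖z‖) ^ k * ‖iteratedFDeriv ℝ (l + 1) b z‖) := by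
            rw [mul_pow]; ring
        _ ≤ (2 + ‖x₀‖) ^ k * c := by gcongr; exact h z
        _ = D := by rw [hD]; ring
  have ht : Tendsto (fun x => D * ‖x - x₀‖) (𝓝 x₀) (𝓝 0) := by
    have : Continuous fun x => D * ‖x - x₀‖ := by fun_prop
    simpa using this.tendsto x₀
  filter_upwards [ht.eventually (gt_mem_nhds hε), Metric.closedBall_mem_nhds x₀ one_pos] with x h1 h2
  exact (key x (by simpa [dist_eq_norm] using h2)).trans_lt h1

theorem continuous_cv (a : 𝓢(Rn n, ℂ)) (f : 𝓢'(Rn n, ℂ)) : Continuous (cv a f) :=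
  f.cont.comp (continuous_tr a)

theorem lineDerivOp_cnv (a b : 𝓢(Rn n, ℂ)) (m : Rn n) : ∂_{m} (cnv a b) = cnv (∂_{m} a) b := by
  have hm : (fun ξ : Rn n => inner ℝ ξ m).HasTemperateGrowth := by fun_prop
  refine ext_fourier fun ξ => ?_
  rw [fourier_cnv, SchwartzMap.fourier_lineDerivOp_eq, SchwartzMap.fourier_lineDerivOp_eq]
  simp only [smul_apply, SchwartzMap.smulLeftCLM_apply_apply hm, fourier_cnv]
  simp
  ring

theorem iteratedLineDerivOp_cnv (a b : 𝓢(Rn n, ℂ)) {l : ℕ} (m : Fin l → Rn n) :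
    ∂^{m} (cnv a b) = cnv (∂^{m} a) b := by
  induction l with
  | zero => simp
  | succ l ih => rw [iteratedLineDerivOp_succ_left, ih, lineDerivOp_cnv,
      ← iteratedLineDerivOp_succ_left]

/-- Index set for the weighted directional derivatives `|x|^k D^l u(x)(m_0, …, m_{l-1})`, with
`(k, l) ∈ s`. -/
structure JetIndex (n : ℕ) (s : Finset (ℕ × ℕ)) where
  /-- the orders `(k, l)` -/
  ord : ℕ × ℕ
  mem : ord ∈ s
  /-- the point at which the derivative is taken -/
  pt : Rn n
  /-- the directions of the derivative -/
  dir : ℕ → Rn n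

/-- With the discrete topology the bounded continuous functions are all bounded functions, so the
target of the jet map is an $\ell^\infty$ space. -/
instance (s : Finset (ℕ × ℕ)) : TopologicalSpace (JetIndex n s) := ⊥

instance (s : Finset (ℕ × ℕ)) : DiscreteTopology (JetIndex n s) := ⟨rfl⟩

/-- The normalized derivative `|x|^k D^l u(x)(m_0, …, m_{l-1}) / (|m_0| ⋯ |m_{l-1}|)`. -/
def jetFun (s : Finset (ℕ × ℕ)) (u : 𝓢(Rn n, ℂ)) (i : JetIndex n s) : ℂ :=
  ((‖i.pt‖ ^ i.ord.1 * (∏ j : Fin i.ord.2, ‖i.dir j‖)⁻¹ : ℝ) : ℂ) *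
    iteratedFDeriv ℝ i.ord.2 u i.pt (fun j => i.dir j)

theorem norm_jetFun_le (s : Finset (ℕ × ℕ)) (u : 𝓢(Rn n, ℂ)) (i : JetIndex n s) :
    ‖jetFun s u i‖ ≤ SchwartzMap.seminorm ℂ i.ord.1 i.ord.2 u := by
  have h1 := (iteratedFDeriv ℝ i.ord.2 u i.pt).le_opNorm (fun j => i.dir j)
  have h2 := SchwartzMap.le_seminorm ℂ i.ord.1 i.ord.2 u i.pt
  have h0 : 0 ≤ ∏ j : Fin i.ord.2, ‖i.dir j‖ := Finset.prod_nonneg fun _ _ => norm_nonneg _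
  rw [jetFun, norm_mul, Complex.norm_real, Real.norm_of_nonneg (by positivity)]
  calc _ ≤ ‖i.pt‖ ^ i.ord.1 * (∏ j : Fin i.ord.2, ‖i.dir j‖)⁻¹ *
        (‖iteratedFDeriv ℝ i.ord.2 u i.pt‖ * ∏ j : Fin i.ord.2, ‖i.dir j‖) := by gcongr
    _ = (‖i.pt‖ ^ i.ord.1 * ‖iteratedFDeriv ℝ i.ord.2 u i.pt‖) *
        ((∏ j : Fin i.ord.2, ‖i.dir j‖)⁻¹ * ∏ j : Fin i.ord.2, ‖i.dir j‖) := by ring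
    _ ≤ (‖i.pt‖ ^ i.ord.1 * ‖iteratedFDeriv ℝ i.ord.2 u i.pt‖) * 1 := by
        gcongr
        exact inv_mul_le_one
    _ ≤ _ := by rwa [mul_one]

theorem seminorm_le_sup {s : Finset (ℕ × ℕ)} {i : ℕ × ℕ} (hi : i ∈ s) (u : 𝓢(Rn n, ℂ)) :
    SchwartzMap.seminorm ℂ i.1 i.2 u ≤ (s.sup (schwartzSeminormFamily ℂ (Rn n) ℂ)) u :=
  Seminorm.le_def.1 (Finset.le_sup (f := schwartzSeminormFamily ℂ (Rn n) ℂ) hi) u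

/-- The map `u ↦ jetFun s u` into a Banach space. -/
def jetCLM (s : Finset (ℕ × ℕ)) :
    𝓢(Rn n, ℂ) →L[ℂ] BoundedContinuousFunction (JetIndex n s) ℂ :=
  SchwartzMap.mkCLMtoNormedSpace
    (fun u => BoundedContinuousFunction.ofNormedAddCommGroup (jetFun s u)
      continuous_of_discreteTopology ((s.sup (schwartzSeminormFamily ℂ (Rn n) ℂ)) u)
      (fun i => (norm_jetFun_le s u i).trans (seminorm_le_sup i.mem u)))
    (fun u v => by
      ext i
      have : iteratedFDeriv ℝ i.ord.2 (⇑u + ⇑v) i.pt =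
          iteratedFDeriv ℝ i.ord.2 u i.pt + iteratedFDeriv ℝ i.ord.2 v i.pt :=
        iteratedFDeriv_add_apply (u.contDiffAt i.ord.2) (v.contDiffAt i.ord.2)
      simp [jetFun, this, mul_add])
    (fun c u => by
      ext i
      have : iteratedFDeriv ℝ i.ord.2 (c • ⇑u) i.pt = c • iteratedFDeriv ℝ i.ord.2 u i.pt :=
        iteratedFDeriv_const_smul_apply (u.contDiffAt i.ord.2)
      simp [jetFun, this]
      ring)
    ⟨s, 1, zero_le_one, fun u => by
      rw [one_mul]
      exact BoundedContinuousFunction.norm_ofNormedAddCommGroup_le _ (apply_nonneg _ _) _⟩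

theorem jetCLM_apply (s : Finset (ℕ × ℕ)) (u : 𝓢(Rn n, ℂ)) (i : JetIndex n s) :
    jetCLM s u i = jetFun s u i := rfl

theorem norm_jetCLM_le (s : Finset (ℕ × ℕ)) (u : 𝓢(Rn n, ℂ)) :
    ‖jetCLM s u‖ ≤ (s.sup (schwartzSeminormFamily ℂ (Rn n) ℂ)) u :=
  BoundedContinuousFunction.norm_ofNormedAddCommGroup_le _ (apply_nonneg _ _)
    (fun i => (norm_jetFun_le s u i).trans (seminorm_le_sup i.mem u))

/-- The converse of `norm_jetCLM_le`: the jet map turns a finite supremum of Schwartz seminorms into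
a Banach space norm. -/
theorem sup_seminorm_le_norm_jetCLM (s : Finset (ℕ × ℕ)) (u : 𝓢(Rn n, ℂ)) :
    (s.sup (schwartzSeminormFamily ℂ (Rn n) ℂ)) u ≤ ‖jetCLM s u‖ := by
  refine Seminorm.finset_sup_apply_le (norm_nonneg _) fun k hk => ?_
  refine SchwartzMap.seminorm_le_bound ℂ k.1 k.2 u (norm_nonneg _) fun x => ?_
  have key : ‖‖x‖ ^ k.1 • iteratedFDeriv ℝ k.2 u x‖ ≤ ‖jetCLM s u‖ := by
    refine ContinuousMultilinearMap.opNorm_le_bound (norm_nonneg _) fun m => ?_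
    -- Directions are stored as infinite sequences; the entries beyond the order of the derivative
    -- play no role.
    let m' : ℕ → Rn n := fun j => if h : j < k.2 then m ⟨j, h⟩ else 0
    have hm' : ∀ j : Fin k.2, m' j = m j := fun j => by simp [m']
    have h1 := (jetCLM s u).norm_coe_le_norm ⟨k, hk, x, m'⟩
    have h0 : 0 ≤ ∏ j, ‖m j‖ := Finset.prod_nonneg fun _ _ => norm_nonneg _
    rw [jetCLM_apply, jetFun] at h1
    simp only [hm'] at h1
    rw [norm_mul, Complex.norm_real, Real.norm_of_nonneg (by positivity)] at h1
    rw [_root_.smul_apply, norm_smul, norm_pow, norm_norm]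
    rcases h0.eq_or_lt with h0 | h0
    · obtain ⟨j, -, hj⟩ := Finset.prod_eq_zero_iff.1 h0.symm
      rw [(iteratedFDeriv ℝ k.2 u x).map_coord_zero j (norm_eq_zero.1 hj), ← h0]
      simp
    · rw [← div_le_iff₀ h0]
      calc _ = _ := by rw [div_eq_mul_inv]; ring
        _ ≤ _ := h1
  rwa [norm_smul, norm_pow, norm_norm] at key

/-- A tempered distribution is bounded by finitely many seminorms, so it defines a bounded
functional on the range of the jet map, which Hahn–Banach extends to the Banach space. Bochner
integrals are then available. -/
theorem exists_jet_factor (f : 𝓢'(Rn n, ℂ)) : ∃ (s : Finset (ℕ × ℕ))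
    (F : BoundedContinuousFunction (JetIndex n s) ℂ →L[ℂ] ℂ), ∀ u, f u = F (jetCLM s u) := by
  obtain ⟨s₀, C, hC⟩ := exists_seminorm_bound f
  classical
  -- The index `(0, 0)` is added so that jets record point values and the jet map is injective.
  obtain ⟨s, hs0, hs⟩ : ∃ s : Finset (ℕ × ℕ), (0, 0) ∈ s ∧ s₀ ⊆ s :=
    ⟨insert (0, 0) s₀, by simp, by simp⟩
  have hJ : Function.Injective (jetCLM (n := n) s).toLinearMap := by
    intro u v huv
    ext x
    have h0 : jetCLM s u ⟨(0, 0), hs0, x, 0⟩ = jetCLM s v ⟨(0, 0), hs0, x, 0⟩ :=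
      congrArg (fun g : BoundedContinuousFunction (JetIndex n s) ℂ => g ⟨(0, 0), hs0, x, 0⟩) huv
    simp only [jetCLM_apply] at h0
    simpa [jetFun] using h0
  have hbound : ∀ u, ‖f u‖ ≤ C * ‖jetCLM s u‖ := by
    intro u
    refine (hC u).trans ?_
    gcongr
    exact (Seminorm.le_def.1 (Finset.sup_mono hs) u).trans (sup_seminorm_le_norm_jetCLM s u)
  let e := LinearEquiv.ofInjective (jetCLM (n := n) s).toLinearMap hJ
  let V : Subspace ℂ (BoundedContinuousFunction (JetIndex n s) ℂ) :=
    LinearMap.range (jetCLM (n := n) s).toLinearMap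
  let f₁ : V →ₗ[ℂ] ℂ := f.toLinearMap ∘ₗ e.symm.toLinearMap
  have hf₁ : ∀ u, f₁ (e u) = f u := fun u => by
    change f (e.symm (e u)) = f u
    rw [e.symm_apply_apply]
  let f₀ : StrongDual ℂ V := f₁.mkContinuous C (fun z => by
      obtain ⟨u, rfl⟩ := e.surjective z
      rw [hf₁]
      exact hbound u)
  obtain ⟨F, hF, -⟩ := exists_extension_norm_eq V f₀
  refine ⟨s, F, fun u => ?_⟩
  have h1 := hF (e u)
  exact (h1.trans (hf₁ u)).symm

/-- A tempered distribution may be exchanged with the integral that defines a convolution. -/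
theorem apply_cnv_reflect (f : 𝓢'(Rn n, ℂ)) (a u : 𝓢(Rn n, ℂ)) :
    f (cnv (reflect a) u) = ∫ x, u x * cv a f x := by
  -- The functional `F` passes through the Bochner integral of the jets of translates. It remains to
  -- identify that integral with the jet of the convolution, by evaluating at each index.
  obtain ⟨s, F, hF⟩ := exists_jet_factor f
  have hcont : Continuous fun x => u x • jetCLM s (tr a x) :=
    u.continuous.smul ((jetCLM s).continuous.comp (continuous_tr a))
  have hint : Integrable fun x => u x • jetCLM s (tr a x) := by
    choose c hc0 hc using fun i : ℕ × ℕ => seminorm_tr_dil_le a i.1 i.2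
    set k := ∑ i ∈ s, i.1
    set c' := ∑ i ∈ s, c i * 2 ^ i.1
    have hc' : 0 ≤ c' := Finset.sum_nonneg fun i _ => mul_nonneg (hc0 i) (by positivity)
    have hg := (u.integrable_pow_mul (volume : Measure (Rn n)) 0).norm.add
      ((u.integrable_pow_mul (volume : Measure (Rn n)) k).norm)
    refine Integrable.mono' (hg.const_mul (c' * 2 ^ k))
      hcont.aestronglyMeasurable (Eventually.of_forall fun x => ?_)
    have h1 : ‖jetCLM s (tr a x)‖ ≤ c' * (1 + ‖x‖) ^ k := by
      refine (norm_jetCLM_le s _).trans (Seminorm.finset_sup_apply_le (by positivity) fun i hi => ?_)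
      have h2 := hc i 1 1 one_pos le_rfl x
      rw [dil_one] at h2
      refine h2.trans ?_
      have e1 : c i * 2 ^ i.1 ≤ c' := Finset.single_le_sum
        (f := fun i : ℕ × ℕ => c i * 2 ^ i.1)
        (fun i _ => mul_nonneg (hc0 i) (by positivity)) hi
      have e2 : (1 + ‖x‖) ^ i.1 ≤ (1 + ‖x‖) ^ k :=
        pow_le_pow_right₀ (by linarith [norm_nonneg x])
          (Finset.single_le_sum (f := fun i : ℕ × ℕ => i.1) (fun _ _ => Nat.zero_le _) hi)
      simp only [inv_one, one_pow, mul_one, one_add_one_eq_two]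
      gcongr
    have h3 : (1 + ‖x‖) ^ k ≤ 2 ^ k * (1 + ‖x‖ ^ k) := by
      calc (1 + ‖x‖) ^ k ≤ (2 * max 1 ‖x‖) ^ k := by
            gcongr
            have := le_max_left 1 ‖x‖
            have := le_max_right 1 ‖x‖
            linarith
        _ = 2 ^ k * (max 1 ‖x‖) ^ k := mul_pow _ _ _
        _ ≤ _ := by
            gcongr
            rcases max_choice 1 ‖x‖ with h | h <;> rw [h] <;> simp
    rw [norm_smul]
    calc _ ≤ ‖u x‖ * (c' * (2 ^ k * (1 + ‖x‖ ^ k))) := by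
          gcongr
          exact h1.trans (by gcongr)
      _ = _ := by simp; ring
  have h1 : ∫ x, u x * cv a f x = F (∫ x, u x • jetCLM s (tr a x)) := by
    rw [← F.integral_comp_comm hint]
    refine integral_congr_ae (Eventually.of_forall fun x => ?_)
    simp only [map_smul, smul_eq_mul, cv, hF]
  rw [h1, hF]
  congr 1
  ext i
  let ev := BoundedContinuousFunction.evalCLM (β := ℂ) ℂ i
  have hev : ∀ g, g i = ev g := fun g => rfl
  rw [hev, hev, ← ev.integral_comp_comm hint, ← hev]
  simp only [← hev, jetCLM_apply, BoundedContinuousFunction.coe_smul, jetFun,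
    iteratedFDeriv_tr]
  -- All derivatives of the convolution fall on the factor `reflect a`, which turns both sides into
  -- the same integral.
  simp only [← SchwartzMap.iteratedLineDerivOp_eq_iteratedFDeriv, iteratedLineDerivOp_cnv, cnv_apply]
  rw [← integral_const_mul]
  refine integral_congr_ae (Eventually.of_forall fun x => ?_)
  simp only [smul_eq_mul]
  ring

/-- `(a * b) * f = a * (b * f)`. -/
theorem cv_cnv (a b : 𝓢(Rn n, ℂ)) (f : 𝓢'(Rn n, ℂ)) (x : Rn n) :
    cv (cnv a b) f x = ∫ v, a (x - v) * cv b f v := by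
  have h : tr (cnv a b) x = cnv (reflect b) (tr a x) := by
    ext y
    rw [tr_apply, cnv_apply, cnv_apply, ← integral_sub_right_eq_self _ y]
    refine integral_congr_ae (Eventually.of_forall fun v => ?_)
    simp only [tr_apply, reflect_apply, neg_sub, sub_sub_sub_cancel_right]
    ring
  rw [cv, h, apply_cnv_reflect]
  simp only [tr_apply]

end

section

open LineDeriv

/-! ### Band-limited Schwartz functions -/

theorem exists_fourier_eq {χ : Rn n → ℂ} (hc : HasCompactSupport χ) (hs : ContDiff ℝ ∞ χ) :
    ∃ a : 𝓢(Rn n, ℂ), ∀ ξ, 𝓕 a ξ = χ ξ := by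
  refine ⟨𝓕⁻ (hc.toSchwartzMap hs), fun ξ => ?_⟩
  rw [FourierTransform.fourier_fourierInv_eq]
  rfl

/-- Away from the closed support of `χ` the quotient vanishes locally, whatever the zeros of `g`. -/
theorem contDiff_div_of_tsupport {χ g : Rn n → ℂ} (hχ : ContDiff ℝ ∞ χ) (hg : ContDiff ℝ ∞ g)
    (h : ∀ ξ ∈ tsupport χ, g ξ ≠ 0) : ContDiff ℝ ∞ fun ξ => χ ξ / g ξ := by
  refine contDiff_iff_contDiffAt.2 fun ξ => ?_
  by_cases hξ : ξ ∈ tsupport χ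
  · simp_rw [div_eq_mul_inv]
    exact hχ.contDiffAt.mul (hg.contDiffAt.inv (h ξ hξ))
  · refine (contDiffAt_const (c := (0 : ℂ))).congr_of_eventuallyEq ?_
    filter_upwards [(isClosed_tsupport χ).isOpen_compl.mem_nhds hξ] with η hη
    rw [image_eq_zero_of_notMem_tsupport hη, zero_div]

/-- The Fourier transform is supported in an annulus. -/
def IsAnnular (d : 𝓢(Rn n, ℂ)) : Prop :=
  HasCompactSupport ⇑(𝓕 d : 𝓢(Rn n, ℂ)) ∧ ∃ c : ℝ, 0 < c ∧ ∀ ξ, ‖ξ‖ < c → 𝓕 d ξ = 0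

theorem fourier_lineDerivOp_apply (a : 𝓢(Rn n, ℂ)) (m ξ : Rn n) :
    𝓕 (∂_{m} a) ξ = 2 * Real.pi * Complex.I * (inner ℝ ξ m : ℝ) * 𝓕 a ξ := by
  have hm : (fun ξ : Rn n => inner ℝ ξ m).HasTemperateGrowth := by fun_prop
  rw [SchwartzMap.fourier_lineDerivOp_eq]
  simp only [_root_.smul_apply, SchwartzMap.smulLeftCLM_apply_apply hm]
  simp
  ring

/-- Take $\hat b_j = \xi_j \hat d/(2\pi i|\xi|^2)$, which is smooth because $\hat d$ vanishes near
the origin. This is the cancellation of `d`, in a form that can be iterated. -/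
theorem IsAnnular.exists_eq_sum_lineDeriv {d : 𝓢(Rn n, ℂ)} (hd : IsAnnular d) :
    ∃ b : Fin n → 𝓢(Rn n, ℂ), (∀ j, IsAnnular (b j)) ∧
      d = ∑ j, ∂_{EuclideanSpace.single j (1 : ℝ)} (b j) := by
  obtain ⟨hc, c, hc0, hz⟩ := hd
  have hsm : ContDiff ℝ ∞ ⇑(𝓕 d : 𝓢(Rn n, ℂ)) := (𝓕 d).smooth _
  have hts : ∀ ξ ∈ tsupport ⇑(𝓕 d : 𝓢(Rn n, ℂ)), ‖ξ‖ ≠ 0 := by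
    intro ξ hξ h0
    have : ξ ∈ closure (Metric.ball (0 : Rn n) c)ᶜ :=
      closure_mono (fun η hη => by
        by_contra hcon
        rw [Set.notMem_compl_iff, mem_ball_zero_iff] at hcon
        exact hη (hz η hcon)) hξ
    rw [(Metric.isOpen_ball.isClosed_compl).closure_eq] at this
    apply this
    rw [mem_ball_zero_iff, h0]
    exact hc0
  have hex : ∀ j : Fin n, ∃ b : 𝓢(Rn n, ℂ), ∀ ξ, 𝓕 b ξ =
      ((inner ℝ ξ (EuclideanSpace.single j (1 : ℝ)) : ℝ) : ℂ) * 𝓕 d ξ /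
        (2 * Real.pi * Complex.I * ((‖ξ‖ ^ 2 : ℝ) : ℂ)) := by
    intro j
    refine exists_fourier_eq (χ := fun ξ => ((inner ℝ ξ (EuclideanSpace.single j (1 : ℝ)) : ℝ) : ℂ) *
        𝓕 d ξ / (2 * Real.pi * Complex.I * ((‖ξ‖ ^ 2 : ℝ) : ℂ))) ?_ ?_
    · refine hc.mono fun ξ hξ h0 => hξ ?_
      simp only
      rw [h0]
      simp
    · refine contDiff_div_of_tsupport ?_ ?_ ?_
      · refine ContDiff.mul ?_ hsm
        exact Complex.ofRealCLM.contDiff.comp (contDiff_id.inner ℝ contDiff_const)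
      · refine ContDiff.mul contDiff_const ?_
        exact Complex.ofRealCLM.contDiff.comp (contDiff_norm_sq ℝ)
      · intro ξ hξ
        have := hts ξ (tsupport_mul_subset_right hξ)
        have hpi := Real.pi_ne_zero
        simp_all
  choose b hb using hex
  refine ⟨b, fun j => ⟨?_, c, hc0, fun ξ hξ => by simp [hb, hz ξ hξ]⟩, ?_⟩
  · refine hc.mono fun ξ hξ h0 => hξ ?_
    rw [hb, h0]
    simp
  · refine ext_fourier fun ξ => ?_
    have hsum : 𝓕 (∑ j, ∂_{EuclideanSpace.single j (1 : ℝ)} (b j)) ξ =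
        ∑ j, 𝓕 (∂_{EuclideanSpace.single j (1 : ℝ)} (b j)) ξ := by
      simp
    rw [hsum]
    simp only [fourier_lineDerivOp_apply, hb]
    by_cases h0 : 𝓕 d ξ = 0
    · simp [h0]
    · have hn : ‖ξ‖ ≠ 0 := hts ξ (subset_tsupport _ h0)
      have hpi : (Real.pi : ℂ) ≠ 0 := by exact_mod_cast Real.pi_ne_zero
      have hn' : ((‖ξ‖ ^ 2 : ℝ) : ℂ) ≠ 0 := by
        exact_mod_cast pow_ne_zero 2 hn
      have hterm : ∀ j : Fin n, 2 * Real.pi * Complex.I *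
          ((inner ℝ ξ (EuclideanSpace.single j (1 : ℝ)) : ℝ) : ℂ) *
          (((inner ℝ ξ (EuclideanSpace.single j (1 : ℝ)) : ℝ) : ℂ) * 𝓕 d ξ /
            (2 * Real.pi * Complex.I * ((‖ξ‖ ^ 2 : ℝ) : ℂ))) =
          (((ξ j) ^ 2 : ℝ) : ℂ) * (𝓕 d ξ / ((‖ξ‖ ^ 2 : ℝ) : ℂ)) := by
        intro j
        have : inner ℝ ξ (EuclideanSpace.single j (1 : ℝ)) = ξ j := by
          simpa using EuclideanSpace.inner_single_right j (1 : ℝ) ξ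
        rw [this]
        have := Complex.I_ne_zero
        field_simp
        push_cast
        ring
      simp only [hterm]
      rw [← Finset.sum_mul, ← Complex.ofReal_sum]
      have : ∑ j, ξ j ^ 2 = ‖ξ‖ ^ 2 := by
        rw [EuclideanSpace.norm_sq_eq]
        simp
      rw [this, mul_div_cancel₀ _ hn']

/-- Integration by parts: each derivative moved from the dilated factor onto `ψ` yields a factor
`s`. -/
theorem cnv_lineDerivOp_dil (ψ a : 𝓢(Rn n, ℂ)) {s : ℝ} (hs : 0 < s) (m : Rn n) :
    cnv ψ (dil (∂_{m} a) s) = (s : ℂ) • cnv (∂_{m} ψ) (dil a s) := by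
  refine ext_fourier fun ξ => ?_
  have : 𝓕 ((s : ℂ) • cnv (∂_{m} ψ) (dil a s)) ξ = s * 𝓕 (cnv (∂_{m} ψ) (dil a s)) ξ := by
    rw [FourierTransform.fourier_smul]
    rfl
  rw [this, fourier_cnv, fourier_cnv, fourier_dil _ hs, fourier_lineDerivOp_apply,
    fourier_lineDerivOp_apply, fourier_dil _ hs, inner_smul_left]
  simp
  ring

theorem norm_cnv_dil_le (d : 𝓢(Rn n, ℂ)) {B : ℝ} (hB : 0 ≤ B) : ∃ C : ℝ, 0 ≤ C ∧
    ∀ (ψ : 𝓢(Rn n, ℂ)) (M : ℝ), 0 ≤ M → (∀ x, ‖ψ x‖ ≤ M * ker B 1 x) → ∀ s, 0 < s → s ≤ 1 →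
      ∀ x, ‖cnv ψ (dil d s) x‖ ≤ C * M * ker B 1 x := by
  -- The decay of `d` is spent twice: `B` powers carry the weight from $x-v$ to $x$, where $s \le 1$
  -- is used, and the remaining $n+1$ give integrability.
  obtain ⟨c, hc0, hc⟩ := exists_norm_le_ker d (B + (n + 1))
  obtain ⟨C, hC⟩ := lintegral_ker_le (n := n) (B := n + 1) (by linarith)
  refine ⟨c * C, by positivity, fun ψ M hM hψ s hs hs1 x => ?_⟩
  have hkx := ker_nonneg B one_pos x
  have hpt : ∀ v, ‖ψ (x - v) * dil d s v‖ ≤ (M * c * ker B 1 x) * ker (n + 1) s (0 - v) := by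
    intro v
    have h1 := norm_dil_le hc hs v
    have hb := br_pos hs v
    have h2 : ker B 1 (x - v) * ker (B + (n + 1)) s v ≤ ker B 1 x * ker (n + 1) s v := by
      have e1 : br 1 (x - v) ^ (-B) * br 1 v ^ (-B) ≤ br 1 x ^ (-B) := by
        have := br_rpow_neg_sub_le one_pos hB x v 0
        rw [sub_zero, sub_zero] at this
        have := br_rpow_neg_sub_le one_pos hB (x - v) 0 (-v)
        simpa using this
      have e2 : br s v ^ (-(B + (n + 1))) ≤ br 1 v ^ (-B) * br s v ^ (-((n : ℝ) + 1)) := by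
        rw [neg_add, Real.rpow_add hb]
        gcongr ?_ * _
        exact Real.rpow_le_rpow_of_nonpos (br_pos one_pos v) (br_anti hs hs1 v) (by linarith)
      have := br_pos one_pos (x - v)
      have := br_pos one_pos v
      unfold ker
      calc _ ≤ (1 ^ n)⁻¹ * br 1 (x - v) ^ (-B) * ((s ^ n)⁻¹ *
            (br 1 v ^ (-B) * br s v ^ (-((n : ℝ) + 1)))) := by gcongr
        _ = (1 ^ n)⁻¹ * (br 1 (x - v) ^ (-B) * br 1 v ^ (-B)) *
            ((s ^ n)⁻¹ * br s v ^ (-((n : ℝ) + 1))) := by ring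
        _ ≤ _ := by gcongr
    rw [norm_mul, zero_sub, ker_neg]
    calc _ ≤ (M * ker B 1 (x - v)) * (c * ker (B + (n + 1)) s v) := by
          gcongr
          · exact mul_nonneg hM (ker_nonneg _ one_pos _)
          · exact hψ _
      _ = M * c * (ker B 1 (x - v) * ker (B + (n + 1)) s v) := by ring
      _ ≤ M * c * (ker B 1 x * ker (n + 1) s v) := by gcongr
      _ = _ := by ring
  have h1 : ‖cnv ψ (dil d s) x‖ₑ ≤ ENNReal.ofReal (c * C * M * ker B 1 x) := by
    rw [cnv_apply]
    refine (enorm_integral_le_lintegral_enorm _).trans ?_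
    calc _ ≤ ∫⁻ v, ENNReal.ofReal (M * c * ker B 1 x) * ENNReal.ofReal (ker (n + 1) s (0 - v)) := by
          refine lintegral_mono fun v => ?_
          rw [← ENNReal.ofReal_mul (by positivity), ← ofReal_norm]
          exact ENNReal.ofReal_le_ofReal (hpt v)
      _ ≤ ENNReal.ofReal (M * c * ker B 1 x) * C := by
          rw [lintegral_const_mul' _ _ (by finiteness)]
          gcongr
          exact hC s hs 0
      _ = _ := by
          rw [← ENNReal.ofReal_coe_nnreal, ← ENNReal.ofReal_mul (by positivity)]
          congr 1
          ring
  rw [← ofReal_norm, ENNReal.ofReal_le_ofReal_iff (by positivity)] at h1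
  exact h1

theorem cnv_sum (a : 𝓢(Rn n, ℂ)) {ι : Type*} (s : Finset ι) (b : ι → 𝓢(Rn n, ℂ)) :
    cnv a (∑ j ∈ s, b j) = ∑ j ∈ s, cnv a (b j) := by
  simp [cnv, map_sum]

theorem dil_sum {ι : Type*} (s : Finset ι) (b : ι → 𝓢(Rn n, ℂ)) {t : ℝ} (ht : 0 < t) :
    dil (∑ j ∈ s, b j) t = ∑ j ∈ s, dil (b j) t := by
  simp [dil, ht, map_sum, Finset.smul_sum]

/-- Smoothness of `ψ` against cancellation of `d`. -/
theorem IsAnnular.norm_cnv_dil_le {B : ℝ} (hB : 0 ≤ B) (L : ℕ) {d : 𝓢(Rn n, ℂ)}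
    (hd : IsAnnular d) : ∃ C : ℝ, 0 ≤ C ∧ ∀ (ψ : 𝓢(Rn n, ℂ)) (M : ℝ), 0 ≤ M →
      (∀ (i : Fin L → Fin n) x,
        ‖(∂^{fun j => EuclideanSpace.single (i j) (1 : ℝ)} ψ) x‖ ≤ M * ker B 1 x) →
      ∀ s, 0 < s → s ≤ 1 → ∀ x, ‖cnv ψ (dil d s) x‖ ≤ C * s ^ L * M * ker B 1 x := by
  induction L generalizing d with
  | zero =>
    obtain ⟨C, hC, h⟩ := BochnerRiesz.norm_cnv_dil_le d hB
    refine ⟨C, hC, fun ψ M hM hψ s hs hs1 x => ?_⟩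
    simpa using h ψ M hM (fun x => by simpa using hψ Fin.elim0 x) s hs hs1 x
  | succ L ih =>
    obtain ⟨b, hb, hdb⟩ := hd.exists_eq_sum_lineDeriv
    choose C hC0 hC using fun j => ih (hb j)
    refine ⟨∑ j, C j, Finset.sum_nonneg fun j _ => hC0 j, fun ψ M hM hψ s hs hs1 x => ?_⟩
    have h1 : cnv ψ (dil d s) = ∑ j, (s : ℂ) •
        cnv (∂_{EuclideanSpace.single j (1 : ℝ)} ψ) (dil (b j) s) := by
      rw [hdb, dil_sum _ _ hs, cnv_sum]
      exact Finset.sum_congr rfl fun j _ => cnv_lineDerivOp_dil ψ (b j) hs _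
    have h2 : cnv ψ (dil d s) x = ∑ j, (s : ℂ) *
        cnv (∂_{EuclideanSpace.single j (1 : ℝ)} ψ) (dil (b j) s) x := by
      rw [h1]
      simp
    rw [h2, Finset.sum_mul, Finset.sum_mul, Finset.sum_mul]
    refine norm_sum_le_of_le _ fun j _ => ?_
    rw [norm_mul, Complex.norm_real, Real.norm_of_nonneg hs.le]
    have h3 := hC j (∂_{EuclideanSpace.single j (1 : ℝ)} ψ) M hM (fun i x => ?_) s hs hs1 x
    · calc _ ≤ s * (C j * s ^ L * M * ker B 1 x) := by gcongr
        _ = _ := by rw [pow_succ]; ring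
    -- A direction appended at the end is the derivative applied to `ψ` first, as the induction
    -- hypothesis for `∂_j ψ` requires.
    · have h4 := hψ (Fin.snoc (α := fun _ => Fin n) i j) x
      rw [iteratedLineDerivOp_succ_right] at h4
      have h5 : Fin.init (fun k => EuclideanSpace.single
          ((Fin.snoc (α := fun _ => Fin n) i j : Fin (L + 1) → Fin n) k) (1 : ℝ)) =
          fun k => EuclideanSpace.single (i k) (1 : ℝ) := by
        ext k
        simp [Fin.init]
      rw [h5] at h4
      simpa using h4

end

section

open LineDeriv

/-! ### A reproducing formula -/

/-- An approximate identity for continuous functions of polynomial growth: after rescaling to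
$\int\theta(z)g(y-\varepsilon z)\,dz$, the decay of `θ` dominates uniformly for $\varepsilon \le 1$.
-/
theorem tendsto_integral_dil {θ : 𝓢(Rn n, ℂ)} (hθ : ∫ x, θ x = 1) {g : Rn n → ℂ}
    (hg : Continuous g) {c : ℝ} {k : ℕ} (hb : ∀ v, ‖g v‖ ≤ c * (1 + ‖v‖) ^ k) (y : Rn n) :
    Tendsto (fun ε : ℝ => ∫ v, dil θ ε (y - v) * g v) (𝓝[>] 0) (𝓝 (g y)) := by
  have hc : 0 ≤ c := by simpa using (norm_nonneg _).trans (hb 0)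
  have h1 : ∀ ε : ℝ, 0 < ε → ∫ v, dil θ ε (y - v) * g v = ∫ z, θ z * g (y - ε • z) := by
    intro ε hε
    rw [← integral_sub_left_eq_self _ volume y]
    have h := Measure.integral_comp_inv_smul_of_nonneg (volume : Measure (Rn n))
      (fun z => θ z * g (y - ε • z)) hε.le
    rw [finrank_euclideanSpace_fin] at h
    have h2 : ∀ v : Rn n, dil θ ε (y - (y - v)) * g (y - v) =
        ((ε : ℂ) ^ n)⁻¹ * (θ (ε⁻¹ • v) * g (y - ε • ε⁻¹ • v)) := by
      intro v
      rw [dil_apply θ hε, sub_sub_cancel, smul_inv_smul₀ hε.ne']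
      ring
    simp_rw [h2]
    rw [integral_const_mul, h, Complex.real_smul]
    have : (ε : ℂ) ≠ 0 := by exact_mod_cast hε.ne'
    push_cast
    field_simp
  obtain ⟨C, hC, hCθ⟩ := exists_norm_le_ker θ (n + 1 + k)
  have h3 : Tendsto (fun ε : ℝ => ∫ z, θ z * g (y - ε • z)) (𝓝[>] 0)
      (𝓝 (∫ z, θ z * g y)) := by
    refine tendsto_integral_filter_of_dominated_convergence
      (fun z => C * (c * (1 + ‖y‖) ^ k) * (1 + ‖z‖) ^ (-((n : ℝ) + 1))) ?_ ?_ ?_ ?_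
    · refine Eventually.of_forall fun ε => Continuous.aestronglyMeasurable ?_
      exact θ.continuous.mul (hg.comp (by fun_prop))
    · have h01 : Set.Ioc (0 : ℝ) 1 ∈ 𝓝[>] (0 : ℝ) := Ioc_mem_nhdsGT one_pos
      filter_upwards [h01] with ε hε
      refine Eventually.of_forall fun z => ?_
      rw [norm_mul]
      have e0 : 0 < 1 + ‖z‖ := by positivity
      have e1 : ‖y - ε • z‖ ≤ ‖y‖ + ‖z‖ := by
        refine (norm_sub_le _ _).trans ?_
        rw [norm_smul, Real.norm_of_nonneg hε.1.le]
        gcongr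
        exact mul_le_of_le_one_left (norm_nonneg _) hε.2
      have e2 : 1 + ‖y - ε • z‖ ≤ (1 + ‖y‖) * (1 + ‖z‖) := by
        nlinarith [mul_nonneg (norm_nonneg y) (norm_nonneg z)]
      have e3 : ker (n + 1 + k) 1 z * (1 + ‖z‖) ^ k = (1 + ‖z‖) ^ (-((n : ℝ) + 1)) := by
        simp only [ker, br, one_pow, inv_one, one_mul, div_one]
        rw [← Real.rpow_natCast, ← Real.rpow_add e0]
        congr 1
        ring
      have e4 := ker_nonneg (n + 1 + k) one_pos z
      calc _ ≤ (C * ker (n + 1 + k) 1 z) * (c * ((1 + ‖y‖) * (1 + ‖z‖)) ^ k) := by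
            gcongr
            · exact hCθ z
            · exact (hb _).trans (by gcongr)
        _ = C * (c * (1 + ‖y‖) ^ k) * (ker (n + 1 + k) 1 z * (1 + ‖z‖) ^ k) := by
            rw [mul_pow]; ring
        _ = _ := by rw [e3]
    · refine Integrable.const_mul ?_ _
      exact integrable_one_add_norm (by simp)
    · refine Eventually.of_forall fun z => Tendsto.const_mul _ ?_
      have hc : Continuous (fun ε : ℝ => g (y - ε • z)) := hg.comp (by fun_prop)
      have := (hc.tendsto 0).mono_left (nhdsWithin_le_nhds (s := Set.Ioi 0))
      simpa using this
  rw [integral_mul_const, hθ, one_mul] at h3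
  refine h3.congr' ?_
  filter_upwards [self_mem_nhdsWithin] with ε hε
  exact (h1 ε hε).symm

theorem fourier_zero (a : 𝓢(Rn n, ℂ)) : 𝓕 a 0 = ∫ x, a x := by
  rw [SchwartzMap.fourier_coe, Real.fourier_eq]
  simp

/-- A bump `θ` on the frequency side, factored through `φ`. -/
theorem exists_decomposition {φ : 𝓢(Rn n, ℂ)} (hφ : ∫ x, φ x = 1) :
    ∃ θ Λ₀ Λ₁ : 𝓢(Rn n, ℂ), (∫ x, θ x = 1) ∧ θ = cnv Λ₀ φ ∧ IsAnnular Λ₁ ∧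
      dil θ (1 / 2) = θ + cnv Λ₁ (dil φ (1 / 2)) := by
  have hcont : Continuous fun ξ => 𝓕 φ ξ := (𝓕 φ).continuous
  have h0 : 𝓕 φ 0 ≠ 0 := by rw [fourier_zero, hφ]; exact one_ne_zero
  obtain ⟨c, hc, hball⟩ := Metric.isOpen_iff.1 (isOpen_ne.preimage hcont) 0 h0
  have hne : ∀ ξ : Rn n, ‖ξ‖ ≤ c / 2 → 𝓕 φ ξ ≠ 0 := fun ξ hξ =>
    hball (by rw [mem_ball_zero_iff]; linarith)
  -- Since $\hat\varphi \ne 0$ for $|\xi| \le c/2$, division by $\hat\varphi$ is allowed on the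
  -- support of `b`. The difference $b(\xi/2) - b(\xi)$ lives in $c/4 \le |\xi| \le c$, where
  -- $\hat\varphi(\xi/2) \ne 0$.
  let b : ContDiffBump (0 : Rn n) := ⟨c / 4, c / 2, by positivity, by linarith⟩
  have hbs : ContDiff ℝ ∞ fun ξ : Rn n => (b ξ : ℂ) :=
    Complex.ofRealCLM.contDiff.comp b.contDiff
  have hbz : ∀ ξ : Rn n, c / 2 ≤ ‖ξ‖ → b ξ = 0 := fun ξ hξ =>
    b.zero_of_le_dist (by rwa [dist_zero_right])
  have hb1 : ∀ ξ : Rn n, ‖ξ‖ ≤ c / 4 → b ξ = 1 := fun ξ hξ =>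
    b.one_of_mem_closedBall (by rwa [mem_closedBall_zero_iff])
  have hsupp : ∀ (u : Rn n → ℂ) (r : ℝ), (∀ ξ, r < ‖ξ‖ → u ξ = 0) →
      tsupport u ⊆ Metric.closedBall 0 r := by
    intro u r hu
    refine closure_minimal (fun ξ hξ => ?_) Metric.isClosed_closedBall
    by_contra hcon
    rw [mem_closedBall_zero_iff, not_le] at hcon
    exact hξ (hu ξ hcon)
  have hcs : ∀ (u : Rn n → ℂ) (r : ℝ), (∀ ξ, r < ‖ξ‖ → u ξ = 0) → HasCompactSupport u :=
    fun u r hu => (isCompact_closedBall 0 r).of_isClosed_subset (isClosed_tsupport u) (hsupp u r hu)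
  have hnorm : ∀ ξ : Rn n, ‖(1 / 2 : ℝ) • ξ‖ = ‖ξ‖ / 2 := fun ξ => by
    rw [norm_smul]; simp; ring
  obtain ⟨θ, hθ⟩ := exists_fourier_eq (χ := fun ξ => (b ξ : ℂ))
    (hcs _ (c / 2) fun ξ hξ => by simp [hbz ξ hξ.le]) hbs
  obtain ⟨Λ₀, hΛ₀⟩ := exists_fourier_eq (χ := fun ξ => (b ξ : ℂ) / 𝓕 φ ξ)
    (hcs _ (c / 2) fun ξ hξ => by simp [hbz ξ hξ.le])
    (contDiff_div_of_tsupport hbs ((𝓕 φ).smooth _) fun ξ hξ => hne ξ (by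
      simpa using hsupp _ (c / 2) (fun ξ hξ => by simp [hbz ξ hξ.le]) hξ))
  have hbz2 : ∀ ξ : Rn n, c < ‖ξ‖ → (b ((1 / 2 : ℝ) • ξ) : ℂ) - b ξ = 0 := fun ξ hξ => by
    rw [hbz ξ (by linarith), hbz _ (by rw [hnorm]; linarith), sub_self]
  obtain ⟨Λ₁, hΛ₁⟩ := exists_fourier_eq
    (χ := fun ξ => ((b ((1 / 2 : ℝ) • ξ) : ℂ) - b ξ) / 𝓕 φ ((1 / 2 : ℝ) • ξ))
    (hcs _ c fun ξ hξ => by rw [hbz2 ξ hξ, zero_div])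
    (contDiff_div_of_tsupport ((hbs.comp (contDiff_const_smul _)).sub hbs)
      (((𝓕 φ).smooth _).comp (contDiff_const_smul _)) fun ξ hξ => hne _ (by
        have : ‖ξ‖ ≤ c := by simpa using hsupp _ c hbz2 hξ
        rw [hnorm]
        linarith))
  refine ⟨θ, Λ₀, Λ₁, ?_, ?_, ⟨?_, c / 4, by positivity, fun ξ hξ => ?_⟩, ?_⟩
  · rw [← fourier_zero, hθ, hb1 _ (by simp; positivity), Complex.ofReal_one]
  · refine ext_fourier fun ξ => ?_
    rw [fourier_cnv, hθ, hΛ₀]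
    by_cases h : ‖ξ‖ ≤ c / 2
    · rw [div_mul_cancel₀ _ (hne ξ h)]
    · rw [hbz ξ (not_le.1 h).le]
      simp
  · refine hcs _ c fun ξ hξ => ?_
    rw [hΛ₁, hbz2 ξ hξ, zero_div]
  · rw [hΛ₁, hb1 ξ hξ.le, hb1 _ (by rw [hnorm]; linarith [norm_nonneg ξ])]
    simp
  · refine ext_fourier fun ξ => ?_
    simp only [FourierTransform.fourier_add, _root_.add_apply, fourier_cnv,
      fourier_dil _ (one_half_pos (α := ℝ)), hθ, hΛ₁]
    by_cases h : ‖ξ‖ ≤ c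
    · rw [div_mul_cancel₀ _ (hne _ (by rw [hnorm]; linarith))]
      ring
    · rw [hbz ξ (by linarith), hbz _ (by rw [hnorm]; linarith)]
      simp

theorem enorm_cv_dil_cnv_le {a : 𝓢(Rn n, ℂ)} {M B : ℝ} (hM : 0 ≤ M)
    (ha : ∀ x, ‖a x‖ ≤ M * ker B 1 x) (b : 𝓢(Rn n, ℂ)) (f : 𝓢'(Rn n, ℂ)) {t : ℝ} (ht : 0 < t)
    (y : Rn n) : ‖cv (dil (cnv a b) t) f y‖ₑ ≤
      ENNReal.ofReal M * ∫⁻ v, ENNReal.ofReal (ker B t (y - v)) * ‖cv (dil b t) f v‖ₑ := by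
  rw [dil_cnv _ _ ht, cv_cnv, ← lintegral_const_mul' _ _ (by finiteness)]
  refine (enorm_integral_le_lintegral_enorm _).trans (lintegral_mono fun v => ?_)
  rw [enorm_mul, ← mul_assoc, ← ENNReal.ofReal_mul hM, ← ofReal_norm (dil a t (y - v))]
  gcongr
  exact norm_dil_le ha ht _

/-- Convolutions with an arbitrary test function are controlled by those with `φ`. -/
theorem exists_enorm_cv_dil_le {φ : 𝓢(Rn n, ℂ)} (hφ : ∫ x, φ x = 1) {B : ℝ} (hB : 0 ≤ B) (L : ℕ) :
    ∃ C : ℝ, 0 ≤ C ∧ ∀ (ψ : 𝓢(Rn n, ℂ)) (M : ℝ), 0 ≤ M → (∀ x, ‖ψ x‖ ≤ M * ker B 1 x) →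
      (∀ (i : Fin L → Fin n) x,
        ‖(∂^{fun j => EuclideanSpace.single (i j) (1 : ℝ)} ψ) x‖ ≤ M * ker B 1 x) →
      ∀ (f : 𝓢'(Rn n, ℂ)) (t : ℝ), 0 < t → ∀ y, ‖cv (dil ψ t) f y‖ₑ ≤
        ENNReal.ofReal (C * M) * ∑' m : ℕ, ENNReal.ofReal ((1 / 2) ^ (m * L)) *
          ∫⁻ v, ENNReal.ofReal (ker B t (y - v)) * ‖cv (dil φ ((1 / 2) ^ m * t)) f v‖ₑ := by
  obtain ⟨θ, Λ₀, Λ₁, hθ, hΛ₀, hΛ₁, hθΛ⟩ := exists_decomposition hφ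
  obtain ⟨C₀, hC₀, h₀⟩ := norm_cnv_dil_le Λ₀ hB
  obtain ⟨C₁, hC₁, h₁⟩ := hΛ₁.norm_cnv_dil_le hB L
  -- The factor $2^L$ pays for an index shift: the difference that involves scale $2^{-(m+1)}$ only
  -- carries $2^{-mL}$.
  refine ⟨C₀ + 2 ^ L * C₁, by positivity, fun ψ M hM hψ0 hψ f t ht y => ?_⟩
  have hpos : ∀ m : ℕ, (0 : ℝ) < (1 / 2) ^ m := fun m => by positivity
  have hle : ∀ m : ℕ, (1 / 2 : ℝ) ^ m ≤ 1 := fun m => pow_le_one₀ (by norm_num) (by norm_num)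
  set I : ℕ → ℝ≥0∞ := fun m =>
    ∫⁻ v, ENNReal.ofReal (ker B t (y - v)) * ‖cv (dil φ ((1 / 2) ^ m * t)) f v‖ₑ with hI
  -- Telescoping: consecutive dyadic dilates of `θ` differ by an annular kernel convolved with a
  -- dilate of `φ`.
  have hstep : ∀ m : ℕ, dil θ ((1 / 2) ^ (m + 1)) = dil θ ((1 / 2) ^ m) +
      cnv (dil Λ₁ ((1 / 2) ^ m)) (dil φ ((1 / 2) ^ (m + 1))) := by
    intro m
    rw [pow_succ', ← dil_dil θ one_half_pos (hpos m), hθΛ, dil_add _ _ (hpos m),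
      dil_cnv _ _ (hpos m), dil_dil φ one_half_pos (hpos m)]
  have hsum : ∀ J : ℕ, ‖cv (dil (cnv ψ (dil θ ((1 / 2) ^ J))) t) f y‖ₑ ≤
      ENNReal.ofReal (C₀ * M) * I 0 + ∑ m ∈ Finset.range J,
        ENNReal.ofReal (C₁ * M * (1 / 2) ^ (m * L)) * I (m + 1) := by
    intro J
    induction J with
    | zero =>
      rw [pow_zero, dil_one, hΛ₀, ← cnv_assoc, Finset.sum_range_zero, add_zero]
      have := enorm_cv_dil_cnv_le (a := cnv ψ Λ₀) (M := C₀ * M) (B := B) (by positivity)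
        (fun x => by simpa [dil_one] using h₀ ψ M hM hψ0 1 one_pos le_rfl x) φ f ht y
      simpa [hI] using this
    | succ J ih =>
      rw [hstep, cnv_add, dil_add _ _ ht, cv_add, Finset.sum_range_succ, ← add_assoc]
      refine (enorm_add_le _ _).trans (add_le_add ih ?_)
      rw [← cnv_assoc]
      have := enorm_cv_dil_cnv_le (a := cnv ψ (dil Λ₁ ((1 / 2) ^ J)))
        (M := C₁ * M * (1 / 2) ^ (J * L)) (B := B) (by positivity)
        (fun x => (h₁ ψ M hM hψ _ (hpos J) (hle J) x).trans_eq (by rw [pow_mul]; ring))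
        (dil φ ((1 / 2) ^ (J + 1))) f ht y
      rwa [dil_dil φ (hpos _) ht] at this
  set S : ℝ≥0∞ := ∑' m : ℕ, ENNReal.ofReal ((1 / 2) ^ (m * L)) * I m with hS
  have hbound : ∀ J : ℕ, ‖cv (dil (cnv ψ (dil θ ((1 / 2) ^ J))) t) f y‖ₑ ≤
      ENNReal.ofReal ((C₀ + 2 ^ L * C₁) * M) * S := by
    intro J
    refine (hsum J).trans ?_
    have e1 : I 0 ≤ S := by
      have := ENNReal.le_tsum (f := fun m : ℕ => ENNReal.ofReal ((1 / 2) ^ (m * L)) * I m) 0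
      simpa only [zero_mul, pow_zero, ENNReal.ofReal_one, one_mul] using this
    have e2 : ∑ m ∈ Finset.range J, ENNReal.ofReal (C₁ * M * (1 / 2) ^ (m * L)) * I (m + 1) ≤
        ENNReal.ofReal (2 ^ L * C₁ * M) * S := by
      have : ∀ m : ℕ, ENNReal.ofReal (C₁ * M * (1 / 2) ^ (m * L)) * I (m + 1) =
          ENNReal.ofReal (2 ^ L * C₁ * M) *
            (ENNReal.ofReal ((1 / 2) ^ ((m + 1) * L)) * I (m + 1)) := by
        intro m
        rw [← mul_assoc, ← ENNReal.ofReal_mul (by positivity)]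
        congr 2
        rw [add_mul, pow_add, one_mul]
        have : (2 : ℝ) ^ L * (1 / 2) ^ L = 1 := by rw [← mul_pow]; norm_num
        linear_combination (-C₁ * M * (1 / 2) ^ (m * L)) * this
      simp_rw [this]
      rw [← Finset.mul_sum]
      gcongr
      refine le_trans ?_ (ENNReal.sum_le_tsum (Finset.range (J + 1)))
      rw [Finset.sum_range_succ' (fun m => ENNReal.ofReal ((1 / 2) ^ (m * L)) * I m)]
      exact le_self_add
    rw [add_mul, ENNReal.ofReal_add (by positivity) (by positivity), add_mul]
    gcongr
  -- The dilates of `θ` form an approximate identity, so the bound, uniform in `J`, passes to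
  -- $\psi_t * f(y)$.
  obtain ⟨k, c, -, hk⟩ := exists_cv_le (dil ψ t) f
  have hlim := (tendsto_integral_dil hθ (continuous_cv (dil ψ t) f) hk y).comp
    (tendsto_nhdsWithin_iff.2 ⟨by
      have h2 : Tendsto (fun J : ℕ => (1 / 2 : ℝ) ^ J * t) atTop (𝓝 (0 * t)) :=
        (tendsto_pow_atTop_nhds_zero_of_lt_one (by norm_num) (by norm_num)).mul_const t
      rwa [zero_mul] at h2, Eventually.of_forall fun J => mul_pos (hpos J) ht⟩)
  refine le_of_tendsto' hlim.enorm fun J => ?_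
  refine le_trans (le_of_eq ?_) (hbound J)
  simp only [Function.comp_apply]
  rw [cnv_comm, dil_cnv _ _ ht, cv_cnv, dil_dil _ (hpos J) ht]

end

/-! ### The Peetre maximal function -/

/-- The bracket `1 + |x| / t` as an extended nonnegative real. -/
def ebr (t : ℝ) (x : Rn n) : ℝ≥0∞ := ENNReal.ofReal (br t x)

theorem ebr_ne_zero {t : ℝ} (ht : 0 < t) (x : Rn n) : ebr t x ≠ 0 := by
  simpa [ebr] using br_pos ht x

theorem ebr_ne_top (t : ℝ) (x : Rn n) : ebr t x ≠ ⊤ := ENNReal.ofReal_ne_top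

theorem ofReal_ker (B : ℝ) {t : ℝ} (ht : 0 < t) (x : Rn n) :
    ENNReal.ofReal (ker B t x) = ENNReal.ofReal ((t ^ n)⁻¹) * ebr t x ^ (-B) := by
  rw [ker, ENNReal.ofReal_mul (by positivity), ebr, ENNReal.ofReal_rpow_of_pos (br_pos ht x)]

theorem ebr_rpow_ne_top {t : ℝ} (ht : 0 < t) (x : Rn n) (a : ℝ) : ebr t x ^ a ≠ ⊤ := by
  simp [ENNReal.rpow_eq_top_iff, ebr_ne_zero ht, ebr_ne_top]

theorem ebr_rpow_add {t : ℝ} (ht : 0 < t) (x : Rn n) (a b : ℝ) :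
    ebr t x ^ (a + b) = ebr t x ^ a * ebr t x ^ b :=
  ENNReal.rpow_add _ _ (ebr_ne_zero ht x) (ebr_ne_top t x)

theorem ebr_rpow_neg_sub_le {t : ℝ} (ht : 0 < t) {A : ℝ} (hA : 0 ≤ A) (x y z : Rn n) :
    ebr t (x - y) ^ (-A) * ebr t (y - z) ^ (-A) ≤ ebr t (x - z) ^ (-A) := by
  simp only [ebr, ENNReal.ofReal_rpow_of_pos (br_pos ht _)]
  rw [← ENNReal.ofReal_mul (Real.rpow_nonneg (br_pos ht _).le _)]
  exact ENNReal.ofReal_le_ofReal (br_rpow_neg_sub_le ht hA x y z)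

theorem rpow_neg_le_rpow_neg {a b : ℝ≥0∞} (h : a ≤ b) {A : ℝ} (hA : 0 ≤ A) :
    b ^ (-A) ≤ a ^ (-A) := by
  rw [ENNReal.rpow_neg, ENNReal.rpow_neg]
  gcongr

theorem ebr_anti {s t : ℝ} (hs : 0 < s) (hst : s ≤ t) (x : Rn n) : ebr t x ≤ ebr s x :=
  ENNReal.ofReal_le_ofReal (br_anti hs hst x)

theorem two_rpow_add (a b : ℝ) : (2 : ℝ≥0∞) ^ (a + b) = 2 ^ a * 2 ^ b :=
  ENNReal.rpow_add _ _ two_ne_zero ENNReal.ofNat_ne_top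

theorem two_rpow_ne_top (a : ℝ) : (2 : ℝ≥0∞) ^ a ≠ ⊤ := by
  simp [ENNReal.rpow_eq_top_iff]

theorem ofReal_half_pow (k : ℕ) : ENNReal.ofReal ((1 / 2) ^ k) = 2 ^ (-(k : ℝ)) := by
  rw [ENNReal.rpow_neg, ENNReal.rpow_natCast, ENNReal.inv_pow, ENNReal.ofReal_pow (by norm_num),
    one_div, ENNReal.ofReal_inv_of_pos two_pos]
  simp

theorem half_pow_le_one (j : ℕ) : (1 / 2 : ℝ) ^ j ≤ 1 := pow_le_one₀ (by norm_num) (by norm_num)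

theorem half_pow_mul_pos (j : ℕ) {t : ℝ} (ht : 0 < t) : 0 < (1 / 2 : ℝ) ^ j * t := by positivity

theorem half_pow_mul_le (j : ℕ) {t : ℝ} (ht : 0 < t) : (1 / 2 : ℝ) ^ j * t ≤ t :=
  mul_le_of_le_one_left ht.le (half_pow_le_one j)

theorem half_pow_mul_half_pow_mul (m j : ℕ) (t : ℝ) :
    (1 / 2 : ℝ) ^ m * ((1 / 2) ^ j * t) = (1 / 2) ^ (m + j) * t := by
  rw [pow_add, mul_assoc]

theorem ofReal_ker_half_pow_le {A : ℝ} (hA : 0 ≤ A) (j : ℕ) {t : ℝ} (ht : 0 < t) (x : Rn n) :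
    ENNReal.ofReal (ker A ((1 / 2) ^ j * t) x) ≤
      2 ^ ((j : ℝ) * n) * ENNReal.ofReal ((t ^ n)⁻¹) * ebr t x ^ (-A) := by
  rw [ofReal_ker A (half_pow_mul_pos j ht)]
  gcongr ?_ * ?_
  · rw [mul_pow, mul_inv, ENNReal.ofReal_mul (by positivity), ENNReal.ofReal_inv_of_pos (by positivity),
      ← pow_mul, ofReal_half_pow, ← ENNReal.rpow_neg, neg_neg]
    push_cast
    rfl
  · exact rpow_neg_le_rpow_neg (ebr_anti (half_pow_mul_pos j ht) (half_pow_mul_le j ht) x) hA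

/-- The dyadic Peetre maximal function at scales below `t`. -/
def dyadicPeetre (F : Rn n → ℝ → ℝ≥0∞) (A : ℝ) (x : Rn n) (t : ℝ) : ℝ≥0∞ :=
  ⨆ (j : ℕ) (z : Rn n), 2 ^ (-(j * A)) * ebr t (x - z) ^ (-A) * F z ((1 / 2) ^ j * t)

/-- The weighted sum of averages that controls `dyadicPeetre`. -/
def dyadicSum (F : Rn n → ℝ → ℝ≥0∞) (A r : ℝ) (x : Rn n) (t : ℝ) : ℝ≥0∞ :=
  ∑' m : ℕ, 2 ^ (-(m * (A * r - n))) *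
    ∫⁻ v, ENNReal.ofReal (ker (A * r) t (x - v)) * F v ((1 / 2) ^ m * t) ^ r

theorem le_dyadicPeetre (F : Rn n → ℝ → ℝ≥0∞) (A : ℝ) (x z : Rn n) {t : ℝ} (ht : 0 < t) (j : ℕ) :
    F z ((1 / 2) ^ j * t) ≤ dyadicPeetre F A x t * (2 ^ (j * A) * ebr t (x - z) ^ A) := by
  have h : 2 ^ (-(j * A)) * ebr t (x - z) ^ (-A) * F z ((1 / 2) ^ j * t) ≤ dyadicPeetre F A x t :=
    le_iSup₂ (f := fun (j : ℕ) (z : Rn n) =>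
      2 ^ (-(j * A)) * ebr t (x - z) ^ (-A) * F z ((1 / 2) ^ j * t)) j z
  have h1 : (2 : ℝ≥0∞) ^ (-(j * A)) * 2 ^ (j * A) = 1 := by
    rw [← two_rpow_add, neg_add_cancel, ENNReal.rpow_zero]
  have h2 : ebr t (x - z) ^ (-A) * ebr t (x - z) ^ A = 1 := by
    rw [← ebr_rpow_add ht, neg_add_cancel, ENNReal.rpow_zero]
  calc F z ((1 / 2) ^ j * t) = ((2 : ℝ≥0∞) ^ (-(j * A)) * 2 ^ (j * A)) *
        (ebr t (x - z) ^ (-A) * ebr t (x - z) ^ A) * F z ((1 / 2) ^ j * t) := by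
        rw [h1, h2, one_mul, one_mul]
    _ = 2 ^ (-(j * A)) * ebr t (x - z) ^ (-A) * F z ((1 / 2) ^ j * t) *
        (2 ^ (j * A) * ebr t (x - z) ^ A) := by ring
    _ ≤ _ := by gcongr

/-- Allows an estimate obtained with a large exponent, chosen depending on the distribution, to be
restated with the fixed exponent `A`. -/
theorem dyadicSum_anti (F : Rn n → ℝ → ℝ≥0∞) {A A' r : ℝ} (hr : 0 ≤ r) (hA : A ≤ A') (x : Rn n)
    {t : ℝ} (ht : 0 < t) : dyadicSum F A' r x t ≤ dyadicSum F A r x t := by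
  unfold dyadicSum
  refine ENNReal.tsum_le_tsum fun m => ?_
  have h : A * r ≤ A' * r := by gcongr
  gcongr ?_ * ?_
  · refine ENNReal.rpow_le_rpow_of_exponent_le one_le_two ?_
    have : (0 : ℝ) ≤ m := Nat.cast_nonneg m
    nlinarith
  · refine lintegral_mono fun v => ?_
    gcongr ?_ * _
    refine ENNReal.ofReal_le_ofReal ?_
    unfold ker
    gcongr
    exact one_le_br ht _

/-- The sum based at `z` and scale $2^{-j}t$ is, after shifting the index by `j`, a tail of the sum
based at `x` and scale `t`; the prefactor pays for the change of centre and of normalization. -/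
theorem dyadicSum_scale_le (F : Rn n → ℝ → ℝ≥0∞) {A r : ℝ} (hA : 0 ≤ A * r) (x z : Rn n)
    {t : ℝ} (ht : 0 < t) (j : ℕ) :
    2 ^ (-(j * (A * r))) * ebr t (x - z) ^ (-(A * r)) * dyadicSum F A r z ((1 / 2) ^ j * t) ≤
      dyadicSum F A r x t := by
  have key : ∀ m : ℕ, 2 ^ (-(j * (A * r))) * ebr t (x - z) ^ (-(A * r)) *
      (2 ^ (-(m * (A * r - n))) * ∫⁻ v, ENNReal.ofReal (ker (A * r) ((1 / 2) ^ j * t) (z - v)) *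
        F v ((1 / 2) ^ m * ((1 / 2) ^ j * t)) ^ r) ≤
      2 ^ (-((m + j : ℕ) * (A * r - n))) *
        ∫⁻ v, ENNReal.ofReal (ker (A * r) t (x - v)) * F v ((1 / 2) ^ (m + j) * t) ^ r := by
    intro m
    rw [← mul_assoc, ← lintegral_const_mul' _ _ (two_rpow_ne_top _), ← lintegral_const_mul']
    swap
    · exact ENNReal.mul_ne_top (ENNReal.mul_ne_top (two_rpow_ne_top _) (ebr_rpow_ne_top ht _ _))
        (two_rpow_ne_top _)
    refine lintegral_mono fun v => ?_
    rw [half_pow_mul_half_pow_mul, ← mul_assoc]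
    conv_rhs => rw [← mul_assoc]
    gcongr ?_ * _
    calc _ ≤ 2 ^ (-(j * (A * r))) * ebr t (x - z) ^ (-(A * r)) * 2 ^ (-(m * (A * r - n))) *
          (2 ^ ((j : ℝ) * n) * ENNReal.ofReal ((t ^ n)⁻¹) * ebr t (z - v) ^ (-(A * r))) := by
          gcongr
          exact ofReal_ker_half_pow_le hA j ht _
      _ = (2 ^ (-(j * (A * r))) * 2 ^ (-(m * (A * r - n))) * 2 ^ ((j : ℝ) * n)) *
          (ENNReal.ofReal ((t ^ n)⁻¹) * (ebr t (x - z) ^ (-(A * r)) *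
            ebr t (z - v) ^ (-(A * r)))) := by ring
      _ ≤ _ := by
          rw [ofReal_ker _ ht, ← two_rpow_add, ← two_rpow_add]
          gcongr ?_ * (_ * ?_)
          · refine le_of_eq (congrArg _ ?_)
            push_cast
            ring
          · exact ebr_rpow_neg_sub_le ht hA _ _ _
  unfold dyadicSum
  rw [← ENNReal.tsum_mul_left]
  refine (ENNReal.tsum_le_tsum key).trans ?_
  exact ENNReal.tsum_comp_le_tsum_of_injective (add_left_injective j) (fun k : ℕ =>
    2 ^ (-(k * (A * r - n))) *
      ∫⁻ v, ENNReal.ofReal (ker (A * r) t (x - v)) * F v ((1 / 2) ^ k * t) ^ r)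

/-- A self-improving inequality implies the sub-mean value property. -/
theorem dyadicPeetre_rpow_le {F : Rn n → ℝ → ℝ≥0∞} {A r : ℝ} (hA : 0 ≤ A) (hr : 0 < r)
    (hr1 : r < 1) {L : ℕ} (hL : A ≤ L) {D : ℝ≥0}
    (hF : ∀ z t, 0 < t → F z t ≤ D * ∑' m : ℕ, ENNReal.ofReal ((1 / 2) ^ (m * L)) *
      ∫⁻ v, ENNReal.ofReal (ker A t (z - v)) * F v ((1 / 2) ^ m * t))
    (x : Rn n) {t : ℝ} (ht : 0 < t) (hfin : dyadicPeetre F A x t ≠ ⊤) :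
    dyadicPeetre F A x t ^ r ≤ D * dyadicSum F A r x t := by
  set P := dyadicPeetre F A x t with hP
  rcases eq_or_ne P 0 with h0 | h0
  · rw [h0, ENNReal.zero_rpow_of_pos hr]
    exact zero_le
  have hP1 : P ^ (1 - r) ≠ 0 := by simp [ENNReal.rpow_eq_zero_iff, h0, hfin]
  have hP2 : P ^ (1 - r) ≠ ⊤ := ENNReal.rpow_ne_top_of_nonneg (by linarith) hfin
  have key : ∀ (j : ℕ) (z : Rn n) (m : ℕ), 2 ^ (-(j * A)) * ebr t (x - z) ^ (-A) *
      (ENNReal.ofReal ((1 / 2) ^ (m * L)) *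
        ∫⁻ v, ENNReal.ofReal (ker A ((1 / 2) ^ j * t) (z - v)) *
          F v ((1 / 2) ^ m * ((1 / 2) ^ j * t))) ≤
      P ^ (1 - r) * (2 ^ (-((m + j : ℕ) * (A * r - n))) *
        ∫⁻ v, ENNReal.ofReal (ker (A * r) t (x - v)) * F v ((1 / 2) ^ (m + j) * t) ^ r) := by
    intro j z m
    rw [ofReal_half_pow, ← mul_assoc, ← lintegral_const_mul' _ _ (two_rpow_ne_top _),
      ← lintegral_const_mul' _ _ hP2, ← lintegral_const_mul']
    swap
    · exact ENNReal.mul_ne_top (ENNReal.mul_ne_top (two_rpow_ne_top _) (ebr_rpow_ne_top ht _ _))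
        (two_rpow_ne_top _)
    refine lintegral_mono fun v => ?_
    rw [half_pow_mul_half_pow_mul]
    set G := F v ((1 / 2) ^ (m + j) * t) with hG
    -- The power $G^{1-r}$ is bounded by the Peetre maximal function itself; only $G^r$ stays under
    -- the integral.
    have hG1 : G ≤ G ^ r * (P ^ (1 - r) * (2 ^ (((m + j : ℕ) * A) * (1 - r)) *
        ebr t (x - v) ^ (A * (1 - r)))) := by
      calc G = G ^ r * G ^ (1 - r) := by
            rw [← ENNReal.rpow_add_of_nonneg _ _ hr.le (by linarith), add_sub_cancel,
              ENNReal.rpow_one]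
        _ ≤ G ^ r * (P * (2 ^ ((m + j : ℕ) * A) * ebr t (x - v) ^ A)) ^ (1 - r) := by
            gcongr
            exact le_dyadicPeetre F A x v ht (m + j)
        _ = _ := by
            rw [ENNReal.mul_rpow_of_nonneg _ _ (by linarith),
              ENNReal.mul_rpow_of_nonneg _ _ (by linarith), ← ENNReal.rpow_mul, ← ENNReal.rpow_mul]
    calc _ ≤ 2 ^ (-(j * A)) * ebr t (x - z) ^ (-A) * 2 ^ (-((m * L : ℕ) : ℝ)) *
          ((2 ^ ((j : ℝ) * n) * ENNReal.ofReal ((t ^ n)⁻¹) * ebr t (z - v) ^ (-A)) *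
          (G ^ r * (P ^ (1 - r) * (2 ^ (((m + j : ℕ) * A) * (1 - r)) *
            ebr t (x - v) ^ (A * (1 - r)))))) := by
          gcongr
          exact ofReal_ker_half_pow_le hA j ht _
      _ = P ^ (1 - r) * ((2 ^ (-(j * A)) * 2 ^ (-((m * L : ℕ) : ℝ)) * 2 ^ ((j : ℝ) * n) *
          2 ^ (((m + j : ℕ) * A) * (1 - r))) * ((ENNReal.ofReal ((t ^ n)⁻¹) *
          ((ebr t (x - z) ^ (-A) * ebr t (z - v) ^ (-A)) * ebr t (x - v) ^ (A * (1 - r)))) *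
          G ^ r)) := by ring
      _ ≤ P ^ (1 - r) * (2 ^ (-((m + j : ℕ) * (A * r - n))) * ((ENNReal.ofReal ((t ^ n)⁻¹) *
          (ebr t (x - v) ^ (-A) * ebr t (x - v) ^ (A * (1 - r)))) * G ^ r)) := by
          rw [← two_rpow_add, ← two_rpow_add, ← two_rpow_add]
          gcongr _ * (?_ * ((_ * (?_ * _)) * _))
          -- The two exponents differ by $m(A - L - n)$, which is nonpositive as $A \le L$.
          · refine ENNReal.rpow_le_rpow_of_exponent_le one_le_two ?_
            push_cast
            have : (0 : ℝ) ≤ m := Nat.cast_nonneg m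
            have hn0 : (0 : ℝ) ≤ n := Nat.cast_nonneg n
            nlinarith [mul_nonneg this (sub_nonneg.2 hL), mul_nonneg this hn0]
          · exact ebr_rpow_neg_sub_le ht hA _ _ _
      _ = _ := by
          rw [← ebr_rpow_add ht, ofReal_ker _ ht]
          congr 6
          ring
  have hle : P ≤ (D * dyadicSum F A r x t) * P ^ (1 - r) := by
    refine iSup₂_le fun j z => ?_
    calc _ ≤ 2 ^ (-(j * A)) * ebr t (x - z) ^ (-A) * (D * ∑' m : ℕ,
          ENNReal.ofReal ((1 / 2) ^ (m * L)) *
          ∫⁻ v, ENNReal.ofReal (ker A ((1 / 2) ^ j * t) (z - v)) *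
            F v ((1 / 2) ^ m * ((1 / 2) ^ j * t))) := by
          gcongr
          exact hF z _ (half_pow_mul_pos j ht)
      _ = D * ∑' m : ℕ, 2 ^ (-(j * A)) * ebr t (x - z) ^ (-A) *
          (ENNReal.ofReal ((1 / 2) ^ (m * L)) *
          ∫⁻ v, ENNReal.ofReal (ker A ((1 / 2) ^ j * t) (z - v)) *
            F v ((1 / 2) ^ m * ((1 / 2) ^ j * t))) := by
          rw [ENNReal.tsum_mul_left]
          ring
      _ ≤ D * (P ^ (1 - r) * dyadicSum F A r x t) := by
          gcongr
          refine (ENNReal.tsum_le_tsum (key j z)).trans ?_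
          rw [ENNReal.tsum_mul_left]
          gcongr
          exact ENNReal.tsum_comp_le_tsum_of_injective (add_left_injective j) (fun k : ℕ =>
            2 ^ (-(k * (A * r - n))) *
              ∫⁻ v, ENNReal.ofReal (ker (A * r) t (x - v)) * F v ((1 / 2) ^ k * t) ^ r)
      _ = _ := by ring
  -- Cancelling $P^{1-r}$ is the only place where finiteness of `P` is essential.
  have hsplit : P = P ^ r * P ^ (1 - r) := by
    rw [← ENNReal.rpow_add_of_nonneg _ _ hr.le (by linarith), add_sub_cancel, ENNReal.rpow_one]
  rw [hsplit] at hle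
  conv_rhs at hle => rw [← hsplit]
  exact (ENNReal.mul_le_mul_iff_left hP1 hP2).1 hle

/-! ### The Peetre maximal function of a tempered distribution. -/

section

open LineDeriv

theorem exists_norm_iteratedLineDeriv_le_ker (a : 𝓢(Rn n, ℂ)) (B : ℝ) (L : ℕ) :
    ∃ M : ℝ, 0 ≤ M ∧ (∀ x, ‖a x‖ ≤ M * ker B 1 x) ∧ ∀ (i : Fin L → Fin n) x,
      ‖(∂^{fun j => EuclideanSpace.single (i j) (1 : ℝ)} a) x‖ ≤ M * ker B 1 x := by
  obtain ⟨c, hc0, hc⟩ := exists_norm_le_ker a B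
  choose d hd0 hd using fun i : Fin L → Fin n =>
    exists_norm_le_ker (∂^{fun j => EuclideanSpace.single (i j) (1 : ℝ)} a) B
  have hs : 0 ≤ ∑ i, d i := Finset.sum_nonneg fun i _ => hd0 i
  refine ⟨c + ∑ i, d i, by positivity, fun x => (hc x).trans ?_, fun i x => (hd i x).trans ?_⟩
  · have := ker_nonneg B one_pos x
    gcongr
    linarith
  · have := ker_nonneg B one_pos x
    gcongr
    have := Finset.single_le_sum (f := d) (fun i _ => hd0 i) (Finset.mem_univ i)
    linarith

theorem exists_enorm_cv_self_le {φ : 𝓢(Rn n, ℂ)} (hφ : ∫ x, φ x = 1) {A : ℝ} (hA : 0 ≤ A) (L : ℕ) :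
    ∃ D : ℝ≥0, ∀ (f : 𝓢'(Rn n, ℂ)) (z : Rn n) (t : ℝ), 0 < t →
      ‖cv (dil φ t) f z‖ₑ ≤ D * ∑' m : ℕ, ENNReal.ofReal ((1 / 2) ^ (m * L)) *
        ∫⁻ v, ENNReal.ofReal (ker A t (z - v)) * ‖cv (dil φ ((1 / 2) ^ m * t)) f v‖ₑ := by
  obtain ⟨C, -, h⟩ := exists_enorm_cv_dil_le hφ hA L
  obtain ⟨M, hM, h1, h2⟩ := exists_norm_iteratedLineDeriv_le_ker φ A L
  exact ⟨(C * M).toNNReal, fun f z t ht => h φ M hM h1 h2 f t ht z⟩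

/-- The polynomial bounds on $\varphi_t * f$ are beaten once `A` is at least their order, which
depends on `f`. -/
theorem dyadicPeetre_ne_top (φ : 𝓢(Rn n, ℂ)) (f : 𝓢'(Rn n, ℂ)) : ∃ k : ℕ, ∀ A : ℝ, k ≤ A →
    ∀ (x : Rn n) (t : ℝ), 0 < t → dyadicPeetre (fun z t => ‖cv (dil φ t) f z‖ₑ) A x t ≠ ⊤ := by
  obtain ⟨k, hk⟩ := exists_cv_dil_le φ f
  refine ⟨k, fun A hA x t ht => ?_⟩
  obtain ⟨c, hc, h⟩ := hk t ht
  refine ne_top_of_le_ne_top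
    (ENNReal.ofReal_ne_top (r := c * t⁻¹ ^ k * ((1 + ‖x‖) * (1 + t)) ^ k)) ?_
  refine iSup₂_le fun j z => ?_
  have h1 := h _ (half_pow_mul_pos j ht) (half_pow_mul_le j ht) z
  have hb := br_pos ht (x - z)
  have h2 : (2 : ℝ≥0∞) ^ (-(j * A)) = ENNReal.ofReal ((2 : ℝ) ^ (-(j * A))) := by
    rw [← ENNReal.ofReal_rpow_of_pos two_pos]
    simp
  beta_reduce
  rw [h2, ebr, ENNReal.ofReal_rpow_of_pos hb, ← ofReal_norm,
    ← ENNReal.ofReal_mul (by positivity), ← ENNReal.ofReal_mul (by positivity)]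
  refine ENNReal.ofReal_le_ofReal ?_
  have e1 : (2 : ℝ) ^ (-(j * A)) * (((1 / 2 : ℝ) ^ j)⁻¹) ^ k ≤ 1 := by
    have : (((1 / 2 : ℝ) ^ j)⁻¹) ^ k = 2 ^ ((j : ℝ) * k) := by
      rw [← inv_pow, ← pow_mul, one_div, inv_inv, ← Real.rpow_natCast]
      push_cast
      rfl
    rw [this, ← Real.rpow_add two_pos]
    refine Real.rpow_le_one_of_one_le_of_nonpos one_le_two ?_
    have : (j : ℝ) * k ≤ j * A := by gcongr
    linarith
  have e2 : 1 + ‖z‖ ≤ (1 + ‖x‖) * (1 + t) * br t (x - z) := by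
    have hz : ‖z‖ ≤ ‖x‖ + ‖x - z‖ := by
      have := norm_sub_le x (x - z)
      rwa [sub_sub_cancel] at this
    have hbt : t * br t (x - z) = t + ‖x - z‖ := by
      unfold br
      field_simp
    have hone := one_le_br ht (x - z)
    nlinarith [norm_nonneg x, norm_nonneg (x - z), mul_nonneg (norm_nonneg x) (norm_nonneg (x - z)),
      mul_nonneg (norm_nonneg x) ht.le, mul_nonneg (norm_nonneg x) (sub_nonneg.2 hone)]
  have e3 : br t (x - z) ^ (-A) * br t (x - z) ^ k ≤ 1 := by
    rw [← Real.rpow_natCast, ← Real.rpow_add hb]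
    exact Real.rpow_le_one_of_one_le_of_nonpos (one_le_br ht _) (by linarith)
  calc _ ≤ (2 : ℝ) ^ (-(j * A)) * br t (x - z) ^ (-A) *
        (c * (((1 / 2) ^ j * t)⁻¹) ^ k * ((1 + ‖x‖) * (1 + t) * br t (x - z)) ^ k) := by
        gcongr
        exact h1.trans (by gcongr)
    _ = c * t⁻¹ ^ k * ((1 + ‖x‖) * (1 + t)) ^ k *
        ((2 : ℝ) ^ (-(j * A)) * (((1 / 2 : ℝ) ^ j)⁻¹) ^ k) *
        (br t (x - z) ^ (-A) * br t (x - z) ^ k) := by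
        rw [mul_inv, mul_pow, mul_pow _ (br t (x - z))]
        ring
    _ ≤ c * t⁻¹ ^ k * ((1 + ‖x‖) * (1 + t)) ^ k * 1 * 1 := by gcongr
    _ = _ := by ring

/-- The absorption argument needs finiteness at the given `A`, known a priori only for exponents
depending on `f`. A first run with a large exponent bounds $|\varphi_t * f|^r$ by the sum for `A`,
with a constant depending on `f`. This gives finiteness at `A` where the sum is finite, and a second
run at `A` yields a constant independent of `f`. -/
theorem dyadicPeetre_rpow_le_dyadicSum {φ : 𝓢(Rn n, ℂ)} (hφ : ∫ x, φ x = 1) {A r : ℝ} (hA : 0 ≤ A)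
    (hr : 0 < r) (hr1 : r < 1) : ∃ D : ℝ≥0, ∀ (f : 𝓢'(Rn n, ℂ)) (x : Rn n) (t : ℝ), 0 < t →
      dyadicPeetre (fun z t => ‖cv (dil φ t) f z‖ₑ) A x t ^ r ≤
        D * dyadicSum (fun z t => ‖cv (dil φ t) f z‖ₑ) A r x t := by
  obtain ⟨L, hL⟩ := exists_nat_ge A
  obtain ⟨D, hD⟩ := exists_enorm_cv_self_le hφ hA L
  -- The added 1 keeps the constant nonzero, so that the bound is trivial when the sum is infinite.
  refine ⟨D + 1, fun f x t ht => ?_⟩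
  set F : Rn n → ℝ → ℝ≥0∞ := fun z t => ‖cv (dil φ t) f z‖ₑ with hF
  rcases eq_or_ne (dyadicSum F A r x t) ⊤ with hS | hS
  · rw [hS, ENNReal.mul_top (by positivity)]
    exact le_top
  obtain ⟨k, hk⟩ := dyadicPeetre_ne_top φ f
  set A' : ℝ := max A k with hA'
  have hA'0 : 0 ≤ A' := hA.trans (le_max_left _ _)
  obtain ⟨L', hL'⟩ := exists_nat_ge A'
  obtain ⟨D', hD'⟩ := exists_enorm_cv_self_le hφ hA'0 L'
  have hpt : ∀ z s, 0 < s → F z s ^ r ≤ D' * dyadicSum F A r z s := by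
    intro z s hs
    have h1 := dyadicPeetre_rpow_le hA'0 hr hr1 hL' (hD' f) z hs (hk A' (le_max_right _ _) z s hs)
    have h2 : F z s ≤ dyadicPeetre F A' z s := by
      have := le_dyadicPeetre F A' z z hs 0
      simpa [ebr, br] using this
    calc F z s ^ r ≤ dyadicPeetre F A' z s ^ r := by gcongr
      _ ≤ _ := h1
      _ ≤ _ := by
        gcongr
        exact dyadicSum_anti F hr.le (le_max_left _ _) z hs
  have hfin : dyadicPeetre F A x t ≠ ⊤ := by
    have hle : dyadicPeetre F A x t ≤ (D' * dyadicSum F A r x t) ^ (1 / r) := by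
      refine iSup₂_le fun j z => ?_
      rw [← ENNReal.rpow_le_rpow_iff hr, ← ENNReal.rpow_mul, one_div_mul_cancel hr.ne',
        ENNReal.rpow_one, ENNReal.mul_rpow_of_nonneg _ _ hr.le, ENNReal.mul_rpow_of_nonneg _ _ hr.le,
        ← ENNReal.rpow_mul, ← ENNReal.rpow_mul]
      calc _ ≤ 2 ^ (-(j * A) * r) * ebr t (x - z) ^ (-A * r) *
            (D' * dyadicSum F A r z ((1 / 2) ^ j * t)) := by
            gcongr
            exact hpt z _ (half_pow_mul_pos j ht)
        _ = D' * (2 ^ (-(j * (A * r))) * ebr t (x - z) ^ (-(A * r)) *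
            dyadicSum F A r z ((1 / 2) ^ j * t)) := by
            rw [show -(j * A) * r = -(j * (A * r)) by ring, show -A * r = -(A * r) by ring]
            ring
        _ ≤ _ := by
            gcongr
            exact dyadicSum_scale_le F (by positivity) x z ht j
    refine ne_top_of_le_ne_top ?_ hle
    exact ENNReal.rpow_ne_top_of_nonneg (by positivity)
      (ENNReal.mul_ne_top ENNReal.coe_ne_top hS)
  refine (dyadicPeetre_rpow_le hA hr hr1 hL (hD f) x ht hfin).trans ?_
  gcongr
  exact le_self_add

/-- The Peetre maximal function `sup_{t, z} |(φ_t * f)(z)| (1 + |x - z| / t)^{-A}`. -/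
def peetreMax (φ : 𝓢(Rn n, ℂ)) (A : ℝ) (f : 𝓢'(Rn n, ℂ)) (x : Rn n) : ℝ≥0∞ :=
  ⨆ (t : ℝ) (_ : 0 < t) (z : Rn n), ebr t (x - z) ^ (-A) * ‖cv (dil φ t) f z‖ₑ

theorem le_peetreMax (φ : 𝓢(Rn n, ℂ)) (A : ℝ) (f : 𝓢'(Rn n, ℂ)) (x z : Rn n) {t : ℝ} (ht : 0 < t) :
    ‖cv (dil φ t) f z‖ₑ ≤ ebr t (x - z) ^ A * peetreMax φ A f x := by
  have h : ebr t (x - z) ^ (-A) * ‖cv (dil φ t) f z‖ₑ ≤ peetreMax φ A f x :=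
    le_iSup_of_le t (le_iSup_of_le ht (le_iSup (fun z =>
      ebr t (x - z) ^ (-A) * ‖cv (dil φ t) f z‖ₑ) z))
  have h2 : ebr t (x - z) ^ A * ebr t (x - z) ^ (-A) = 1 := by
    rw [← ebr_rpow_add ht, add_neg_cancel, ENNReal.rpow_zero]
  calc _ = ebr t (x - z) ^ A * (ebr t (x - z) ^ (-A) * ‖cv (dil φ t) f z‖ₑ) := by
        rw [← mul_assoc, h2, one_mul]
    _ ≤ _ := by gcongr

theorem enorm_cv_le_radialMax (φ : 𝓢(Rn n, ℂ)) (f : 𝓢'(Rn n, ℂ)) (x : Rn n) {t : ℝ} (ht : 0 < t) :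
    ‖cv (dil φ t) f x‖ₑ ≤ radialMax φ f x := by
  rw [← convDil_eq φ t ht]
  exact le_iSup₂ (f := fun (t : ℝ) (ht : 0 < t) => ‖convDil φ t ht f x‖ₑ) t ht

/-- An uncountable supremum of continuous functions is lower semicontinuous, hence measurable. -/
theorem measurable_radialMax (φ : 𝓢(Rn n, ℂ)) (f : 𝓢'(Rn n, ℂ)) : Measurable (radialMax φ f) := by
  have : LowerSemicontinuous (radialMax φ f) := by
    unfold radialMax
    simp only [convDil_eq]
    refine lowerSemicontinuous_iSup fun t => lowerSemicontinuous_iSup fun ht => ?_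
    exact (continuous_cv _ f).enorm.lowerSemicontinuous
  exact this.measurable

theorem measurable_peetreMax (φ : 𝓢(Rn n, ℂ)) (A : ℝ) (f : 𝓢'(Rn n, ℂ)) :
    Measurable (peetreMax φ A f) := by
  have : LowerSemicontinuous (peetreMax φ A f) := by
    unfold peetreMax
    refine lowerSemicontinuous_iSup fun t => lowerSemicontinuous_iSup fun ht =>
      lowerSemicontinuous_iSup fun z => Continuous.lowerSemicontinuous ?_
    have h1 : Continuous fun x : Rn n => ENNReal.ofReal (br t (x - z) ^ (-A)) :=
      ENNReal.continuous_ofReal.comp (((continuous_br t).comp (by fun_prop)).rpow_const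
        fun x => Or.inl (br_pos ht _).ne')
    simp only [ebr, ENNReal.ofReal_rpow_of_pos (br_pos ht _)]
    exact h1.ennreal_mul continuous_const (fun x => Or.inr (by simp)) (fun x => Or.inr (by simp))
  exact this.measurable

theorem tsum_two_rpow_ne_top {a : ℝ} (ha : 0 < a) : ∑' m : ℕ, (2 : ℝ≥0∞) ^ (-(m * a)) ≠ ⊤ := by
  have h1 : ∀ m : ℕ, (2 : ℝ≥0∞) ^ (-(m * a)) = (2 ^ (-a)) ^ m := by
    intro m
    rw [← ENNReal.rpow_natCast, ← ENNReal.rpow_mul]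
    congr 1
    ring
  simp_rw [h1]
  rw [ENNReal.tsum_geometric, ne_eq, ENNReal.inv_eq_top, tsub_eq_zero_iff_le, not_le]
  exact ENNReal.rpow_lt_one_of_one_lt_of_neg (by norm_num) (by linarith)

/-- The Peetre maximal function is controlled by the radial one. -/
theorem peetreMax_rpow_le {φ : 𝓢(Rn n, ℂ)} (hφ : ∫ x, φ x = 1) {A r : ℝ} (hr : 0 < r) (hr1 : r < 1)
    (hAr : n < A * r) : ∃ C : ℝ≥0, ∀ (f : 𝓢'(Rn n, ℂ)) (x : Rn n),
      peetreMax φ A f x ^ r ≤ C * hlMax (fun y => radialMax φ f y ^ r) x := by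
  have hA : 0 ≤ A := by
    by_contra! h
    have : A * r ≤ 0 := by nlinarith
    have : (0 : ℝ) ≤ n := Nat.cast_nonneg n
    linarith
  obtain ⟨D, hD⟩ := dyadicPeetre_rpow_le_dyadicSum hφ hA hr hr1
  obtain ⟨C, hC⟩ := lintegral_ker_mul_le hAr
  set Q : ℝ≥0∞ := ∑' m : ℕ, 2 ^ (-(m * (A * r - n))) with hQ
  have hQ1 : Q ≠ ⊤ := tsum_two_rpow_ne_top (by linarith)
  refine ⟨D * (Q.toNNReal * C), fun f x => ?_⟩
  set R := fun y => radialMax φ f y ^ r with hR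
  set F : Rn n → ℝ → ℝ≥0∞ := fun z t => ‖cv (dil φ t) f z‖ₑ with hF
  have h1 : ∀ t, 0 < t → dyadicSum F A r x t ≤ Q * (C * hlMax R x) := by
    intro t ht
    rw [hQ, ← ENNReal.tsum_mul_right]
    refine ENNReal.tsum_le_tsum fun m => ?_
    gcongr
    refine le_trans (lintegral_mono fun v => ?_)
      (hC t ht R ((measurable_radialMax φ f).pow_const r) x)
    gcongr
    refine ENNReal.rpow_le_rpow ?_ hr.le
    exact enorm_cv_le_radialMax φ f v (half_pow_mul_pos m ht)
  have h2 : ∀ t, 0 < t → ∀ z, ebr t (x - z) ^ (-A) * F z t ≤ dyadicPeetre F A x t := by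
    intro t ht z
    have := le_iSup₂ (f := fun (j : ℕ) (z : Rn n) =>
      2 ^ (-(j * A)) * ebr t (x - z) ^ (-A) * F z ((1 / 2) ^ j * t)) 0 z
    simpa [dyadicPeetre] using this
  rw [← ENNReal.rpow_inv_rpow hr.ne' ((D * (Q.toNNReal * C) : ℝ≥0) * hlMax R x)]
  gcongr
  refine iSup₂_le fun t ht => iSup_le fun z => (h2 t ht z).trans ?_
  rw [← ENNReal.rpow_le_rpow_iff hr, ENNReal.rpow_inv_rpow hr.ne']
  refine (hD f x t ht).trans ?_
  push_cast
  rw [ENNReal.coe_toNNReal hQ1]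
  calc _ ≤ D * (Q * (C * hlMax R x)) := by
        gcongr
        exact h1 t ht
    _ = _ := by ring

end

section

open LineDeriv Metric

/-! ### Control of the grand maximal function -/

/-- Average over the ball about `v` and enlarge it to the ball about `x` of radius $s+|x-v|$; the
volume ratio is the bracket to the power `n`. -/
theorem le_hlMax_of_le_on_ball {G : ℝ≥0∞} {N : Rn n → ℝ≥0∞} {v : Rn n} {s : ℝ} (hs : 0 < s)
    (h : ∀ u ∈ closedBall v s, G ≤ N u) (x : Rn n) :
    G ≤ (unitVol n)⁻¹ * ebr s (x - v) ^ (n : ℝ) * hlMax N x := by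
  have h1 : G * (ENNReal.ofReal (s ^ n) * unitVol n) ≤
      ENNReal.ofReal ((s + ‖x - v‖) ^ n) * hlMax N x := by
    rw [← volume_closedBall_eq v hs.le, ← setLIntegral_const]
    calc _ ≤ ∫⁻ u in closedBall v s, N u := setLIntegral_mono' measurableSet_closedBall h
      _ ≤ ∫⁻ u in closedBall x (s + ‖x - v‖), N u := by
          refine lintegral_mono_set (closedBall_subset_closedBall' ?_)
          rw [dist_comm, dist_eq_norm]
      _ ≤ _ := lintegral_closedBall_le_hlMax N x (by positivity)
  have h2 : ENNReal.ofReal ((s + ‖x - v‖) ^ n) =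
      ENNReal.ofReal (s ^ n) * ebr s (x - v) ^ (n : ℝ) := by
    rw [ebr, ENNReal.rpow_natCast, ← ENNReal.ofReal_pow (br_pos hs _).le,
      ← ENNReal.ofReal_mul (by positivity), ← mul_pow]
    congr 2
    unfold br
    field_simp
  have h3 : ENNReal.ofReal (s ^ n) ≠ 0 := by
    simpa using pow_pos hs n
  rw [h2, mul_left_comm, mul_assoc, ENNReal.mul_le_mul_iff_right h3 ENNReal.ofReal_ne_top] at h1
  rw [mul_assoc, mul_comm, ← div_eq_mul_inv, ENNReal.le_div_iff_mul_le (Or.inl (unitVol_ne_zero n))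
    (Or.inl (unitVol_ne_top n))]
  exact h1

theorem ebr_half_pow_le (m : ℕ) {t : ℝ} (ht : 0 < t) (x : Rn n) :
    ebr ((1 / 2) ^ m * t) x ≤ 2 ^ (m : ℝ) * ebr t x := by
  rw [ENNReal.rpow_natCast, ebr, ebr, show (2 : ℝ≥0∞) ^ m = ENNReal.ofReal (2 ^ m) by
    rw [ENNReal.ofReal_pow two_pos.le]; simp, ← ENNReal.ofReal_mul (by positivity)]
  refine ENNReal.ofReal_le_ofReal ?_
  unfold br
  have h1 : ‖x‖ / ((1 / 2) ^ m * t) = 2 ^ m * (‖x‖ / t) := by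
    rw [one_div, inv_pow]
    field_simp
  have h2 : (1 : ℝ) ≤ 2 ^ m := one_le_pow₀ one_le_two
  rw [h1]
  linarith

theorem enorm_cv_le_peetreMax (φ : 𝓢(Rn n, ℂ)) (A : ℝ) (f : 𝓢'(Rn n, ℂ)) (x : Rn n) {t : ℝ}
    (ht : 0 < t) : ‖cv (dil φ t) f x‖ₑ ≤ peetreMax φ A f x := by
  have := le_peetreMax φ A f x x ht
  simpa [ebr, br] using this

/-- On the ball of radius `s` about `v` the Peetre maximal function is at least $2^{-A}$ times the
value at `v`. Averaging replaces the growth exponent $Ar$ by `n`, whatever `A` is. -/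
theorem enorm_cv_rpow_le_hlMax (φ : 𝓢(Rn n, ℂ)) {A r : ℝ} (hA : 0 ≤ A) (hr : 0 < r)
    (f : 𝓢'(Rn n, ℂ)) (x v : Rn n) {s : ℝ} (hs : 0 < s) :
    ‖cv (dil φ s) f v‖ₑ ^ r ≤ 2 ^ (A * r) * (unitVol n)⁻¹ * ebr s (x - v) ^ (n : ℝ) *
      hlMax (fun y => peetreMax φ A f y ^ r) x := by
  have h := le_hlMax_of_le_on_ball (G := 2 ^ (-(A * r)) * ‖cv (dil φ s) f v‖ₑ ^ r)
    (N := fun y => peetreMax φ A f y ^ r) (v := v) hs (fun u hu => ?_) x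
  · calc ‖cv (dil φ s) f v‖ₑ ^ r =
          2 ^ (A * r) * (2 ^ (-(A * r)) * ‖cv (dil φ s) f v‖ₑ ^ r) := by
          rw [← mul_assoc, ← two_rpow_add, add_neg_cancel, ENNReal.rpow_zero, one_mul]
      _ ≤ 2 ^ (A * r) * ((unitVol n)⁻¹ * ebr s (x - v) ^ (n : ℝ) *
          hlMax (fun y => peetreMax φ A f y ^ r) x) := by gcongr
      _ = _ := by ring
  · have h1 := le_peetreMax φ A f u v hs
    have h2 : ebr s (u - v) ≤ 2 := by
      have h2' : ENNReal.ofReal 2 = 2 := by simp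
      refine (ENNReal.ofReal_le_ofReal ?_).trans h2'.le
      rw [mem_closedBall, dist_eq_norm] at hu
      have : ‖u - v‖ / s ≤ 1 := by rwa [div_le_one hs]
      unfold br
      linarith
    calc 2 ^ (-(A * r)) * ‖cv (dil φ s) f v‖ₑ ^ r ≤
          2 ^ (-(A * r)) * (2 ^ A * peetreMax φ A f u) ^ r := by
          gcongr
          exact h1.trans (by gcongr)
      _ = peetreMax φ A f u ^ r := by
          rw [ENNReal.mul_rpow_of_nonneg _ _ hr.le, ← ENNReal.rpow_mul, ← mul_assoc, ← two_rpow_add,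
            neg_add_cancel, ENNReal.rpow_zero, one_mul]

/-- Convolutions with test functions of limited smoothness and decay are controlled by the
Peetre maximal function. -/
theorem exists_enorm_cv_le_hlMax {φ : 𝓢(Rn n, ℂ)} (hφ : ∫ x, φ x = 1) {A r : ℝ} (hA : 0 ≤ A)
    (hr : 0 < r) (hr1 : r < 1) {L : ℕ} (hL : n / r < L + n) :
    ∃ C : ℝ≥0, ∀ (ψ : 𝓢(Rn n, ℂ)) (M : ℝ), 0 < M → (∀ x, ‖ψ x‖ ≤ M * ker (L + n) 1 x) →
      (∀ (i : Fin L → Fin n) x,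
        ‖(∂^{fun j => EuclideanSpace.single (i j) (1 : ℝ)} ψ) x‖ ≤ M * ker (L + n) 1 x) →
      ∀ (f : 𝓢'(Rn n, ℂ)) (t : ℝ), 0 < t → ∀ x y, ‖y - x‖ ≤ t → ‖cv (dil ψ t) f y‖ₑ ≤
        C * ENNReal.ofReal M * hlMax (fun y => peetreMax φ A f y ^ r) x ^ (1 / r) := by
  have hB : (0 : ℝ) ≤ L + n := by positivity
  obtain ⟨C₁, hC₁, h₁⟩ := exists_enorm_cv_dil_le hφ hB L
  -- Below, $G = G^r (G^r)^e$: the first factor stays under the integral and the second is replaced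
  -- by its growth bound of order $ne = n/r - n$. The hypothesis says $ne < L$, so both the sum over
  -- scales and the kernel of order $L + n - ne$ converge.
  set e : ℝ := (1 - r) / r with he
  have he0 : 0 < e := div_pos (by linarith) hr
  have hne : n * e = n / r - n := by
    rw [he]
    field_simp
  obtain ⟨C₂, h₂⟩ := lintegral_ker_mul_le (n := n) (B := L + n - n * e) (by rw [hne]; linarith)
  have hQ := tsum_two_rpow_ne_top (a := L - n * e) (by rw [hne]; linarith)
  set Q : ℝ≥0∞ := ∑' m : ℕ, (2 : ℝ≥0∞) ^ (-(m * (L - n * e))) with hQdef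
  obtain ⟨D, hD⟩ : ∃ D : ℝ≥0∞, D = 2 ^ (A * r) * (unitVol n)⁻¹ := ⟨_, rfl⟩
  have hDt : D ≠ ⊤ := hD ▸ ENNReal.mul_ne_top (two_rpow_ne_top _) (ENNReal.inv_ne_top.2 (unitVol_ne_zero n))
  set K : ℝ≥0∞ := ENNReal.ofReal C₁ * ENNReal.ofReal (2 ^ ((L : ℝ) + n)) * D ^ e * Q * C₂ with hK
  have hKt : K ≠ ⊤ := by
    have : D ^ e ≠ ⊤ := ENNReal.rpow_ne_top_of_nonneg he0.le hDt
    finiteness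
  refine ⟨K.toNNReal + 1, fun ψ M hM hψ0 hψ f t ht x y hxy => ?_⟩
  set N : Rn n → ℝ≥0∞ := fun y => peetreMax φ A f y ^ r with hN
  have hNm : Measurable N := (measurable_peetreMax φ A f).pow_const r
  set H := hlMax N x with hH
  rcases eq_or_ne H ⊤ with hHt | hHt
  · rw [hHt, ENNReal.top_rpow_of_pos (by positivity), ENNReal.mul_top]
    · exact le_top
    · have : ENNReal.ofReal M ≠ 0 := by simpa using hM
      exact mul_ne_zero (by positivity) this
  have hDH : D ^ e * H ^ e ≠ ⊤ := ENNReal.mul_ne_top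
    (ENNReal.rpow_ne_top_of_nonneg he0.le hDt) (ENNReal.rpow_ne_top_of_nonneg he0.le hHt)
  have hpt : ∀ (m : ℕ) v, ENNReal.ofReal (ker (L + n) t (y - v)) *
      ‖cv (dil φ ((1 / 2) ^ m * t)) f v‖ₑ ≤ ENNReal.ofReal (2 ^ ((L : ℝ) + n)) *
        (2 ^ (m * (n * e)) * (D ^ e * H ^ e)) *
        (ENNReal.ofReal (ker (L + n - n * e) t (x - v)) * N v) := by
    intro m v
    set G := ‖cv (dil φ ((1 / 2) ^ m * t)) f v‖ₑ with hG
    have g1 : G ^ r ≤ N v := by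
      refine ENNReal.rpow_le_rpow ?_ hr.le
      exact enorm_cv_le_peetreMax φ A f v (half_pow_mul_pos m ht)
    have g2 : G ^ r ≤ D * (2 ^ (m : ℝ) * ebr t (x - v)) ^ (n : ℝ) * H := by
      rw [hD]
      refine (enorm_cv_rpow_le_hlMax φ hA hr f x v (half_pow_mul_pos m ht)).trans ?_
      gcongr
      exact ebr_half_pow_le m ht _
    have g3 : G ≤ N v * (D ^ e * (2 ^ (m * (n * e)) * ebr t (x - v) ^ (n * e)) * H ^ e) := by
      calc G = G ^ r * (G ^ r) ^ e := by
            rw [← ENNReal.rpow_mul, ← ENNReal.rpow_add_of_nonneg _ _ hr.le (by positivity), he,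
              mul_div_cancel₀ _ hr.ne', add_sub_cancel, ENNReal.rpow_one]
        _ ≤ N v * (D * (2 ^ (m : ℝ) * ebr t (x - v)) ^ (n : ℝ) * H) ^ e := by gcongr
        _ = _ := by
            rw [ENNReal.mul_rpow_of_nonneg _ _ he0.le, ENNReal.mul_rpow_of_nonneg _ _ he0.le,
              ← ENNReal.rpow_mul, ENNReal.mul_rpow_of_nonneg _ _ (by positivity),
              ← ENNReal.rpow_mul]
    have g4 : ENNReal.ofReal (ker (L + n) t (y - v)) ≤ ENNReal.ofReal (2 ^ ((L : ℝ) + n)) *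
        (ENNReal.ofReal ((t ^ n)⁻¹) * ebr t (x - v) ^ (-((L : ℝ) + n))) := by
      rw [← ofReal_ker _ ht, ← ENNReal.ofReal_mul (by positivity)]
      exact ENNReal.ofReal_le_ofReal (ker_shift_le hB ht hxy v)
    calc _ ≤ (ENNReal.ofReal (2 ^ ((L : ℝ) + n)) *
          (ENNReal.ofReal ((t ^ n)⁻¹) * ebr t (x - v) ^ (-((L : ℝ) + n)))) *
          (N v * (D ^ e * (2 ^ (m * (n * e)) * ebr t (x - v) ^ (n * e)) * H ^ e)) := by gcongr
      _ = ENNReal.ofReal (2 ^ ((L : ℝ) + n)) * (2 ^ (m * (n * e)) * (D ^ e * H ^ e)) *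
          ((ENNReal.ofReal ((t ^ n)⁻¹) * (ebr t (x - v) ^ (-((L : ℝ) + n)) *
            ebr t (x - v) ^ (n * e))) * N v) := by ring
      _ = _ := by
          rw [← ebr_rpow_add ht, ofReal_ker _ ht]
          congr 5
          ring
  have hint : ∀ m : ℕ, ENNReal.ofReal ((1 / 2) ^ (m * L)) *
      ∫⁻ v, ENNReal.ofReal (ker (L + n) t (y - v)) * ‖cv (dil φ ((1 / 2) ^ m * t)) f v‖ₑ ≤
      2 ^ (-(m * (L - n * e))) * (ENNReal.ofReal (2 ^ ((L : ℝ) + n)) * (D ^ e * H ^ e) *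
        (C₂ * H)) := by
    intro m
    rw [ofReal_half_pow]
    calc _ ≤ 2 ^ (-((m * L : ℕ) : ℝ)) * ∫⁻ v, ENNReal.ofReal (2 ^ ((L : ℝ) + n)) *
          (2 ^ (m * (n * e)) * (D ^ e * H ^ e)) *
          (ENNReal.ofReal (ker (L + n - n * e) t (x - v)) * N v) :=
          mul_le_mul' le_rfl (lintegral_mono fun v => hpt m v)
      _ = 2 ^ (-((m * L : ℕ) : ℝ)) * (ENNReal.ofReal (2 ^ ((L : ℝ) + n)) *
          (2 ^ (m * (n * e)) * (D ^ e * H ^ e)) *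
          ∫⁻ v, ENNReal.ofReal (ker (L + n - n * e) t (x - v)) * N v) := by
          rw [lintegral_const_mul']
          exact ENNReal.mul_ne_top ENNReal.ofReal_ne_top
            (ENNReal.mul_ne_top (two_rpow_ne_top _) hDH)
      _ ≤ 2 ^ (-((m * L : ℕ) : ℝ)) * (ENNReal.ofReal (2 ^ ((L : ℝ) + n)) *
          (2 ^ (m * (n * e)) * (D ^ e * H ^ e)) * (C₂ * H)) := by
          gcongr
          exact h₂ t ht N hNm x
      _ = (2 ^ (-((m * L : ℕ) : ℝ)) * 2 ^ (m * (n * e))) * (ENNReal.ofReal (2 ^ ((L : ℝ) + n)) *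
          (D ^ e * H ^ e) * (C₂ * H)) := by ring
      _ = _ := by
          rw [← two_rpow_add]
          congr 2
          push_cast
          ring
  have hHr : H ^ (1 / r) = H ^ e * H := by
    conv_rhs => rw [← ENNReal.rpow_one H, ← ENNReal.rpow_mul]
    rw [← ENNReal.rpow_add_of_nonneg _ _ (by positivity) zero_le_one]
    congr 1
    rw [he]
    field_simp
    ring
  calc _ ≤ ENNReal.ofReal (C₁ * M) * ∑' m : ℕ, 2 ^ (-(m * (L - n * e))) *
        (ENNReal.ofReal (2 ^ ((L : ℝ) + n)) * (D ^ e * H ^ e) * (C₂ * H)) :=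
        (h₁ ψ M hM.le hψ0 hψ f t ht y).trans 
          (mul_le_mul' le_rfl (ENNReal.tsum_le_tsum hint))
    _ = K * ENNReal.ofReal M * H ^ (1 / r) := by
        rw [ENNReal.tsum_mul_right, ENNReal.ofReal_mul hC₁, hHr, hK]
        ring
    _ ≤ _ := by
        gcongr
        push_cast
        rw [ENNReal.coe_toNNReal hKt]
        exact le_self_add

end

section

open Polynomial intervalIntegral

/-! ### One-dimensional oscillatory integrals -/

theorem intervalIntegrable_one_sub_sq_zero_one {ν : ℝ} (hν : -1 < ν) :
    IntervalIntegrable (fun s : ℝ => (1 - s ^ 2) ^ ν) volume 0 1 := by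
  have h1 : IntervalIntegrable (fun s : ℝ => (1 - s) ^ ν) volume 0 1 := by
    have := ((intervalIntegrable_rpow' (a := 0) (b := 1) hν).comp_sub_left 1).symm
    simpa using this
  have h2 : IntervalIntegrable (fun s : ℝ => (1 - s) ^ ν * (1 + s) ^ ν) volume 0 1 := by
    refine h1.mul_continuousOn (ContinuousOn.rpow_const (by fun_prop) fun s hs => Or.inl ?_)
    rw [Set.uIcc_of_le zero_le_one] at hs
    linarith [hs.1]
  refine h2.congr fun s hs => ?_
  rw [Set.uIoc_of_le zero_le_one] at hs
  rw [← Real.mul_rpow (by linarith [hs.2]) (by linarith [hs.1])]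
  congr 1
  ring

theorem intervalIntegrable_one_sub_sq {ν : ℝ} (hν : -1 < ν) :
    IntervalIntegrable (fun s : ℝ => (1 - s ^ 2) ^ ν) volume (-1) 1 := by
  have h := intervalIntegrable_one_sub_sq_zero_one hν
  have h' := (IntervalIntegrable.iff_comp_neg (by simp)).1 h
  simp only [even_two, Even.neg_pow, neg_zero] at h'
  exact h'.symm.trans h

/-- The integrand `e^{iρs} P(s) (1 - s²)^μ`. -/
def oscFun (P : ℝ[X]) (μ ρ s : ℝ) : ℂ :=
  Complex.exp (ρ * s * Complex.I) * ((P.eval s * (1 - s ^ 2) ^ μ : ℝ) : ℂ)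

theorem norm_oscFun (P : ℝ[X]) (μ ρ s : ℝ) :
    ‖oscFun P μ ρ s‖ = |P.eval s| * |(1 - s ^ 2) ^ μ| := by
  rw [oscFun, norm_mul, ← Complex.ofReal_mul, Complex.norm_exp_ofReal_mul_I, one_mul,
    Complex.norm_real, Real.norm_eq_abs, abs_mul]

theorem intervalIntegrable_oscFun (P : ℝ[X]) {μ : ℝ} (ρ : ℝ) {a b : ℝ}
    (h : IntervalIntegrable (fun s : ℝ => (1 - s ^ 2) ^ μ) volume a b) :
    IntervalIntegrable (oscFun P μ ρ) volume a b := by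
  have h1 : IntervalIntegrable (fun s : ℝ => (((1 - s ^ 2) ^ μ : ℝ) : ℂ)) volume a b :=
    ⟨h.1.ofReal, h.2.ofReal⟩
  have h2 : Continuous fun s : ℝ => Complex.exp (ρ * s * Complex.I) * ((P.eval s : ℝ) : ℂ) := by
    have := P.continuous
    fun_prop
  refine (h1.continuousOn_mul h2.continuousOn).congr fun s _ => ?_
  simp only [oscFun]
  push_cast
  ring

theorem hasDerivAt_one_sub_sq_rpow {μ s : ℝ} (hs : 0 < 1 - s ^ 2) :
    HasDerivAt (fun s : ℝ => (1 - s ^ 2) ^ μ) (-2 * s * μ * (1 - s ^ 2) ^ (μ - 1)) s := by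
  have h1 : HasDerivAt (fun s : ℝ => 1 - s ^ 2) (-2 * s) s := by
    have := ((hasDerivAt_id s).pow 2).const_sub 1
    refine this.congr_deriv ?_
    simp
  exact h1.rpow_const (Or.inl hs.ne')

theorem hasDerivAt_eval_mul (P : ℝ[X]) {μ s : ℝ} (hs : 0 < 1 - s ^ 2) :
    HasDerivAt (fun s : ℝ => ((P.eval s * (1 - s ^ 2) ^ μ : ℝ) : ℂ))
      (((derivative P).eval s * (1 - s ^ 2) ^ μ +
        P.eval s * (-2 * s * μ * (1 - s ^ 2) ^ (μ - 1)) : ℝ) : ℂ) s :=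
  ((P.hasDerivAt s).mul (hasDerivAt_one_sub_sq_rpow hs)).ofReal_comp

theorem hasDerivAt_exp_div {ρ : ℝ} (hρ : ρ ≠ 0) (s : ℝ) :
    HasDerivAt (fun s : ℝ => Complex.exp (ρ * s * Complex.I) / (ρ * Complex.I))
      (Complex.exp (ρ * s * Complex.I)) s := by
  have h1 : HasDerivAt (fun s : ℝ => (ρ * s * Complex.I : ℂ)) (ρ * Complex.I) s := by
    have := (((hasDerivAt_id (s : ℂ)).comp_ofReal).const_mul (ρ : ℂ)).mul_const Complex.I
    simpa using this
  have h2 := h1.cexp.div_const (ρ * Complex.I)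
  refine h2.congr_deriv ?_
  have : (ρ : ℂ) ≠ 0 := by exact_mod_cast hρ
  have := Complex.I_ne_zero
  field_simp

theorem norm_exp_div {ρ : ℝ} (s : ℝ) :
    ‖Complex.exp (ρ * s * Complex.I) / (ρ * Complex.I)‖ = |ρ|⁻¹ := by
  rw [norm_div, ← Complex.ofReal_mul, Complex.norm_exp_ofReal_mul_I]
  simp

theorem exists_abs_eval_le (P : ℝ[X]) :
    ∃ M : ℝ, 0 ≤ M ∧ ∀ s ∈ Set.Icc (-1 : ℝ) 1, |P.eval s| ≤ M := by
  obtain ⟨M, hM⟩ := (isCompact_Icc (a := (-1 : ℝ)) (b := 1)).exists_bound_of_continuousOn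
    P.continuous.continuousOn
  exact ⟨M, (norm_nonneg _).trans (hM 0 (by norm_num)), hM⟩

/-- Cut at distance $\varepsilon = 1/|\rho|$ from the singular endpoint. The short piece has size
$\varepsilon^{\mu+1}$ by absolute values. On the rest one integration by parts gains $\varepsilon$,
and the amplitude has size and variation $O(\varepsilon^\mu)$. -/
theorem norm_integral_oscFun_zero_one_le (P : ℝ[X]) {μ : ℝ} (hμ : -1 < μ) (hμ0 : μ ≤ 0) :
    ∃ C : ℝ, 0 ≤ C ∧ ∀ ρ : ℝ, 1 ≤ |ρ| →
      ‖∫ s in (0 : ℝ)..1, oscFun P μ ρ s‖ ≤ C * |ρ| ^ (-(μ + 1)) := by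
  obtain ⟨M₁, hM₁, h₁⟩ := exists_abs_eval_le P
  obtain ⟨M₂, hM₂, h₂⟩ := exists_abs_eval_le (derivative P)
  set M := M₁ + M₂ with hM
  have hM0 : 0 ≤ M := by positivity
  have hμ1 : 0 < μ + 1 := by linarith
  refine ⟨4 * M + M / (μ + 1), by positivity, fun ρ hρ => ?_⟩
  have hρ0 : 0 < |ρ| := by linarith
  have hρne : ρ ≠ 0 := abs_pos.1 hρ0
  set ε := |ρ|⁻¹ with hε
  have hε0 : 0 < ε := by positivity
  have hε1 : ε ≤ 1 := inv_le_one_of_one_le₀ hρ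
  set b := 1 - ε with hb
  have hb0 : 0 ≤ b := by linarith
  have hb1 : b < 1 := by linarith
  have hpow : |ρ| ^ (-(μ + 1)) = ε ^ μ * ε := by
    rw [Real.rpow_neg hρ0.le, ← Real.inv_rpow hρ0.le, ← hε, Real.rpow_add_one hε0.ne']
  have hεμ : 1 ≤ ε ^ μ := by
    have := Real.rpow_le_rpow_of_nonpos hε0 hε1 hμ0
    rwa [Real.one_rpow] at this
  have hsq : ∀ s ∈ Set.Icc 0 b, ε ≤ 1 - s ^ 2 := by
    intro s hs
    have : s ^ 2 ≤ s := by nlinarith [hs.1, hs.2]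
    linarith [hs.2]
  have hle : ∀ s ∈ Set.Icc 0 b, (1 - s ^ 2) ^ μ ≤ ε ^ μ := fun s hs =>
    Real.rpow_le_rpow_of_nonpos hε0 (hsq s hs) hμ0
  have hint := intervalIntegrable_one_sub_sq_zero_one hμ
  have hab : Set.uIcc 0 b ⊆ Set.uIcc 0 1 := by
    rw [Set.uIcc_of_le hb0, Set.uIcc_of_le zero_le_one]
    exact Set.Icc_subset_Icc_right hb1.le
  have hbb : Set.uIcc b 1 ⊆ Set.uIcc 0 1 := by
    rw [Set.uIcc_of_le hb1.le, Set.uIcc_of_le zero_le_one]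
    exact Set.Icc_subset_Icc_left hb0
  have hi0 := hint.mono_set hab
  have hi1 := hint.mono_set hbb
  -- the part near the endpoint
  have e1 : ‖∫ s in b..1, oscFun P μ ρ s‖ ≤ M / (μ + 1) * (ε ^ μ * ε) := by
    have hg : IntervalIntegrable (fun s : ℝ => M * (1 - s) ^ μ) volume b 1 := by
      have := ((intervalIntegrable_rpow' (a := ε) (b := 0) hμ).comp_sub_left 1).const_mul M
      simpa [hb] using this
    refine (norm_integral_le_of_norm_le hb1.le (Eventually.of_forall fun s hs => ?_) hg).trans ?_
    · have hs0 : 0 ≤ s := hb0.trans hs.1.le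
      rw [norm_oscFun]
      have hsq0 : 0 ≤ 1 - s ^ 2 := by nlinarith [hs.2]
      rw [abs_of_nonneg (Real.rpow_nonneg hsq0 μ)]
      gcongr ?_ * ?_
      · exact (h₁ s ⟨by linarith, hs.2⟩).trans (by linarith)
      · rcases hs.2.eq_or_lt with h | h
        · rw [h]
          norm_num
        · exact Real.rpow_le_rpow_of_nonpos (by linarith) (by nlinarith) hμ0
    · rw [intervalIntegral.integral_const_mul, integral_comp_sub_left (fun x : ℝ => x ^ μ) 1, integral_rpow (Or.inl hμ)]
      rw [sub_self, Real.zero_rpow hμ1.ne', hb, sub_sub_cancel, sub_zero, Real.rpow_add_one hε0.ne']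
      exact le_of_eq (by ring)
  -- the main part
  have e2 : ‖∫ s in (0 : ℝ)..b, oscFun P μ ρ s‖ ≤ 4 * M * (ε ^ μ * ε) := by
    have hpos : ∀ s ∈ Set.uIcc 0 b, 0 < 1 - s ^ 2 := fun s hs =>
      hε0.trans_le (hsq s (by rwa [Set.uIcc_of_le hb0] at hs))
    have hc : ∀ ν : ℝ, ContinuousOn (fun s : ℝ => (1 - s ^ 2) ^ ν) (Set.uIcc 0 b) := fun ν =>
      ContinuousOn.rpow_const (by fun_prop) fun s hs => Or.inl (hpos s hs).ne'
    have hcV : ContinuousOn (fun s : ℝ => (((derivative P).eval s * (1 - s ^ 2) ^ μ +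
        P.eval s * (-2 * s * μ * (1 - s ^ 2) ^ (μ - 1)) : ℝ) : ℂ)) (Set.uIcc 0 b) := by
      refine Complex.continuous_ofReal.comp_continuousOn ?_
      exact ((derivative P).continuous.continuousOn.mul (hc μ)).add
        (P.continuous.continuousOn.mul (ContinuousOn.mul (by fun_prop) (hc (μ - 1))))
    have hibp := integral_mul_deriv_eq_deriv_mul (a := 0) (b := b)
      (u := fun s : ℝ => ((P.eval s * (1 - s ^ 2) ^ μ : ℝ) : ℂ))
      (v := fun s : ℝ => Complex.exp (ρ * s * Complex.I) / (ρ * Complex.I))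
      (fun s hs => hasDerivAt_eval_mul P (hpos s hs)) (fun s _ => hasDerivAt_exp_div hρne s)
      hcV.intervalIntegrable (by
        refine Continuous.intervalIntegrable ?_ _ _
        fun_prop)
    have hV : ∀ s ∈ Set.Icc 0 b, ‖((P.eval s * (1 - s ^ 2) ^ μ : ℝ) : ℂ)‖ ≤ M * ε ^ μ := by
      intro s hs
      rw [Complex.norm_real, Real.norm_eq_abs, abs_mul,
        abs_of_nonneg (Real.rpow_nonneg (hε0.le.trans (hsq s hs)) μ)]
      have := Real.rpow_nonneg (hε0.le.trans (hsq s hs)) μ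
      gcongr ?_ * ?_
      · exact (h₁ s ⟨by linarith [hs.1], by linarith [hs.2]⟩).trans (by linarith)
      · exact hle s hs
    have hg : IntervalIntegrable (fun s : ℝ => (M * ε ^ μ +
        M * (-2 * s * μ * (1 - s ^ 2) ^ (μ - 1))) * ε) volume 0 b := by
      refine ContinuousOn.intervalIntegrable ?_
      exact (continuousOn_const.add (continuousOn_const.mul
        (ContinuousOn.mul (by fun_prop) (hc (μ - 1))))).mul continuousOn_const
    have hft : ∫ s in (0 : ℝ)..b, -2 * s * μ * (1 - s ^ 2) ^ (μ - 1) = (1 - b ^ 2) ^ μ - 1 := by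
      have := integral_eq_sub_of_hasDerivAt
        (fun s hs => hasDerivAt_one_sub_sq_rpow (μ := μ) (hpos s hs))
        (ContinuousOn.intervalIntegrable (ContinuousOn.mul (by fun_prop) (hc (μ - 1))))
      simpa using this
    have hI : ‖∫ s in (0 : ℝ)..b, (((derivative P).eval s * (1 - s ^ 2) ^ μ +
        P.eval s * (-2 * s * μ * (1 - s ^ 2) ^ (μ - 1)) : ℝ) : ℂ) *
        (Complex.exp (ρ * s * Complex.I) / (ρ * Complex.I))‖ ≤ 2 * M * (ε ^ μ * ε) := by
      refine (norm_integral_le_of_norm_le hb0 (Eventually.of_forall fun s hs => ?_) hg).trans ?_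
      · have hs' : s ∈ Set.Icc 0 b := ⟨hs.1.le, hs.2⟩
        have hs1 : s ∈ Set.Icc (-1 : ℝ) 1 := ⟨by linarith [hs.1], by linarith [hs.2]⟩
        have hp := hε0.trans_le (hsq s hs')
        rw [norm_mul, norm_exp_div, Complex.norm_real, Real.norm_eq_abs]
        gcongr ?_ * _
        -- As $\mu \le 0$ this derivative has a sign, so its absolute value integrates exactly by
        -- `hft`.
        have hn : 0 ≤ -2 * s * μ * (1 - s ^ 2) ^ (μ - 1) :=
          mul_nonneg (by nlinarith [hs.1]) (Real.rpow_nonneg hp.le _)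
        refine (abs_add_le _ _).trans ?_
        rw [abs_mul, abs_mul, abs_of_nonneg hn, abs_of_nonneg (Real.rpow_nonneg hp.le μ)]
        have := Real.rpow_nonneg hp.le μ
        gcongr ?_ * ?_ + ?_ * _
        · exact (h₂ s hs1).trans (by linarith)
        · exact hle s hs'
        · exact (h₁ s hs1).trans (by linarith)
      · have hcc : IntervalIntegrable (fun s : ℝ => M * (-2 * s * μ * (1 - s ^ 2) ^ (μ - 1)))
            volume 0 b := (continuousOn_const.mul
          (ContinuousOn.mul (by fun_prop) (hc (μ - 1)))).intervalIntegrable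
        rw [intervalIntegral.integral_mul_const, intervalIntegral.integral_add (by simp) hcc,
          intervalIntegral.integral_const, intervalIntegral.integral_const_mul, hft, smul_eq_mul,
          sub_zero]
        have hbm : (1 - b ^ 2) ^ μ ≤ ε ^ μ := hle b ⟨hb0, le_rfl⟩
        have h1 : b * (M * ε ^ μ) ≤ M * ε ^ μ := mul_le_of_le_one_left (by positivity) hb1.le
        have h2 : M * ((1 - b ^ 2) ^ μ - 1) ≤ M * ε ^ μ := by gcongr; linarith
        calc _ ≤ (M * ε ^ μ + M * ε ^ μ) * ε := by gcongr
          _ = _ := by ring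
    have heq : ∫ s in (0 : ℝ)..b, oscFun P μ ρ s =
        ∫ s in (0 : ℝ)..b, ((P.eval s * (1 - s ^ 2) ^ μ : ℝ) : ℂ) *
          Complex.exp (ρ * s * Complex.I) :=
      integral_congr fun s _ => by simp only [oscFun]; ring
    rw [heq, hibp]
    have h3 := norm_sub_le
      (((P.eval b * (1 - b ^ 2) ^ μ : ℝ) : ℂ) * (Complex.exp (ρ * b * Complex.I) / (ρ * Complex.I)))
      (((P.eval 0 * (1 - 0 ^ 2) ^ μ : ℝ) : ℂ) *
        (Complex.exp (ρ * (0 : ℝ) * Complex.I) / (ρ * Complex.I)))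
    rw [norm_mul, norm_mul, norm_exp_div, norm_exp_div, ← hε] at h3
    have h4 := hV b ⟨hb0, le_rfl⟩
    have h5 := hV 0 ⟨le_rfl, hb0⟩
    have h6 := mul_le_mul_of_nonneg_right h4 hε0.le
    have h7 := mul_le_mul_of_nonneg_right h5 hε0.le
    refine ((norm_sub_le _ _).trans (add_le_add (h3.trans (add_le_add h6 h7)) hI)).trans (le_of_eq ?_)
    ring
  rw [← integral_add_adjacent_intervals (intervalIntegrable_oscFun P ρ hi0)
    (intervalIntegrable_oscFun P ρ hi1), hpow]
  refine (norm_add_le _ _).trans ((add_le_add e2 e1).trans (le_of_eq ?_))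
  ring

theorem norm_integral_oscFun_le_of_nonpos (P : ℝ[X]) {μ : ℝ} (hμ : -1 < μ) (hμ0 : μ ≤ 0) :
    ∃ C : ℝ, 0 ≤ C ∧ ∀ ρ : ℝ, 1 ≤ |ρ| →
      ‖∫ s in (-1 : ℝ)..1, oscFun P μ ρ s‖ ≤ C * |ρ| ^ (-(μ + 1)) := by
  obtain ⟨C₁, h₁, H₁⟩ := norm_integral_oscFun_zero_one_le P hμ hμ0
  obtain ⟨C₂, h₂, H₂⟩ := norm_integral_oscFun_zero_one_le (P.comp (-X)) hμ hμ0
  refine ⟨C₂ + C₁, by positivity, fun ρ hρ => ?_⟩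
  have hint := intervalIntegrable_one_sub_sq hμ
  have e0 : Set.uIcc (-1 : ℝ) 0 ⊆ Set.uIcc (-1) 1 := by
    rw [Set.uIcc_of_le (by norm_num), Set.uIcc_of_le (by norm_num)]
    exact Set.Icc_subset_Icc_right zero_le_one
  have e1 : Set.uIcc (0 : ℝ) 1 ⊆ Set.uIcc (-1) 1 := by
    rw [Set.uIcc_of_le (by norm_num), Set.uIcc_of_le (by norm_num)]
    exact Set.Icc_subset_Icc_left (by norm_num)
  rw [← integral_add_adjacent_intervals (intervalIntegrable_oscFun P ρ (hint.mono_set e0))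
    (intervalIntegrable_oscFun P ρ (hint.mono_set e1)), add_mul]
  refine (norm_add_le _ _).trans (add_le_add ?_ (H₁ ρ hρ))
  have h3 := integral_comp_neg (a := 0) (b := 1) (oscFun P μ ρ)
  rw [neg_zero] at h3
  rw [← h3]
  have h4 : ∀ s, oscFun P μ ρ (-s) = oscFun (P.comp (-X)) μ (-ρ) s := by
    intro s
    simp [oscFun]
  simp_rw [h4]
  simpa using H₂ (-ρ) (by simpa using hρ)

/-- For positive `μ` the boundary terms vanish, and integration by parts trades a factor $1/\rho$
for a drop of `μ` by one. The polynomial factor is carried along to make this class of integrands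
stable. -/
theorem integral_oscFun_eq (P : ℝ[X]) {μ : ℝ} (hμ : 0 < μ) {ρ : ℝ} (hρ : ρ ≠ 0) :
    ∫ s in (-1 : ℝ)..1, oscFun P μ ρ s = -(1 / (ρ * Complex.I)) *
      ∫ s in (-1 : ℝ)..1, oscFun (derivative P * (1 - X ^ 2) - C (2 * μ) * X * P) (μ - 1) ρ s := by
  set Q : ℝ[X] := derivative P * (1 - X ^ 2) - C (2 * μ) * X * P with hQ
  have hI : IntervalIntegrable (fun s : ℝ => (1 - s ^ 2) ^ (μ - 1)) volume (-1) 1 :=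
    intervalIntegrable_one_sub_sq (by linarith)
  have hQi : IntervalIntegrable (fun s : ℝ => ((Q.eval s * (1 - s ^ 2) ^ (μ - 1) : ℝ) : ℂ))
      volume (-1) 1 := by
    have := intervalIntegrable_oscFun Q 0 hI
    refine this.congr fun s _ => ?_
    simp [oscFun]
  have hibp := integral_mul_deriv_eq_deriv_mul_of_hasDerivAt (a := -1) (b := 1)
    (u := fun s : ℝ => ((P.eval s * (1 - s ^ 2) ^ μ : ℝ) : ℂ))
    (v := fun s : ℝ => Complex.exp (ρ * s * Complex.I) / (ρ * Complex.I))
    (u' := fun s : ℝ => ((Q.eval s * (1 - s ^ 2) ^ (μ - 1) : ℝ) : ℂ))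
    (v' := fun s : ℝ => Complex.exp (ρ * s * Complex.I))
    (by
      refine (Complex.continuous_ofReal.comp (P.continuous.mul ?_)).continuousOn
      exact Continuous.rpow_const (by fun_prop) fun s => Or.inr hμ.le)
    (by fun_prop)
    (fun s hs => by
      rw [min_eq_left (by norm_num), max_eq_right (by norm_num)] at hs
      have hp : 0 < 1 - s ^ 2 := by nlinarith [hs.1, hs.2]
      refine (hasDerivAt_eval_mul P hp).congr_deriv ?_
      rw [show (1 - s ^ 2) ^ μ = (1 - s ^ 2) ^ (μ - 1) * (1 - s ^ 2) by
        rw [← Real.rpow_add_one hp.ne', sub_add_cancel]]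
      congr 1
      simp [hQ]
      ring)
    (fun s _ => hasDerivAt_exp_div hρ s) hQi
    (by
      refine Continuous.intervalIntegrable ?_ _ _
      fun_prop)
  have heq : ∫ s in (-1 : ℝ)..1, oscFun P μ ρ s =
      ∫ s in (-1 : ℝ)..1, ((P.eval s * (1 - s ^ 2) ^ μ : ℝ) : ℂ) *
        Complex.exp (ρ * s * Complex.I) :=
    integral_congr fun s _ => by simp only [oscFun]; ring
  have heq' : ∫ s in (-1 : ℝ)..1, ((Q.eval s * (1 - s ^ 2) ^ (μ - 1) : ℝ) : ℂ) *
      (Complex.exp (ρ * s * Complex.I) / (ρ * Complex.I)) =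
      1 / (ρ * Complex.I) * ∫ s in (-1 : ℝ)..1, oscFun Q (μ - 1) ρ s := by
    rw [← intervalIntegral.integral_const_mul]
    exact integral_congr fun s _ => by simp only [oscFun]; ring
  rw [heq, hibp, heq']
  simp [Real.zero_rpow (ne_of_gt hμ)]

/-- Decay of the Fourier transform of `P(s) (1 - s²)^μ` on `[-1, 1]`. -/
theorem norm_integral_oscFun_le (P : ℝ[X]) {μ : ℝ} (hμ : -1 < μ) :
    ∃ C : ℝ, 0 ≤ C ∧ ∀ ρ : ℝ, 1 ≤ |ρ| →
      ‖∫ s in (-1 : ℝ)..1, oscFun P μ ρ s‖ ≤ C * |ρ| ^ (-(μ + 1)) := by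
  obtain ⟨k, hk⟩ := exists_nat_ge μ
  induction k generalizing μ P with
  | zero => exact norm_integral_oscFun_le_of_nonpos P hμ (by simpa using hk)
  | succ k ih =>
    rcases le_or_gt μ 0 with h0 | h0
    · exact norm_integral_oscFun_le_of_nonpos P hμ h0
    obtain ⟨D, hD, h⟩ := ih (derivative P * (1 - X ^ 2) - C (2 * μ) * X * P) (μ := μ - 1)
      (by linarith) (by push_cast at hk; linarith)
    refine ⟨D, hD, fun ρ hρ => ?_⟩
    have hρ0 : 0 < |ρ| := by linarith
    rw [integral_oscFun_eq P h0 (abs_pos.1 hρ0), norm_mul]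
    have h1 : ‖-(1 / (ρ * Complex.I))‖ = |ρ| ^ (-1 : ℝ) := by
      rw [Real.rpow_neg_one]
      simp
    rw [h1]
    calc _ ≤ |ρ| ^ (-1 : ℝ) * (D * |ρ| ^ (-(μ - 1 + 1))) := by
          gcongr
          exact h ρ hρ
      _ = D * (|ρ| ^ (-1 : ℝ) * |ρ| ^ (-(μ - 1 + 1))) := by ring
      _ = _ := by
          rw [← Real.rpow_add hρ0]
          congr 2
          ring

end

/-! ### The Bochner–Riesz kernel -/

theorem measurePreserving_splitFirst (k : ℕ) :
    MeasurePreserving (fun ξ : Rn (k + 1) => ((ξ 0, fun i => ξ i.succ) : ℝ × (Fin k → ℝ)))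
      volume volume ∧
    MeasurableEmbedding (fun ξ : Rn (k + 1) => ((ξ 0, fun i => ξ i.succ) : ℝ × (Fin k → ℝ))) := by
  have h1 := EuclideanSpace.volume_preserving_symm_measurableEquiv_toLp (Fin (k + 1))
  have h2 := volume_preserving_piFinSuccAbove (fun _ : Fin (k + 1) => ℝ) 0
  have he : (fun ξ : Rn (k + 1) => ((ξ 0, fun i => ξ i.succ) : ℝ × (Fin k → ℝ))) =
      ⇑(MeasurableEquiv.piFinSuccAbove (fun _ : Fin (k + 1) => ℝ) 0) ∘
        ⇑(MeasurableEquiv.toLp 2 (Fin (k + 1) → ℝ)).symm := by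
    ext ξ
    · rfl
    · rfl
  rw [he]
  exact ⟨h2.comp h1, (MeasurableEquiv.measurableEmbedding _).comp
    (MeasurableEquiv.measurableEmbedding _)⟩

/-- The integral of `(a - |η|²)_+^δ`. -/
def sliceIntegral (k : ℕ) (δ a : ℝ) : ℝ :=
  ∫ η : Fin k → ℝ, (max (a - ∑ i, η i ^ 2) 0) ^ δ

theorem sliceIntegral_of_nonpos (k : ℕ) {δ : ℝ} (hδ : 0 < δ) {a : ℝ} (ha : a ≤ 0) :
    sliceIntegral k δ a = 0 := by
  unfold sliceIntegral
  refine integral_eq_zero_of_ae (Eventually.of_forall fun η => ?_)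
  have : 0 ≤ ∑ i, η i ^ 2 := Finset.sum_nonneg fun i _ => sq_nonneg _
  simp only [Pi.zero_apply]
  rw [max_eq_right (by linarith), Real.zero_rpow hδ.ne']

/-- Scaling by $\sqrt a$ in dimension `k`; this is how slicing raises the exponent from $\delta$ to
$\delta + k/2$. -/
theorem sliceIntegral_of_pos (k : ℕ) (δ : ℝ) {a : ℝ} (ha : 0 < a) :
    sliceIntegral k δ a = a ^ (δ + k / 2) * sliceIntegral k δ 1 := by
  have h := Measure.integral_comp_smul (volume : Measure (Fin k → ℝ))
    (fun η => (max (a - ∑ i, η i ^ 2) 0) ^ δ) (Real.sqrt a)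
  have h2 : ∀ η : Fin k → ℝ, (max (a - ∑ i, (Real.sqrt a • η) i ^ 2) 0) ^ δ =
      a ^ δ * (max (1 - ∑ i, η i ^ 2) 0) ^ δ := by
    intro η
    rw [← Real.mul_rpow ha.le (le_max_right _ _), mul_max_of_nonneg _ _ ha.le, mul_zero]
    congr 2
    simp only [Pi.smul_apply, smul_eq_mul, mul_pow, Real.sq_sqrt ha.le]
    rw [← Finset.mul_sum]
    ring
  simp_rw [h2] at h
  rw [integral_const_mul, smul_eq_mul, Module.finrank_fintype_fun_eq_card, Fintype.card_fin] at h
  have hs : 0 < Real.sqrt a := Real.sqrt_pos.2 ha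
  rw [abs_of_pos (by positivity)] at h
  unfold sliceIntegral
  have h3 : Real.sqrt a ^ k = a ^ ((k : ℝ) / 2) := by
    rw [Real.sqrt_eq_rpow, ← Real.rpow_natCast, ← Real.rpow_mul ha.le]
    congr 1
    ring
  rw [Real.rpow_add ha, ← h3]
  have h4 : Real.sqrt a ^ k ≠ 0 := by positivity
  field_simp at h
  linarith

theorem integrable_symbol {δ : ℝ} (hδ : 0 < δ) {R : ℝ} (hR : 0 < R) :
    Integrable (fun ξ : Rn n => (symbol δ R ξ : ℂ)) volume :=
  (Complex.continuous_ofReal.comp (continuous_symbol hδ R)).integrable_of_hasCompactSupport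
    (hasCompactSupport_symbol hδ hR)

/-- Integration over hyperplanes reduces the kernel to a one-dimensional integral. -/
theorem fourierInv_symbol_eq (k : ℕ) {δ : ℝ} (hδ : 0 < δ) (x : Rn (k + 1)) :
    𝓕⁻ (fun ξ : Rn (k + 1) => (symbol δ 1 ξ : ℂ)) x =
      sliceIntegral k δ 1 * ∫ s in (-1 : ℝ)..1, oscFun 1 (δ + k / 2) (2 * Real.pi * ‖x‖) s := by
  set y : Rn (k + 1) := EuclideanSpace.single 0 ‖x‖ with hy
  have hxy : ‖x‖ = ‖y‖ := by simp [hy]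
  -- A reflection sends `x` to $|x|e_0$, so the phase depends on the first coordinate only while the
  -- radial symbol is unchanged.
  set U := (ℝ ∙ (x - y))ᗮ.reflection with hU
  have hUx : U x = y := Submodule.reflection_sub hxy
  set Φ : ℝ × (Fin k → ℝ) → ℂ := fun z => Complex.exp ((2 * Real.pi * ‖x‖ : ℝ) * z.1 * Complex.I) *
    (((max (1 - z.1 ^ 2 - ∑ i, z.2 i ^ 2) 0) ^ δ : ℝ) : ℂ) with hΦ
  obtain ⟨hT, hTe⟩ := measurePreserving_splitFirst k
  have hpt : ∀ ξ : Rn (k + 1), Real.fourierChar (inner ℝ (U ξ) x) • (symbol δ 1 (U ξ) : ℂ) =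
      Φ (ξ 0, fun i => ξ i.succ) := by
    intro ξ
    have h1 : inner ℝ (U ξ) x = ξ 0 * ‖x‖ := by
      have h2 := U.inner_map_map ξ (U x)
      rw [hU, Submodule.reflection_reflection, ← hU, hUx] at h2
      rw [h2, hy, mul_comm]
      simpa using EuclideanSpace.inner_single_right (0 : Fin (k + 1)) ‖x‖ ξ
    have h3 : ‖ξ‖ ^ 2 = ξ 0 ^ 2 + ∑ i : Fin k, ξ i.succ ^ 2 := by
      rw [EuclideanSpace.norm_sq_eq, Fin.sum_univ_succ]
      simp
    rw [h1, hΦ, symbol, LinearIsometryEquiv.norm_map, h3, Circle.smul_def, Real.fourierChar_apply,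
      smul_eq_mul]
    simp only [one_pow, div_one, sub_sub]
    congr 2
    push_cast
    ring
  have hint : Integrable (fun ξ : Rn (k + 1) =>
      Real.fourierChar (inner ℝ (U ξ) x) • (symbol δ 1 (U ξ) : ℂ)) volume := by
    have h1 : Integrable (fun ξ : Rn (k + 1) => Real.fourierChar (inner ℝ ξ x) •
        (symbol δ 1 ξ : ℂ)) volume := by
      refine ((integrable_symbol hδ one_pos).norm).mono' ?_ ?_
      · refine Continuous.aestronglyMeasurable ?_
        have := Complex.continuous_ofReal.comp (continuous_symbol (n := k + 1) hδ 1)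
        have h2 : Continuous fun ξ : Rn (k + 1) => Real.fourierChar (inner ℝ ξ x) :=
          Real.continuous_fourierChar.comp (by fun_prop)
        exact h2.smul this
      · exact Eventually.of_forall fun ξ => by simp
    exact (U.measurePreserving.integrable_comp_emb U.toHomeomorph.measurableEmbedding).2 h1
  have hΦi : Integrable Φ volume := by
    simp_rw [hpt] at hint
    exact (hT.integrable_comp_emb hTe).1 hint
  have h1 : 𝓕⁻ (fun ξ : Rn (k + 1) => (symbol δ 1 ξ : ℂ)) x = ∫ z, Φ z := by
    rw [Real.fourierInv_eq, ← U.measurePreserving.integral_comp U.toHomeomorph.measurableEmbedding]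
    simp_rw [hpt]
    exact hT.integral_comp hTe Φ
  have h2 : ∀ s : ℝ, ∫ η, Φ (s, η) = Complex.exp ((2 * Real.pi * ‖x‖ : ℝ) * s * Complex.I) *
      (sliceIntegral k δ (1 - s ^ 2) : ℂ) := by
    intro s
    simp only [hΦ]
    rw [integral_const_mul, integral_complex_ofReal, sliceIntegral]
  rw [h1, Measure.volume_eq_prod, integral_prod _ (by rwa [Measure.volume_eq_prod] at hΦi)]
  simp_rw [h2]
  rw [← setIntegral_eq_integral_of_forall_compl_eq_zero (s := Set.Ioc (-1 : ℝ) 1),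
    ← intervalIntegral.integral_of_le (by norm_num), ← intervalIntegral.integral_const_mul]
  · refine intervalIntegral.integral_congr fun s hs => ?_
    rw [Set.uIcc_of_le (by norm_num)] at hs
    simp only [oscFun, Polynomial.eval_one, one_mul]
    have hsq : 0 ≤ 1 - s ^ 2 := by nlinarith [hs.1, hs.2]
    have hμ : δ + (k : ℝ) / 2 ≠ 0 := by positivity
    rcases hsq.eq_or_lt with h0 | h0
    · rw [← h0, sliceIntegral_of_nonpos k hδ le_rfl, Real.zero_rpow hμ]
      simp
    · rw [sliceIntegral_of_pos k δ h0]
      push_cast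
      ring
  · intro s hs
    have : 1 - s ^ 2 ≤ 0 := by
      rw [Set.mem_Ioc, not_and_or, not_lt, not_le] at hs
      rcases hs with h | h <;> nlinarith
    rw [sliceIntegral_of_nonpos k hδ this]
    simp

/-- The one-dimensional decay for large $|x|$, the $L^1$ norm of the symbol for small $|x|$. With $n
= k+1$ the exponent is $\delta + (n+1)/2$. -/
theorem exists_norm_fourierInv_symbol_one_le (k : ℕ) {δ : ℝ} (hδ : 0 < δ) :
    ∃ C : ℝ, 0 ≤ C ∧ ∀ x : Rn (k + 1), ‖𝓕⁻ (fun ξ : Rn (k + 1) => (symbol δ 1 ξ : ℂ)) x‖ ≤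
      C * (1 + ‖x‖) ^ (-(δ + k / 2 + 1)) := by
  have hμ : 0 < δ + (k : ℝ) / 2 := by positivity
  obtain ⟨D, hD, h⟩ := norm_integral_oscFun_le 1 (μ := δ + k / 2) (by linarith)
  set q := δ + (k : ℝ) / 2 + 1 with hq
  have hq0 : 0 < q := by positivity
  set M := ∫ ξ : Rn (k + 1), ‖(symbol δ 1 ξ : ℂ)‖ with hM
  have hM0 : 0 ≤ M := integral_nonneg fun _ => norm_nonneg _
  refine ⟨(|sliceIntegral k δ 1| * D + M) * 2 ^ q, by positivity, fun x => ?_⟩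
  have hpi := Real.pi_gt_three
  have hx1 : 0 < 1 + ‖x‖ := by positivity
  have key : ∀ c : ℝ, 0 < c → 1 + ‖x‖ ≤ 2 * c → c ^ (-q) ≤ 2 ^ q * (1 + ‖x‖) ^ (-q) := by
    intro c hc hle
    have h1 : (2 * c) ^ (-q) ≤ (1 + ‖x‖) ^ (-q) :=
      Real.rpow_le_rpow_of_nonpos hx1 hle (by linarith)
    rw [Real.mul_rpow two_pos.le hc.le] at h1
    calc c ^ (-q) = 2 ^ q * (2 ^ (-q) * c ^ (-q)) := by
          rw [← mul_assoc, ← Real.rpow_add two_pos]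
          simp
      _ ≤ _ := by gcongr
  have hA := abs_nonneg (sliceIntegral k δ 1)
  rcases le_total 1 (2 * Real.pi * ‖x‖) with h1 | h1
  · have h2 := h (2 * Real.pi * ‖x‖) (h1.trans (le_abs_self _))
    rw [abs_of_nonneg (by positivity)] at h2
    have h3 := key (2 * Real.pi * ‖x‖) (by linarith) (by nlinarith [norm_nonneg x])
    rw [fourierInv_symbol_eq k hδ, norm_mul, Complex.norm_real, Real.norm_eq_abs]
    calc _ ≤ |sliceIntegral k δ 1| * (D * (2 ^ q * (1 + ‖x‖) ^ (-q))) := by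
          gcongr
          exact h2.trans (by gcongr)
      _ ≤ |sliceIntegral k δ 1| * (D * (2 ^ q * (1 + ‖x‖) ^ (-q))) +
          M * (2 ^ q * (1 + ‖x‖) ^ (-q)) := le_add_of_nonneg_right (by positivity)
      _ = _ := by ring
  · have h3 := key 1 one_pos (by nlinarith [norm_nonneg x])
    rw [Real.one_rpow] at h3
    have h4 : ‖𝓕⁻ (fun ξ : Rn (k + 1) => (symbol δ 1 ξ : ℂ)) x‖ ≤ M := by
      rw [Real.fourierInv_eq]
      refine (norm_integral_le_integral_norm _).trans (le_of_eq ?_)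
      simp [hM]
    calc _ ≤ M * 1 := by rwa [mul_one]
      _ ≤ M * (2 ^ q * (1 + ‖x‖) ^ (-q)) := by gcongr
      _ ≤ |sliceIntegral k δ 1| * (D * (2 ^ q * (1 + ‖x‖) ^ (-q))) +
          M * (2 ^ q * (1 + ‖x‖) ^ (-q)) := le_add_of_nonneg_left (by positivity)
      _ = _ := by ring

theorem symbol_inv_smul (δ : ℝ) {R : ℝ} (hR : 0 < R) (ξ : Rn n) :
    symbol δ 1 (R⁻¹ • ξ) = symbol δ R ξ := by
  simp only [symbol, norm_smul, norm_inv, Real.norm_of_nonneg hR.le]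
  congr 3
  field_simp

theorem fourierInv_symbol_scale (δ : ℝ) {R : ℝ} (hR : 0 < R) (x : Rn n) :
    𝓕⁻ (fun ξ : Rn n => (symbol δ R ξ : ℂ)) x =
      (R : ℂ) ^ n * 𝓕⁻ (fun ξ : Rn n => (symbol δ 1 ξ : ℂ)) (R • x) := by
  rw [Real.fourierInv_eq, Real.fourierInv_eq]
  have h := Measure.integral_comp_inv_smul_of_nonneg (volume : Measure (Rn n))
    (fun v => Real.fourierChar (inner ℝ v (R • x)) • (symbol δ 1 v : ℂ)) hR.le
  rw [finrank_euclideanSpace_fin, Complex.real_smul] at h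
  push_cast at h
  rw [← h]
  refine integral_congr_ae (Eventually.of_forall fun v => ?_)
  have h1 : inner ℝ (R⁻¹ • v) (R • x) = inner ℝ v x := by
    rw [inner_smul_left, inner_smul_right]
    simp [hR.ne']
  simp only [h1, symbol_inv_smul δ hR]

/-- The decay of the Bochner–Riesz kernel. -/
theorem exists_norm_fourierInv_symbol_le (hn : 1 ≤ n) {δ : ℝ} (hδ : 0 < δ) :
    ∃ C : ℝ, 0 ≤ C ∧ ∀ R : ℝ, 0 < R → ∀ x : Rn n,
      ‖𝓕⁻ (fun ξ : Rn n => (symbol δ R ξ : ℂ)) x‖ ≤ C * ker (δ + (n + 1) / 2) R⁻¹ x := by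
  obtain ⟨k, rfl⟩ : ∃ k, n = k + 1 := ⟨n - 1, by omega⟩
  obtain ⟨C, hC, h⟩ := exists_norm_fourierInv_symbol_one_le k hδ
  refine ⟨C, hC, fun R hR x => ?_⟩
  rw [fourierInv_symbol_scale δ hR, norm_mul, norm_pow, Complex.norm_real, Real.norm_of_nonneg hR.le]
  have h1 := h (R • x)
  rw [norm_smul, Real.norm_of_nonneg hR.le] at h1
  calc _ ≤ R ^ (k + 1) * (C * (1 + R * ‖x‖) ^ (-(δ + k / 2 + 1))) := by gcongr
    _ = _ := by
      simp only [ker, br, inv_pow, inv_inv, div_inv_eq_mul]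
      rw [mul_left_comm, mul_comm R ‖x‖]
      congr 4
      push_cast
      ring

section

open Metric

/-! ### A weak type estimate for a potential at the critical exponent -/

/-- Where the bracket is at least `b`, the kernel may be replaced by the one at the coarser scale `b
* s`, with a gain $b^{n-q}$. -/
theorem ker_le_of_le_br {q s b : ℝ} (hq : 0 ≤ q) (hs : 0 < s) (hb : 1 ≤ b) {u : Rn n}
    (hbu : b ≤ br s u) : ker q s u ≤ 2 ^ q * b ^ (n - q) * ker q (b * s) u := by
  have hb0 : 0 < b := by linarith
  have hbs : 0 < b * s := by positivity
  have h1 : b * br (b * s) u ≤ 2 * br s u := by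
    have : b * br (b * s) u = b + ‖u‖ / s := by
      unfold br
      field_simp
    rw [this]
    have : ‖u‖ / s ≤ br s u := by unfold br; linarith
    linarith
  have h2 : (2 * br s u) ^ (-q) ≤ (b * br (b * s) u) ^ (-q) :=
    Real.rpow_le_rpow_of_nonpos (mul_pos hb0 (br_pos hbs u)) h1 (by linarith)
  rw [Real.mul_rpow two_pos.le (br_pos hs u).le, Real.mul_rpow hb0.le (br_pos hbs u).le] at h2
  have h3 : br s u ^ (-q) ≤ 2 ^ q * (b ^ (-q) * br (b * s) u ^ (-q)) := by
    calc br s u ^ (-q) = 2 ^ q * (2 ^ (-q) * br s u ^ (-q)) := by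
          rw [← mul_assoc, ← Real.rpow_add two_pos]
          simp
      _ ≤ _ := by gcongr
  unfold ker
  calc _ ≤ (s ^ n)⁻¹ * (2 ^ q * (b ^ (-q) * br (b * s) u ^ (-q))) := by gcongr
    _ = _ := by
        rw [Real.rpow_sub hb0, Real.rpow_neg hb0.le, Real.rpow_natCast, mul_pow]
        field_simp

/-- The potential `∫ ker q s (x - z) g(z) dz`. -/
def potential (q s : ℝ) (g : Rn n → ℝ≥0∞) (x : Rn n) : ℝ≥0∞ :=
  ∫⁻ z, ENNReal.ofReal (ker q s (x - z)) * g z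

theorem measurable_ker_sub_mul (q : ℝ) {s : ℝ} (hs : 0 < s) {g : Rn n → ℝ≥0∞} (hg : Measurable g) :
    Measurable fun v : Rn n × Rn n => ENNReal.ofReal (ker q s (v.1 - v.2)) * g v.2 :=
  (((continuous_ker q hs).measurable.comp (measurable_fst.sub measurable_snd)).ennreal_ofReal).mul
    (hg.comp measurable_snd)

theorem measurable_potential (q : ℝ) {s : ℝ} (hs : 0 < s) {g : Rn n → ℝ≥0∞} (hg : Measurable g) :
    Measurable (potential q s g) :=
  (measurable_ker_sub_mul q hs hg).lintegral_prod_right'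

/-- By `IsA1Ball.doubling` the averages of `w` over concentric balls of radius at least `s` are
bounded by the average at radius `s`. Hence the bound does not deteriorate at coarse scales `t`. -/
theorem IsA1Ball.lintegral_ker_le {w : Rn n → ℝ} {C : ℝ≥0} (h : IsA1Ball w C) {q : ℝ} (hq : n < q) :
    ∃ D : ℝ≥0, ∀ s t : ℝ, 0 < s → s ≤ t → ∀ z, ∫⁻ x, ENNReal.ofReal (ker q t (x - z)) ∂weightMeasure w
      ≤ D * (ENNReal.ofReal ((s ^ n)⁻¹) * weightMeasure w (closedBall z s)) := by
  obtain ⟨D, hD⟩ := lintegral_ker_measure_le hq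
  have hCt : (C : ℝ≥0∞) / unitVol n ≠ ⊤ := ENNReal.div_ne_top ENNReal.coe_ne_top (unitVol_ne_zero n)
  refine ⟨D * (C / unitVol n : ℝ≥0∞).toNNReal, fun s t hs hst z => ?_⟩
  have h1 := hD t (hs.trans_le hst) (weightMeasure w) z
    (C / unitVol n * (ENNReal.ofReal ((s ^ n)⁻¹) * weightMeasure w (closedBall z s)))
    (fun ρ hρ => by
      have h2 := h.doubling z hs (hst.trans hρ)
      have h3 : ENNReal.ofReal ((s ^ n)⁻¹) * ENNReal.ofReal (s ^ n) = 1 := by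
        rw [← ENNReal.ofReal_mul (by positivity), inv_mul_cancel₀ (by positivity), ENNReal.ofReal_one]
      calc _ = ENNReal.ofReal ((s ^ n)⁻¹) * (ENNReal.ofReal (s ^ n) *
            weightMeasure w (closedBall z ρ)) := by rw [← mul_assoc, h3, one_mul]
        _ ≤ ENNReal.ofReal ((s ^ n)⁻¹) * (C / unitVol n * ENNReal.ofReal (ρ ^ n) *
            weightMeasure w (closedBall z s)) := by gcongr
        _ = _ := by ring)
  have h4 : ∀ x, ker q t (x - z) = ker q t (z - x) := fun x => by rw [← ker_neg, neg_sub]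
  simp_rw [h4]
  refine h1.trans (le_of_eq ?_)
  push_cast
  rw [ENNReal.coe_toNNReal hCt]
  ring

/-- By Tonelli: seen from `x`, only points `z` within distance `s` contribute, and there `G z ≤ N
x`. -/
theorem lintegral_ball_average_le {w : Rn n → ℝ} {s : ℝ} (hs : 0 < s) {G N : Rn n → ℝ≥0∞}
    (hG : Measurable G) (h : ∀ z u, ‖u - z‖ ≤ s → G z ≤ N u) :
    ∫⁻ z, G z * (ENNReal.ofReal ((s ^ n)⁻¹) * weightMeasure w (closedBall z s)) ≤
      unitVol n * ∫⁻ x, N x ∂weightMeasure w := by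
  have hms : MeasurableSet {v : Rn n × Rn n | ‖v.2 - v.1‖ ≤ s} :=
    measurableSet_le (measurable_snd.sub measurable_fst).norm measurable_const
  set k : Rn n × Rn n → ℝ≥0∞ := {v : Rn n × Rn n | ‖v.2 - v.1‖ ≤ s}.indicator 1 with hk
  have hkm : Measurable k := measurable_one.indicator hms
  have h1 : ∀ z, weightMeasure w (closedBall z s) = ∫⁻ x, k (z, x) ∂weightMeasure w := by
    intro z
    rw [← lintegral_indicator_one measurableSet_closedBall]
    refine lintegral_congr fun x => ?_
    simp [hk, Set.indicator, dist_eq_norm]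
  have h3 : ENNReal.ofReal ((s ^ n)⁻¹) * ENNReal.ofReal (s ^ n) = 1 := by
    rw [← ENNReal.ofReal_mul (by positivity), inv_mul_cancel₀ (by positivity), ENNReal.ofReal_one]
  have h2 : ∀ z, G z * (ENNReal.ofReal ((s ^ n)⁻¹) * weightMeasure w (closedBall z s)) =
      ∫⁻ x, G z * (ENNReal.ofReal ((s ^ n)⁻¹) * k (z, x)) ∂weightMeasure w := by
    intro z
    have hm : Measurable fun x => k (z, x) := hkm.comp measurable_prodMk_left
    rw [h1, ← lintegral_const_mul _ hm, ← lintegral_const_mul _ (hm.const_mul _)]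
  simp_rw [h2]
  rw [lintegral_lintegral_swap, ← lintegral_const_mul' _ _ (unitVol_ne_top n)]
  · refine lintegral_mono fun x => ?_
    calc ∫⁻ z, G z * (ENNReal.ofReal ((s ^ n)⁻¹) * k (z, x)) ≤
          ∫⁻ z, (closedBall x s).indicator (fun _ => N x * ENNReal.ofReal ((s ^ n)⁻¹)) z := by
          refine lintegral_mono fun z => ?_
          by_cases hz : ‖x - z‖ ≤ s
          · have hz' : z ∈ closedBall x s := by rwa [mem_closedBall, dist_comm, dist_eq_norm]
            simp only [hk]
            rw [Set.indicator_of_mem hz', Set.indicator_of_mem (by exact hz), Pi.one_apply, mul_one]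
            gcongr
            exact h z x hz
          · simp only [hk]
            rw [Set.indicator_of_notMem (a := (z, x)) (by exact hz)]
            simp
      _ = _ := by
          rw [lintegral_indicator_const measurableSet_closedBall, volume_closedBall_eq x hs.le]
          calc _ = (ENNReal.ofReal ((s ^ n)⁻¹) * ENNReal.ofReal (s ^ n)) * (unitVol n * N x) := by
                ring
            _ = _ := by rw [h3, one_mul]
  · exact ((hG.comp measurable_fst).mul (hkm.const_mul _)).aemeasurable

/-- The heart of the weak type bound. A function majorized by `N` at scale `s` cannot be large near
a point where the maximal function of $N^p$ is small, so its large values act on such points only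
through the tail of the kernel. At the exponent $n/p$ the tail gain is exactly what turns $g$ into
$g^p\lambda^{1-p}$. -/
theorem IsA1Ball.weak_potential {w : Rn n → ℝ} {C : ℝ≥0} (hw : IsWeight w) (h : IsA1Ball w C)
    (hn : 1 ≤ n) {p : ℝ} (hp : 0 < p) (hp1 : p < 1) :
    ∃ D : ℝ≥0, ∀ (s : ℝ), 0 < s → ∀ g N : Rn n → ℝ≥0∞, Measurable g → Measurable N →
      (∀ z u, ‖u - z‖ ≤ s → g z ≤ N u) → ∀ l : ℝ, 0 < l →
        ENNReal.ofReal l ^ p * weightMeasure w {x | ENNReal.ofReal l < potential (n / p) s g x} ≤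
          D * ∫⁻ x, N x ^ p ∂weightMeasure w := by
  have hn0 : (0 : ℝ) < n := by exact_mod_cast hn
  set q : ℝ := n / p with hq
  have hqn : (n : ℝ) < q := by
    rw [hq, lt_div_iff₀ hp]
    exact mul_lt_of_lt_one_right hn0 hp1
  have hq0 : 0 < q := hn0.trans hqn
  have hqp : q * p = n := div_mul_cancel₀ _ hp.ne'
  obtain ⟨D₁, hD₁⟩ := h.lintegral_ker_le hqn
  set V := unitVol n with hV
  have hV0 : V ≠ 0 := unitVol_ne_zero n
  have hVt : V ≠ ⊤ := unitVol_ne_top n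
  set K : ℝ≥0∞ := V⁻¹ * (C * 5 ^ n) + ENNReal.ofReal (2 ^ q) * D₁ * V with hK
  have hVi : V⁻¹ ≠ ⊤ := ENNReal.inv_ne_top.2 hV0
  have hKt : K ≠ ⊤ := by finiteness
  refine ⟨K.toNNReal, fun s hs g N hg hN hgN l hl => ?_⟩
  rw [ENNReal.coe_toNNReal hKt]
  set Λ : ℝ≥0∞ := ENNReal.ofReal l with hl'
  have hl0 : Λ ≠ 0 := by simpa [hl'] using hl
  have hlt : Λ ≠ ⊤ := ENNReal.ofReal_ne_top
  have hlp0 : Λ ^ p ≠ 0 := by simp [ENNReal.rpow_eq_zero_iff, hl0, hlt]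
  have hlpt : Λ ^ p ≠ ⊤ := ENNReal.rpow_ne_top_of_nonneg hp.le hlt
  set I := ∫⁻ x, N x ^ p ∂weightMeasure w with hI
  -- The factor `V` cancels the $V^{-1}$ of `le_hlMax_of_le_on_ball`, so the bound outside `E` has
  -- constant one.
  set E : Set (Rn n) := {x | V * Λ ^ p < hlMax (fun u => N u ^ p) x} with hE
  have hEm : MeasurableSet E := (isOpen_lt_hlMax _ _).measurableSet
  have hNp : Measurable fun u => N u ^ p := hN.pow_const p
  have hEw : Λ ^ p * weightMeasure w E ≤ V⁻¹ * (C * 5 ^ n) * I := by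
    have h1 := h.weak_hlMax hw hNp (V * Λ ^ p)
    calc _ = V⁻¹ * (V * Λ ^ p * weightMeasure w E) := by
          rw [← mul_assoc, ← mul_assoc, ENNReal.inv_mul_cancel hV0 hVt, one_mul]
      _ ≤ V⁻¹ * ((C * 5 ^ n) * I) := by gcongr
      _ = _ := by ring
  have hout : ∀ x, x ∉ E → ∀ z, g z ≤ Λ * ebr s (x - z) ^ q := by
    intro x hx z
    have h1 := le_hlMax_of_le_on_ball (G := g z ^ p) (N := fun u => N u ^ p) (v := z) hs
      (fun u hu => by
        rw [mem_closedBall, dist_eq_norm] at hu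
        exact ENNReal.rpow_le_rpow (hgN z u hu) hp.le) x
    have h2 : hlMax (fun u => N u ^ p) x ≤ V * Λ ^ p := not_lt.1 hx
    rw [← ENNReal.rpow_le_rpow_iff hp, ENNReal.mul_rpow_of_nonneg _ _ hp.le, ← ENNReal.rpow_mul, hqp]
    calc g z ^ p ≤ V⁻¹ * ebr s (x - z) ^ (n : ℝ) * (V * Λ ^ p) := h1.trans (by gcongr)
      _ = (V⁻¹ * V) * (Λ ^ p * ebr s (x - z) ^ (n : ℝ)) := by ring
      _ = _ := by rw [ENNReal.inv_mul_cancel hV0 hVt, one_mul]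
  have hslice : ∀ z, g z * ∫⁻ x in Eᶜ, ENNReal.ofReal (ker q s (x - z)) ∂weightMeasure w ≤
      ENNReal.ofReal (2 ^ q) * D₁ * Λ ^ (1 - p) *
        (g z ^ p * (ENNReal.ofReal ((s ^ n)⁻¹) * weightMeasure w (closedBall z s))) := by
    intro z
    -- A single point outside `E` already makes `g z` finite, so that real powers can be used.
    rcases Set.eq_empty_or_nonempty Eᶜ with he | ⟨x₀, hx₀⟩
    · rw [he]
      simp
    have hgt : g z ≠ ⊤ := ne_top_of_le_ne_top
      (ENNReal.mul_ne_top hlt (ebr_rpow_ne_top hs _ _)) (hout x₀ hx₀ z)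
    rcases eq_or_ne (g z) 0 with hg0 | hg0
    · rw [hg0, zero_mul]
      exact zero_le
    obtain ⟨γ, hγ, hγ0⟩ : ∃ γ : ℝ, g z = ENNReal.ofReal γ ∧ 0 < γ :=
      ⟨(g z).toReal, (ENNReal.ofReal_toReal hgt).symm, ENNReal.toReal_pos hg0 hgt⟩
    -- By `hout`, points outside `E` see `z` only with bracket at least `b`.
    set b : ℝ := max 1 ((γ / l) ^ (1 / q)) with hb
    have hb1 : 1 ≤ b := le_max_left _ _
    have hb0 : 0 < b := by linarith
    have hbr : ∀ x ∈ Eᶜ, b ≤ br s (x - z) := by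
      intro x hx
      refine max_le (one_le_br hs _) ?_
      have h1 := hout x hx z
      rw [hγ, hl', ebr, ENNReal.ofReal_rpow_of_pos (br_pos hs _), ← ENNReal.ofReal_mul hl.le,
        ENNReal.ofReal_le_ofReal_iff (mul_nonneg hl.le (Real.rpow_nonneg (br_pos hs _).le _))] at h1
      have h2 : γ / l ≤ br s (x - z) ^ q := by
        rw [div_le_iff₀ hl]
        linarith
      calc (γ / l) ^ (1 / q) ≤ (br s (x - z) ^ q) ^ (1 / q) := by gcongr
        _ = br s (x - z) := by
            rw [← Real.rpow_mul (br_pos hs _).le, mul_one_div_cancel hq0.ne', Real.rpow_one]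
    -- The exponent works because $(n-q)/q = p-1$ for $q = n/p$.
    have hγb : γ * b ^ (n - q) ≤ γ ^ p * l ^ (1 - p) := by
      have h1 : b ^ (n - q) ≤ ((γ / l) ^ (1 / q)) ^ (n - q) :=
        Real.rpow_le_rpow_of_nonpos (by positivity) (le_max_right _ _) (by linarith)
      have h2 : ((γ / l) ^ (1 / q)) ^ (n - q) = (γ / l) ^ (p - 1) := by
        rw [← Real.rpow_mul (by positivity)]
        congr 1
        rw [← hqp]
        field_simp
      rw [h2, Real.div_rpow hγ0.le hl.le] at h1
      calc γ * b ^ (n - q) ≤ γ * (γ ^ (p - 1) / l ^ (p - 1)) := by gcongr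
        _ = (γ ^ (1 : ℝ) * γ ^ (p - 1)) * (l ^ (p - 1))⁻¹ := by rw [Real.rpow_one]; ring
        _ = _ := by
            rw [← Real.rpow_add hγ0, ← Real.rpow_neg hl.le, add_sub_cancel, neg_sub]
    calc _ ≤ g z * ∫⁻ x in Eᶜ, ENNReal.ofReal (2 ^ q * b ^ (n - q)) *
          ENNReal.ofReal (ker q (b * s) (x - z)) ∂weightMeasure w := by
          refine mul_le_mul' le_rfl (setLIntegral_mono' hEm.compl fun x hx => ?_)
          rw [← ENNReal.ofReal_mul (by positivity)]
          exact ENNReal.ofReal_le_ofReal (ker_le_of_le_br hq0.le hs hb1 (hbr x hx))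
      _ ≤ g z * (ENNReal.ofReal (2 ^ q * b ^ (n - q)) *
          (D₁ * (ENNReal.ofReal ((s ^ n)⁻¹) * weightMeasure w (closedBall z s)))) := by
          rw [lintegral_const_mul' _ _ ENNReal.ofReal_ne_top]
          gcongr
          exact (setLIntegral_le_lintegral _ _).trans
            (hD₁ s (b * s) hs (le_mul_of_one_le_left hs.le hb1) z)
      _ = ENNReal.ofReal (γ * b ^ (n - q)) * (ENNReal.ofReal (2 ^ q) *
          (D₁ * (ENNReal.ofReal ((s ^ n)⁻¹) * weightMeasure w (closedBall z s)))) := by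
          rw [hγ, ENNReal.ofReal_mul (by positivity), ENNReal.ofReal_mul hγ0.le]
          ring
      _ ≤ ENNReal.ofReal (γ ^ p * l ^ (1 - p)) * (ENNReal.ofReal (2 ^ q) *
          (D₁ * (ENNReal.ofReal ((s ^ n)⁻¹) * weightMeasure w (closedBall z s)))) := by
          gcongr
      _ = _ := by
          rw [ENNReal.ofReal_mul (by positivity), hγ, hl', ENNReal.ofReal_rpow_of_pos hγ0,
            ENNReal.ofReal_rpow_of_pos hl]
          ring
  have hmain : ∫⁻ x in Eᶜ, potential q s g x ∂weightMeasure w ≤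
      ENNReal.ofReal (2 ^ q) * D₁ * Λ ^ (1 - p) * (V * I) := by
    unfold potential
    rw [lintegral_lintegral_swap (measurable_ker_sub_mul q hs hg).aemeasurable]
    calc _ = ∫⁻ z, g z * ∫⁻ x in Eᶜ, ENNReal.ofReal (ker q s (x - z)) ∂weightMeasure w := by
          refine lintegral_congr fun z => ?_
          have hm : Measurable fun x : Rn n => ENNReal.ofReal (ker q s (x - z)) :=
            ((continuous_ker q hs).measurable.comp
              (measurable_id.sub measurable_const)).ennreal_ofReal
          rw [lintegral_mul_const _ hm, mul_comm]
      _ ≤ ∫⁻ z, ENNReal.ofReal (2 ^ q) * D₁ * Λ ^ (1 - p) *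
          (g z ^ p * (ENNReal.ofReal ((s ^ n)⁻¹) * weightMeasure w (closedBall z s))) :=
          lintegral_mono hslice
      _ ≤ _ := by
          rw [lintegral_const_mul']
          · gcongr
            exact lintegral_ball_average_le hs (hg.pow_const p)
              fun z u hu => ENNReal.rpow_le_rpow (hgN z u hu) hp.le
          · have : Λ ^ (1 - p) ≠ ⊤ := ENNReal.rpow_ne_top_of_nonneg (by linarith) hlt
            finiteness
  have hcheb : Λ ^ p * weightMeasure w ({x | Λ < potential q s g x} ∩ Eᶜ) ≤
      ENNReal.ofReal (2 ^ q) * D₁ * V * I := by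
    have hme := measurable_potential q hs hg
    have h1 : Λ * weightMeasure w ({x | Λ < potential q s g x} ∩ Eᶜ) ≤
        ∫⁻ x in Eᶜ, potential q s g x ∂weightMeasure w := by
      refine le_trans ?_ (mul_meas_ge_le_lintegral hme Λ)
      rw [Measure.restrict_apply (measurableSet_le measurable_const hme)]
      gcongr
      exact le_of_lt
    have h2 : Λ ^ p = Λ ^ (p - 1) * Λ := by
      conv_rhs => rw [← ENNReal.rpow_one Λ, ← ENNReal.rpow_mul, ← ENNReal.rpow_add _ _ hl0 hlt]
      congr 1
      ring
    have h3 : Λ ^ (p - 1) * Λ ^ (1 - p) = 1 := by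
      rw [← ENNReal.rpow_add _ _ hl0 hlt]
      simp
    rw [h2, mul_assoc]
    calc _ ≤ Λ ^ (p - 1) * (ENNReal.ofReal (2 ^ q) * D₁ * Λ ^ (1 - p) * (V * I)) :=
          mul_le_mul' le_rfl (h1.trans hmain)
      _ = (Λ ^ (p - 1) * Λ ^ (1 - p)) * (ENNReal.ofReal (2 ^ q) * D₁ * V * I) := by ring
      _ = _ := by rw [h3, one_mul]
  calc _ ≤ Λ ^ p * (weightMeasure w E +
        weightMeasure w ({x | Λ < potential q s g x} ∩ Eᶜ)) := by
        gcongr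
        refine (measure_mono fun x hx => ?_).trans (measure_union_le _ _)
        by_cases hxE : x ∈ E
        · exact Or.inl hxE
        · exact Or.inr ⟨hx, hxE⟩
    _ ≤ V⁻¹ * (C * 5 ^ n) * I + ENNReal.ofReal (2 ^ q) * D₁ * V * I := by
        rw [mul_add]
        exact add_le_add hEw hcheb
    _ = _ := by rw [hK]; ring

end

section

open LineDeriv

/-! ### A maximal function that controls all convolutions -/

/-- A single maximal function controls the convolutions with all admissible test functions. -/
theorem exists_maximalFunction {w : Rn n → ℝ} (hw : IsA1 w) {φ : 𝓢(Rn n, ℂ)} (hφ : ∫ x, φ x = 1)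
    (hn : 1 ≤ n) {p : ℝ} (hp : 0 < p) (hp1 : p < 1) {L : ℕ} (hL : n / p < L + n) :
    ∃ C : ℝ≥0, ∀ f : 𝓢'(Rn n, ℂ), ∃ N : Rn n → ℝ≥0∞, Measurable N ∧
      ∫⁻ x, N x ^ p ∂weightMeasure w ≤ C * ∫⁻ x, radialMax φ f x ^ p ∂weightMeasure w ∧
      ∀ (ψ : 𝓢(Rn n, ℂ)) (M : ℝ), 0 < M → (∀ x, ‖ψ x‖ ≤ M * ker (L + n) 1 x) →
        (∀ (i : Fin L → Fin n) x,
          ‖(∂^{fun j => EuclideanSpace.single (i j) (1 : ℝ)} ψ) x‖ ≤ M * ker (L + n) 1 x) →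
        ∀ t, 0 < t → ∀ x y, ‖y - x‖ ≤ t → ‖cv (dil ψ t) f y‖ₑ ≤ C * ENNReal.ofReal M * N x := by
  have hn0 : (0 : ℝ) < n := by exact_mod_cast hn
  have hLn : (0 : ℝ) < L + n := by positivity
  -- The upper bound makes the maximal operator bounded on $L^{p/r}(w)$; the lower bound is $n/r <
  -- L+n$, the requirement of `exists_enorm_cv_le_hlMax`.
  obtain ⟨r, hr1, hr2⟩ : ∃ r : ℝ, n / (L + n : ℝ) < r ∧ r < p := by
    refine exists_between ?_
    rw [div_lt_iff₀ hLn]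
    rw [div_lt_iff₀ hp] at hL
    linarith
  have hr0 : 0 < r := lt_trans (by positivity) hr1
  have hrL : n / r < L + n := by
    rw [div_lt_iff₀ hLn] at hr1
    rw [div_lt_iff₀ hr0]
    linarith
  have hpr : 1 < p / r := by rwa [one_lt_div hr0]
  -- Any exponent with $Ar > n$ would do.
  set A : ℝ := (n + 1) / r with hA
  have hAr : n < A * r := by
    rw [hA, div_mul_cancel₀ _ hr0.ne']
    linarith
  obtain ⟨C₀, h0⟩ := hw.exists_isA1Ball
  obtain ⟨C₁, h1⟩ := peetreMax_rpow_le hφ hr0 (hr2.trans hp1) hAr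
  obtain ⟨C₂, h2⟩ := exists_enorm_cv_le_hlMax hφ (A := A) (by positivity) hr0 (hr2.trans hp1) hrL
  obtain ⟨D, h3⟩ := h0.strong_hlMax hw.1 hpr
  have hexp : ∀ a : ℝ≥0∞, (a ^ r) ^ (p / r) = a ^ p := fun a => by
    rw [← ENNReal.rpow_mul, mul_div_cancel₀ _ hr0.ne']
  refine ⟨D * (C₁ ^ (p / r) * D) + C₂, fun f =>
    ⟨fun x => hlMax (fun y => peetreMax φ A f y ^ r) x ^ (1 / r), ?_, ?_, ?_⟩⟩
  · exact (measurable_hlMax _).pow_const _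
  · have e1 : ∀ x, (hlMax (fun y => peetreMax φ A f y ^ r) x ^ (1 / r)) ^ p =
        hlMax (fun y => peetreMax φ A f y ^ r) x ^ (p / r) := fun x => by
      rw [← ENNReal.rpow_mul]
      congr 1
      ring
    simp_rw [e1]
    have e2 := h3 _ ((measurable_peetreMax φ A f).pow_const r)
    have e3 := h3 _ ((measurable_radialMax φ f).pow_const r)
    simp_rw [hexp] at e2 e3
    have e4 : ∫⁻ x, peetreMax φ A f x ^ p ∂weightMeasure w ≤
        C₁ ^ (p / r) * ∫⁻ x, hlMax (fun y => radialMax φ f y ^ r) x ^ (p / r) ∂weightMeasure w := by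
      rw [← lintegral_const_mul' _ _ (ENNReal.rpow_ne_top_of_nonneg (by positivity) (by simp))]
      refine lintegral_mono fun x => ?_
      rw [← ENNReal.mul_rpow_of_nonneg _ _ (by positivity), ← hexp]
      exact ENNReal.rpow_le_rpow (h1 f x) (by positivity)
    calc _ ≤ D * (C₁ ^ (p / r) * (D * ∫⁻ x, radialMax φ f x ^ p ∂weightMeasure w)) :=
          e2.trans (mul_le_mul' le_rfl (e4.trans (mul_le_mul' le_rfl e3)))
      _ = (D * (C₁ ^ (p / r) * D)) * ∫⁻ x, radialMax φ f x ^ p ∂weightMeasure w := by ring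
      _ ≤ _ := by
          gcongr
          push_cast
          rw [ENNReal.coe_rpow_of_nonneg _ (by positivity)]
          exact le_self_add
  · intro ψ M hM hψ0 hψ t ht x y hxy
    refine (h2 ψ M hM hψ0 hψ f t ht x y hxy).trans ?_
    gcongr
    exact le_add_self

/-! ### Finiteness and growth of the potential. -/

/-- If `H` were infinite everywhere, every level set would be the whole space, and letting the level
tend to infinity would force `w` to vanish. -/
theorem exists_potential_lt_top {w : Rn n → ℝ} (hw : IsA1 w) (hw0 : ¬ w =ᵐ[volume] 0) {H : Rn n → ℝ≥0∞}
    {p : ℝ} (hp : 0 < p) {K : ℝ≥0∞} (hK : K ≠ ⊤)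
    (h : ∀ l : ℝ, 0 < l → ENNReal.ofReal l ^ p * weightMeasure w {x | ENNReal.ofReal l < H x} ≤ K) :
    ∃ x, H x < ⊤ := by
  by_contra! hcon
  have h1 : ∀ l : ℝ, {x | ENNReal.ofReal l < H x} = Set.univ := by
    intro l
    ext x
    simp [top_le_iff.1 (hcon x)]
  have h2 : weightMeasure w Set.univ = 0 := by
    by_contra h0
    have h3 : ∀ l : ℝ, 0 < l → ENNReal.ofReal l ^ p * weightMeasure w Set.univ ≤ K := fun l hl => by
      simpa [h1] using h l hl
    have h4 : (⊤ : ℝ≥0∞) ≤ K := by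
      have ht : Tendsto (fun l : ℝ => ENNReal.ofReal l ^ p * weightMeasure w Set.univ) atTop
          (𝓝 ⊤) := by
        have ht1 : Tendsto (fun l : ℝ => ENNReal.ofReal l ^ p) atTop (𝓝 ⊤) :=
          (ENNReal.tendsto_rpow_at_top hp).comp ENNReal.tendsto_ofReal_atTop
        have := ENNReal.Tendsto.mul_const (b := weightMeasure w Set.univ) ht1 (Or.inl ENNReal.top_ne_zero)
        rwa [ENNReal.top_mul h0] at this
      exact le_of_tendsto ht ((eventually_gt_atTop 0).mono h3)
    exact hK (top_le_iff.1 h4)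
  rw [weightMeasure_apply w MeasurableSet.univ, Measure.restrict_univ,
    lintegral_eq_zero_iff' (aemeasurable_weight hw.1)] at h2
  refine hw0 (h2.mono fun x hx => ?_)
  simp only [Pi.zero_apply, ENNReal.ofReal_eq_zero] at hx ⊢
  exact le_antisymm hx (hw.1.1 x)

/-- Moving the centre of the kernel from `x` to `x₀` costs `br s (x₀ - x) ^ q`, so finiteness at one
point gives polynomial growth everywhere. -/
theorem exists_potential_le {q s : ℝ} (hq : 0 ≤ q) (hs : 0 < s) {g : Rn n → ℝ≥0∞} {x₀ : Rn n}
    (h : potential q s g x₀ < ⊤) :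
    ∃ (k : ℕ) (c : ℝ), 0 ≤ c ∧ ∀ x, potential q s g x ≤ ENNReal.ofReal (c * (1 + ‖x‖) ^ k) := by
  obtain ⟨k, hk⟩ := exists_nat_ge q
  set P := (potential q s g x₀).toReal with hP
  refine ⟨k, P * (br s x₀ * (1 + s⁻¹)) ^ q, ?_, fun x => ?_⟩
  · have := br_pos hs x₀
    positivity
  have hb0 := br_pos hs x₀
  have h1 : ∀ z, ENNReal.ofReal (ker q s (x - z)) ≤
      ENNReal.ofReal (br s (x₀ - x) ^ q) * ENNReal.ofReal (ker q s (x₀ - z)) := by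
    intro z
    rw [← ENNReal.ofReal_mul (Real.rpow_nonneg (br_pos hs _).le _)]
    refine ENNReal.ofReal_le_ofReal ?_
    have h2 := br_rpow_neg_sub_le hs hq x₀ x z
    have hbx := br_pos hs (x₀ - x)
    unfold ker
    calc _ = (s ^ n)⁻¹ * (br s (x₀ - x) ^ q * (br s (x₀ - x) ^ (-q) * br s (x - z) ^ (-q))) := by
          rw [← mul_assoc (br s (x₀ - x) ^ q), ← Real.rpow_add hbx]
          simp
      _ ≤ (s ^ n)⁻¹ * (br s (x₀ - x) ^ q * br s (x₀ - z) ^ (-q)) := by gcongr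
      _ = _ := by ring
  have h3 : br s (x₀ - x) ≤ br s x₀ * (1 + s⁻¹) * (1 + ‖x‖) := by
    have e1 := br_add_le hs x₀ (-x)
    rw [br_neg, ← sub_eq_add_neg] at e1
    have e2 : br s x ≤ (1 + s⁻¹) * (1 + ‖x‖) := by
      have : 0 < s⁻¹ := by positivity
      unfold br
      rw [div_eq_mul_inv]
      nlinarith [norm_nonneg x]
    calc _ ≤ br s x₀ * br s x := e1
      _ ≤ br s x₀ * ((1 + s⁻¹) * (1 + ‖x‖)) := by gcongr
      _ = _ := by ring
  calc potential q s g x ≤ ∫⁻ z, ENNReal.ofReal (br s (x₀ - x) ^ q) *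
        (ENNReal.ofReal (ker q s (x₀ - z)) * g z) := by
        refine lintegral_mono fun z => ?_
        rw [← mul_assoc]
        gcongr
        exact h1 z
    _ = ENNReal.ofReal (br s (x₀ - x) ^ q) * ENNReal.ofReal P := by
        rw [lintegral_const_mul' _ _ ENNReal.ofReal_ne_top, hP, ENNReal.ofReal_toReal h.ne]
        rfl
    _ ≤ _ := by
        rw [← ENNReal.ofReal_mul (Real.rpow_nonneg (br_pos hs _).le _)]
        refine ENNReal.ofReal_le_ofReal ?_
        have hP0 : 0 ≤ P := ENNReal.toReal_nonneg
        have hbx := br_pos hs (x₀ - x)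
        have hx1 : 1 ≤ 1 + ‖x‖ := by linarith [norm_nonneg x]
        calc _ ≤ (br s x₀ * (1 + s⁻¹) * (1 + ‖x‖)) ^ q * P := by gcongr
          _ = P * (br s x₀ * (1 + s⁻¹)) ^ q * (1 + ‖x‖) ^ q := by
              rw [Real.mul_rpow (by positivity) (by positivity)]
              ring
          _ ≤ _ := by
              gcongr
              rw [← Real.rpow_natCast]
              exact Real.rpow_le_rpow_of_exponent_le hx1 hk

/-! ### Functions of polynomial growth as tempered distributions -/

theorem exists_norm_mul_le (k : ℕ) : ∃ (S : Finset (ℕ × ℕ)) (C : ℝ), 0 ≤ C ∧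
    ∀ (u : 𝓢(Rn n, ℂ)) x, ‖u x‖ * (1 + ‖x‖) ^ k ≤
      C * (S.sup (schwartzSeminormFamily ℂ (Rn n) ℂ)) u * (1 + ‖x‖) ^ (-((n : ℝ) + 1)) := by
  refine ⟨Finset.Iic (k + (n + 1), 0), 2 ^ (k + (n + 1)), by positivity, fun u x => ?_⟩
  have h := SchwartzMap.one_add_le_sup_seminorm_apply (𝕜 := ℂ) (m := (k + (n + 1), 0))
    (k := k + (n + 1)) (n := 0) le_rfl le_rfl u x
  rw [norm_iteratedFDeriv_zero] at h
  have hp : 0 < 1 + ‖x‖ := by positivity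
  have h1 : (1 + ‖x‖) ^ (-((n : ℝ) + 1)) = ((1 + ‖x‖) ^ (n + 1))⁻¹ := by
    rw [Real.rpow_neg hp.le, ← Real.rpow_natCast]
    push_cast
    rfl
  rw [h1, ← div_eq_mul_inv, le_div_iff₀ (by positivity)]
  refine le_trans (le_of_eq ?_) h
  rw [pow_add]
  ring

theorem integrable_mul_of_growth (u : 𝓢(Rn n, ℂ)) {H : Rn n → ℂ} (hH : AEStronglyMeasurable H volume)
    {c : ℝ} {k : ℕ} (hb : ∀ x, ‖H x‖ ≤ c * (1 + ‖x‖) ^ k) :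
    Integrable (fun x => u x * H x) volume := by
  obtain ⟨S, C, hC, h⟩ := exists_norm_mul_le (n := n) k
  have hc : 0 ≤ c := by simpa using (norm_nonneg _).trans (hb 0)
  refine Integrable.mono' (g := fun x => c * (C * (S.sup (schwartzSeminormFamily ℂ (Rn n) ℂ)) u) *
    (1 + ‖x‖) ^ (-((n : ℝ) + 1))) ?_ (u.continuous.aestronglyMeasurable.mul hH)
    (Eventually.of_forall fun x => ?_)
  · exact (integrable_one_add_norm (by simp)).const_mul _
  · rw [norm_mul]
    calc _ ≤ ‖u x‖ * (c * (1 + ‖x‖) ^ k) := by gcongr; exact hb x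
      _ = c * (‖u x‖ * (1 + ‖x‖) ^ k) := by ring
      _ ≤ c * (C * (S.sup (schwartzSeminormFamily ℂ (Rn n) ℂ)) u *
          (1 + ‖x‖) ^ (-((n : ℝ) + 1))) := mul_le_mul_of_nonneg_left (h u x) hc
      _ = _ := by ring

theorem exists_distribution {H : Rn n → ℂ} (hH : AEStronglyMeasurable H volume)
    {c : ℝ} {k : ℕ} (hb : ∀ x, ‖H x‖ ≤ c * (1 + ‖x‖) ^ k) :
    ∃ g : 𝓢'(Rn n, ℂ), ∀ u, g u = ∫ x, u x * H x := by
  obtain ⟨S, C, hC, h⟩ := exists_norm_mul_le (n := n) k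
  have hc : 0 ≤ c := by simpa using (norm_nonneg _).trans (hb 0)
  set I := ∫ x : Rn n, (1 + ‖x‖) ^ (-((n : ℝ) + 1)) with hI
  have hI0 : 0 ≤ I := integral_nonneg fun x => by positivity
  let g₀ : 𝓢(Rn n, ℂ) →L[ℂ] ℂ := SchwartzMap.mkCLMtoNormedSpace (fun u => ∫ x, u x * H x)
    (fun u v => by
      rw [← integral_add (integrable_mul_of_growth u hH hb) (integrable_mul_of_growth v hH hb)]
      simp [add_mul])
    (fun a u => by
      rw [RingHom.id_apply, smul_eq_mul, ← integral_const_mul]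
      simp [mul_assoc])
    ⟨S, c * C * I, by positivity, fun u => by
      refine (norm_integral_le_of_norm_le (g := fun x => c * C *
        (S.sup (schwartzSeminormFamily ℂ (Rn n) ℂ)) u * (1 + ‖x‖) ^ (-((n : ℝ) + 1))) ?_
        (Eventually.of_forall fun x => ?_)).trans ?_
      · exact (integrable_one_add_norm (by simp)).const_mul _
      · rw [norm_mul]
        calc _ ≤ ‖u x‖ * (c * (1 + ‖x‖) ^ k) := by gcongr; exact hb x
          _ = c * (‖u x‖ * (1 + ‖x‖) ^ k) := by ring
          _ ≤ c * (C * (S.sup (schwartzSeminormFamily ℂ (Rn n) ℂ)) u *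
              (1 + ‖x‖) ^ (-((n : ℝ) + 1))) := mul_le_mul_of_nonneg_left (h u x) hc
          _ = _ := by ring
      · rw [integral_const_mul, ← hI]
        exact le_of_eq (by ring)⟩
  exact ⟨ContinuousLinearMap.toPointwiseConvergenceCLM _ _ _ _ g₀, fun u => rfl⟩

end

/-! ### Convolution with a kernel of critical decay -/

/-- The convolution `∫ K(x - z) G(z) dz`. -/
def kerConv (K G : Rn n → ℂ) (x : Rn n) : ℂ := ∫ z, K (x - z) * G z

theorem lintegral_enorm_ker_mul_le {K G : Rn n → ℂ} {C q s : ℝ} (hC : 0 ≤ C)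
    (hK : ∀ v, ‖K v‖ ≤ C * ker q s v) (x : Rn n) :
    ∫⁻ z, ‖K (x - z) * G z‖ₑ ≤ ENNReal.ofReal C * potential q s (fun z => ‖G z‖ₑ) x := by
  rw [potential, ← lintegral_const_mul' _ _ ENNReal.ofReal_ne_top]
  refine lintegral_mono fun z => ?_
  rw [enorm_mul, ← mul_assoc, ← ENNReal.ofReal_mul hC, ← ofReal_norm]
  exact mul_le_mul' (ENNReal.ofReal_le_ofReal (hK _)) le_rfl

theorem enorm_kerConv_le {K G : Rn n → ℂ} {C q s : ℝ} (hC : 0 ≤ C)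
    (hK : ∀ v, ‖K v‖ ≤ C * ker q s v) (x : Rn n) :
    ‖kerConv K G x‖ₑ ≤ ENNReal.ofReal C * potential q s (fun z => ‖G z‖ₑ) x :=
  (enorm_integral_le_lintegral_enorm _).trans (lintegral_enorm_ker_mul_le hC hK x)

theorem stronglyMeasurable_kerConv {K G : Rn n → ℂ} (hK : Continuous K) (hG : Continuous G) :
    StronglyMeasurable (kerConv K G) :=
  StronglyMeasurable.integral_prod_right' (f := fun v : Rn n × Rn n => K (v.1 - v.2) * G v.2)
    (Continuous.stronglyMeasurable (by fun_prop))

theorem norm_kerConv_le {K G : Rn n → ℂ} {C q s c : ℝ} {k : ℕ} (hC : 0 ≤ C) (hc : 0 ≤ c)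
    (hKb : ∀ v, ‖K v‖ ≤ C * ker q s v)
    (hP : ∀ x, potential q s (fun z => ‖G z‖ₑ) x ≤ ENNReal.ofReal (c * (1 + ‖x‖) ^ k)) (x : Rn n) :
    ‖kerConv K G x‖ ≤ C * c * (1 + ‖x‖) ^ k := by
  have h := (enorm_kerConv_le hC hKb x).trans (mul_le_mul' le_rfl (hP x))
  rw [← ENNReal.ofReal_mul hC, ← ofReal_norm, ENNReal.ofReal_le_ofReal_iff (by positivity)] at h
  linarith

theorem integrable_mul_ker_mul (u : 𝓢(Rn n, ℂ)) {K G : Rn n → ℂ} (hK : Continuous K)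
    (hG : Continuous G) {C q s c : ℝ} {k : ℕ} (hC : 0 ≤ C) (hKb : ∀ v, ‖K v‖ ≤ C * ker q s v)
    (hP : ∀ x, potential q s (fun z => ‖G z‖ₑ) x ≤ ENNReal.ofReal (c * (1 + ‖x‖) ^ k)) :
    Integrable (fun v : Rn n × Rn n => u v.1 * (K (v.1 - v.2) * G v.2)) (volume.prod volume) := by
  have hu := u.continuous
  refine ⟨Continuous.aestronglyMeasurable (by fun_prop), ?_⟩
  have hm : Measurable fun v : Rn n × Rn n => ‖u v.1 * (K (v.1 - v.2) * G v.2)‖ₑ :=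
    (Continuous.measurable (by fun_prop)).enorm
  rw [HasFiniteIntegral, lintegral_prod _ hm.aemeasurable]
  have hi : Integrable (fun x => u x * ((C * (max c 0 * (1 + ‖x‖) ^ k) : ℝ) : ℂ)) volume := by
    refine integrable_mul_of_growth u (Continuous.aestronglyMeasurable (by fun_prop))
      (c := C * max c 0) (k := k) fun x => ?_
    rw [Complex.norm_real, Real.norm_of_nonneg (by positivity)]
    exact le_of_eq (by ring)
  refine lt_of_le_of_lt (lintegral_mono fun x => ?_) hi.2
  simp_rw [enorm_mul (u x)]
  rw [lintegral_const_mul' _ _ enorm_ne_top]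
  refine mul_le_mul' le_rfl ((lintegral_enorm_ker_mul_le hC hKb x).trans ?_)
  rw [← ofReal_norm, Complex.norm_real, Real.norm_of_nonneg (by positivity), ENNReal.ofReal_mul hC]
  refine mul_le_mul' le_rfl ((hP x).trans (ENNReal.ofReal_le_ofReal ?_))
  gcongr
  exact le_max_left _ _

/-- Fubini's theorem for `∫ u (K * G)`. -/
theorem integral_mul_kerConv (u : 𝓢(Rn n, ℂ)) {K G : Rn n → ℂ}
    (h : Integrable (fun v : Rn n × Rn n => u v.1 * (K (v.1 - v.2) * G v.2)) (volume.prod volume)) :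
    Integrable (fun z => (∫ x, u x * K (x - z)) * G z) volume ∧
      ∫ x, u x * kerConv K G x = ∫ z, (∫ x, u x * K (x - z)) * G z := by
  have e : ∀ z, ∫ x, u x * (K (x - z) * G z) = (∫ x, u x * K (x - z)) * G z := fun z => by
    rw [← integral_mul_const]
    simp only [mul_assoc]
  constructor
  · have := h.integral_prod_right
    simpa only [e] using this
  · simp_rw [kerConv, ← integral_const_mul, ← e]
    exact integral_integral_swap h

theorem integral_mul_kerConv_eq_prod (u : 𝓢(Rn n, ℂ)) {K G : Rn n → ℂ}
    (h : Integrable (fun v : Rn n × Rn n => u v.1 * (K (v.1 - v.2) * G v.2)) (volume.prod volume)) :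
    ∫ x, u x * kerConv K G x =
      ∫ v : Rn n × Rn n, u v.1 * (K (v.1 - v.2) * G v.2) ∂volume.prod volume := by
  rw [integral_prod _ h]
  simp_rw [kerConv, ← integral_const_mul]

theorem fourierIntegral_neg_innerₗ (v : Rn n → ℂ) :
    VectorFourier.fourierIntegral Real.fourierChar volume (-innerₗ (Rn n)) v = 𝓕⁻ v := by
  ext x
  simp [VectorFourier.fourierIntegral, Real.fourierInv_eq]

theorem integral_fourierInv_mul {m : Rn n → ℂ} (hm : Integrable m volume) (u : 𝓢(Rn n, ℂ)) :
    ∫ x, u x * 𝓕⁻ m x = ∫ ξ, m ξ * 𝓕⁻ u ξ := by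
  have h4 := VectorFourier.integral_fourierIntegral_smul_eq_flip (L := -innerₗ (Rn n))
    (e := Real.fourierChar) Real.continuous_fourierChar
    ((continuous_inner (𝕜 := ℝ) (E := Rn n)).fun_neg) hm (u.integrable (μ := volume))
  have h6 : (-innerₗ (Rn n)).flip = -innerₗ (Rn n) := by
    ext x y
    simp [real_inner_comm]
  rw [h6, fourierIntegral_neg_innerₗ, fourierIntegral_neg_innerₗ, ← SchwartzMap.fourierInv_coe] at h4
  simp only [smul_eq_mul] at h4
  simp_rw [mul_comm (u _)]
  exact h4

theorem fourierInv_tr (a : 𝓢(Rn n, ℂ)) (x ξ : Rn n) :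
    𝓕⁻ (tr a x) ξ = (Real.fourierChar (inner ℝ x ξ) : ℂ) * 𝓕 a ξ := by
  rw [SchwartzMap.fourierInv_coe, SchwartzMap.fourier_coe, Real.fourierInv_eq, Real.fourier_eq,
    ← integral_const_mul, ← integral_sub_left_eq_self _ volume x]
  refine integral_congr_ae (Eventually.of_forall fun v => ?_)
  simp only [tr_apply, Circle.smul_def, smul_eq_mul, sub_sub_cancel, inner_sub_left]
  rw [sub_eq_add_neg, AddChar.map_add_eq_mul, Circle.coe_mul]
  ring

theorem integral_fourierInv_tr (a : 𝓢(Rn n, ℂ)) (x : Rn n) : ∫ ξ, 𝓕⁻ (tr a x) ξ = a x := by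
  rw [← fourier_zero, FourierTransform.fourier_fourierInv_eq, tr_apply, sub_zero]

theorem continuous_fourierInv {m : Rn n → ℂ} (hm : Integrable m volume) :
    Continuous (𝓕⁻ m : Rn n → ℂ) := by
  rw [← fourierIntegral_neg_innerₗ]
  exact VectorFourier.fourierIntegral_continuous Real.continuous_fourierChar
    ((continuous_inner (𝕜 := ℝ) (E := Rn n)).fun_neg) hm

/-- Convolution with the kernel `𝓕⁻ m` splits along `m = k̂ + d̂ m`. -/
theorem integral_tr_mul_fourierInv {m : Rn n → ℂ} (hm : Integrable m volume) {k d : 𝓢(Rn n, ℂ)}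
    (h : ∀ ξ, m ξ = 𝓕 k ξ + 𝓕 d ξ * m ξ) (a : 𝓢(Rn n, ℂ)) (y z : Rn n) :
    ∫ x, tr a y x * 𝓕⁻ m (x - z) =
      cnv a k (y - z) + ∫ x, tr (cnv a d) y x * 𝓕⁻ m (x - z) := by
  have e : ∀ b : 𝓢(Rn n, ℂ), ∫ x, tr b y x * 𝓕⁻ m (x - z) =
      ∫ ξ, m ξ * 𝓕⁻ (tr b (y - z)) ξ := fun b => by
    rw [← integral_fourierInv_mul hm, ← integral_sub_right_eq_self
      (fun x => tr b (y - z) x * 𝓕⁻ m x) z]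
    refine integral_congr_ae (Eventually.of_forall fun v => ?_)
    simp only [tr_apply]
    congr 2
    abel
  have hi : ∀ b : 𝓢(Rn n, ℂ), Integrable (fun ξ => m ξ * b ξ) volume := fun b =>
    hm.mul_bdd (c := SchwartzMap.seminorm ℝ 0 0 b) b.continuous.aestronglyMeasurable
      (Eventually.of_forall fun x => SchwartzMap.norm_le_seminorm ℝ b x)
  rw [e, e, ← integral_fourierInv_tr (cnv a k),
    ← integral_add ((𝓕⁻ (tr (cnv a k) (y - z)) : 𝓢(Rn n, ℂ)).integrable) (hi _)]
  refine integral_congr_ae (Eventually.of_forall fun ξ => ?_)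
  simp only [fourierInv_tr, fourier_cnv]
  nth_rewrite 1 [h ξ]
  ring

/-- By Fubini the splitting of the kernel passes to $K * (\eta * f)$. The smooth part collapses to
$a * k * f$, because $k * \eta = k$. -/
theorem integral_tr_mul_kerConv {m : Rn n → ℂ} (hm : Integrable m volume) {k d η : 𝓢(Rn n, ℂ)}
    (h : ∀ ξ, m ξ = 𝓕 k ξ + 𝓕 d ξ * m ξ) (hk : cnv k η = k) (f : 𝓢'(Rn n, ℂ))
    (hint : ∀ u : 𝓢(Rn n, ℂ), Integrable
      (fun v : Rn n × Rn n => u v.1 * (𝓕⁻ m (v.1 - v.2) * cv η f v.2)) (volume.prod volume))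
    (a : 𝓢(Rn n, ℂ)) (y : Rn n) :
    ∫ x, tr a y x * kerConv (𝓕⁻ m) (cv η f) x =
      cv (cnv a k) f y + ∫ x, tr (cnv a d) y x * kerConv (𝓕⁻ m) (cv η f) x := by
  obtain ⟨hia, ea⟩ := integral_mul_kerConv _ (hint (tr a y))
  obtain ⟨hib, eb⟩ := integral_mul_kerConv _ (hint (tr (cnv a d) y))
  have e1 : cv (cnv a k) f y = ∫ z, cnv a k (y - z) * cv η f z := by
    rw [← cv_cnv, cnv_assoc, hk]
  have e2 : ∀ z, cnv a k (y - z) * cv η f z = (∫ x, tr a y x * 𝓕⁻ m (x - z)) * cv η f z -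
      (∫ x, tr (cnv a d) y x * 𝓕⁻ m (x - z)) * cv η f z := fun z => by
    rw [integral_tr_mul_fourierInv hm h]
    ring
  rw [ea, eb, e1]
  simp_rw [e2]
  rw [integral_sub hia hib]
  ring

/-! ### Existence of the Bochner–Riesz operator -/

theorem symbol_eq_zero {δ : ℝ} (hδ : 0 < δ) {R : ℝ} (hR : 0 < R) {ξ : Rn n} (h : R ≤ ‖ξ‖) :
    symbol δ R ξ = 0 := by
  have : 1 ≤ ‖ξ‖ ^ 2 / R ^ 2 := by
    rw [one_le_div (by positivity)]
    gcongr
  rw [symbol, max_eq_right (by linarith), Real.zero_rpow hδ.ne']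

theorem contDiffAt_symbol (δ : ℝ) {ξ : Rn n} (h : ‖ξ‖ < 1) :
    ContDiffAt ℝ ∞ (fun ξ : Rn n => (symbol δ 1 ξ : ℂ)) ξ := by
  have hpos : ∀ v : Rn n, ‖v‖ < 1 → 0 < 1 - ‖v‖ ^ 2 := fun v hv => by
    nlinarith [norm_nonneg v]
  have h1 : ContDiffAt ℝ ∞ (fun v : Rn n => (1 - ‖v‖ ^ 2) ^ δ) ξ :=
    ContDiffAt.rpow_const_of_ne (contDiff_const.sub (contDiff_norm_sq ℝ)).contDiffAt (hpos ξ h).ne'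
  have h2 : ContDiffAt ℝ ∞ (fun v : Rn n => (((1 - ‖v‖ ^ 2) ^ δ : ℝ) : ℂ)) ξ :=
    Complex.ofRealCLM.contDiff.contDiffAt.comp ξ h1
  refine h2.congr_of_eventuallyEq ?_
  filter_upwards [(isOpen_lt continuous_norm continuous_const).mem_nhds h] with v hv
  rw [symbol, one_pow, div_one, max_eq_left (hpos v hv).le]

/-- The symbol splits into a smooth part, and a part that is supported away from the origin. -/
theorem exists_symbol_splitting (n : ℕ) {δ : ℝ} (hδ : 0 < δ) : ∃ η κ d : 𝓢(Rn n, ℂ), IsAnnular d ∧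
    (∀ ξ, ‖ξ‖ ≤ 2 → 𝓕 η ξ = 1) ∧ cnv κ η = κ ∧
    ∀ ξ, (symbol δ 1 ξ : ℂ) = 𝓕 κ ξ + 𝓕 d ξ * (symbol δ 1 ξ : ℂ) := by
  -- The cutoff `b` gives $\hat\eta$, equal to 1 on a ball large enough for the mollified symbols
  -- too. The cutoff `χ` stays away from the singular sphere, so $\hat\kappa = \chi m$ is smooth,
  -- while $\hat d = b(1-\chi)$ vanishes near 0.
  let b : ContDiffBump (0 : Rn n) := ⟨2, 3, by norm_num, by norm_num⟩
  let χ : ContDiffBump (0 : Rn n) := ⟨1 / 4, 1 / 2, by norm_num, by norm_num⟩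
  have hbs : ContDiff ℝ ∞ fun ξ => ((b ξ : ℝ) : ℂ) := Complex.ofRealCLM.contDiff.comp b.contDiff
  have hχs : ContDiff ℝ ∞ fun ξ => ((χ ξ : ℝ) : ℂ) := Complex.ofRealCLM.contDiff.comp χ.contDiff
  have hbc : HasCompactSupport fun ξ => ((b ξ : ℝ) : ℂ) :=
    b.hasCompactSupport.comp_left (g := Complex.ofReal) Complex.ofReal_zero
  have hχc : HasCompactSupport fun ξ => ((χ ξ : ℝ) : ℂ) :=
    χ.hasCompactSupport.comp_left (g := Complex.ofReal) Complex.ofReal_zero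
  have hb1 : ∀ ξ, ‖ξ‖ ≤ 2 → b ξ = 1 := fun ξ h =>
    b.one_of_mem_closedBall (by rwa [mem_closedBall_zero_iff])
  have hχ1 : ∀ ξ, ‖ξ‖ ≤ 1 / 4 → χ ξ = 1 := fun ξ h =>
    χ.one_of_mem_closedBall (by rwa [mem_closedBall_zero_iff])
  have hχ0 : ∀ ξ, 1 / 2 ≤ ‖ξ‖ → χ ξ = 0 := fun ξ h =>
    χ.zero_of_le_dist (by rwa [dist_zero_right])
  obtain ⟨η, hη⟩ := exists_fourier_eq hbc hbs
  obtain ⟨κ, hκ⟩ := exists_fourier_eq (χ := fun ξ => ((χ ξ : ℝ) : ℂ) * (symbol δ 1 ξ : ℂ))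
    hχc.mul_right (by
      refine contDiff_iff_contDiffAt.2 fun ξ => ?_
      by_cases h : ‖ξ‖ < 1
      · exact hχs.contDiffAt.mul (contDiffAt_symbol δ h)
      · refine (contDiffAt_const (c := (0 : ℂ))).congr_of_eventuallyEq ?_
        filter_upwards [(isOpen_lt continuous_const continuous_norm).mem_nhds
          (show 1 / 2 < ‖ξ‖ by linarith [not_lt.1 h])] with v hv
        rw [hχ0 v (le_of_lt hv), Complex.ofReal_zero, zero_mul])
  obtain ⟨d, hd⟩ := exists_fourier_eq (χ := fun ξ => ((b ξ : ℝ) : ℂ) * (1 - ((χ ξ : ℝ) : ℂ)))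
    hbc.mul_right (hbs.mul (contDiff_const.sub hχs))
  refine ⟨η, κ, d, ⟨?_, 1 / 4, by norm_num, fun ξ hξ => ?_⟩, fun ξ hξ => ?_, ?_, fun ξ => ?_⟩
  · have : ⇑(𝓕 d : 𝓢(Rn n, ℂ)) = fun ξ => ((b ξ : ℝ) : ℂ) * (1 - ((χ ξ : ℝ) : ℂ)) := funext hd
    rw [this]
    exact hbc.mul_right
  · rw [hd, hχ1 ξ hξ.le]
    simp
  · rw [hη, hb1 ξ hξ, Complex.ofReal_one]
  · refine ext_fourier fun ξ => ?_
    rw [fourier_cnv, hκ, hη]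
    by_cases h : ‖ξ‖ ≤ 2
    · rw [hb1 ξ h, Complex.ofReal_one, mul_one]
    · rw [hχ0 ξ (by linarith)]
      simp
  · rw [hκ, hd]
    by_cases h : ‖ξ‖ ≤ 2
    · rw [hb1 ξ h]
      push_cast
      ring
    · rw [symbol_eq_zero hδ one_pos (by linarith)]
      simp

/-- The convolution theorem: mollifying the symbol truncates the kernel smoothly at distance of
order $1/\varepsilon$. -/
theorem fourierInv_mollSymbol {δ : ℝ} (hδ : 0 < δ) {R : ℝ} (hR : 0 < R) {ρ : Rn n → ℂ}
    (hρ : IsMollifier ρ) {ε : ℝ} (hε : 0 < ε) (x : Rn n) :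
    𝓕⁻ (mollSymbol δ R ρ ε) x = 𝓕⁻ (fun ξ => (symbol δ R ξ : ℂ)) x * 𝓕⁻ ρ (ε • x) := by
  have hρs : ContDiff ℝ ∞ (fun ξ : Rn n => ((ε : ℂ) ^ n)⁻¹ * ρ (ε⁻¹ • ξ)) :=
    contDiff_const.mul (hρ.1.comp (contDiff_const_smul _))
  have hi : Integrable (fun ξ : Rn n => ((ε : ℂ) ^ n)⁻¹ * ρ (ε⁻¹ • ξ)) volume :=
    hρs.continuous.integrable_of_hasCompactSupport (hasCompactSupport_dil hρ.2.1 hε)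
  have h1 : mollSymbol δ R ρ ε = (fun ξ => (symbol δ R ξ : ℂ)) ⋆[ContinuousLinearMap.mul ℂ ℂ, volume]
      (fun ξ => ((ε : ℂ) ^ n)⁻¹ * ρ (ε⁻¹ • ξ)) := rfl
  rw [Real.fourierInv_eq_fourier_neg, h1, Real.fourier_mul_convolution_eq (integrable_symbol hδ hR) hi,
    ← Real.fourierInv_eq_fourier_neg, ← Real.fourierInv_eq_fourier_neg]
  congr 1
  rw [Real.fourierInv_eq, Real.fourierInv_eq]
  have h := Measure.integral_comp_inv_smul_of_nonneg (volume : Measure (Rn n))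
    (fun v => Real.fourierChar (inner ℝ v (ε • x)) • ρ v) hε.le
  rw [finrank_euclideanSpace_fin, Complex.real_smul] at h
  have h2 : ∀ v : Rn n, Real.fourierChar (inner ℝ v x) • (((ε : ℂ) ^ n)⁻¹ * ρ (ε⁻¹ • v)) =
      ((ε : ℂ) ^ n)⁻¹ * (Real.fourierChar (inner ℝ (ε⁻¹ • v) (ε • x)) • ρ (ε⁻¹ • v)) := fun v => by
    have : inner ℝ (ε⁻¹ • v) (ε • x) = inner ℝ v x := by
      rw [inner_smul_left, inner_smul_right]
      simp [hε.ne']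
    rw [this]
    simp only [Circle.smul_def, smul_eq_mul]
    ring
  simp_rw [h2]
  rw [integral_const_mul, h]
  have : (ε : ℂ) ≠ 0 := by exact_mod_cast hε.ne'
  push_cast
  field_simp

theorem mollSymbol_eq_zero {δ : ℝ} (hδ : 0 < δ) {R : ℝ} (hR : 0 < R) {ρ : Rn n → ℂ} {r : ℝ}
    (hr : ∀ z, r < ‖z‖ → ρ z = 0) {ε : ℝ} (hε : 0 < ε) {ξ : Rn n} (h : R + ε * r ≤ ‖ξ‖) :
    mollSymbol δ R ρ ε ξ = 0 := by
  rw [mollSymbol_eq δ R ρ hε]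
  refine integral_eq_zero_of_ae (Eventually.of_forall fun z => ?_)
  simp only [Pi.zero_apply]
  by_cases hz : r < ‖z‖
  · rw [hr z hz, mul_zero]
  · rw [symbol_eq_zero hδ hR, Complex.ofReal_zero, zero_mul]
    have h1 := norm_sub_norm_le ξ (ε • z)
    rw [norm_smul, Real.norm_of_nonneg hε.le] at h1
    have h2 : ε * ‖z‖ ≤ ε * r := by gcongr; exact not_lt.1 hz
    linarith

/-- The regularized multiplier is the convolution with a Schwartz kernel. -/
theorem fourierMultiplier_apply_eq {m : Rn n → ℂ} (hm : m.HasTemperateGrowth) {k : 𝓢(Rn n, ℂ)}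
    (hk : ∀ ξ, 𝓕 k ξ = m ξ) (f : 𝓢'(Rn n, ℂ)) (u : 𝓢(Rn n, ℂ)) :
    TemperedDistribution.fourierMultiplierCLM ℂ m f u = ∫ x, u x * cv k f x := by
  rw [TemperedDistribution.fourierMultiplierCLM_apply_apply, ← apply_cnv_reflect]
  congr 1
  have hr : ∀ (a : 𝓢(Rn n, ℂ)) ξ, 𝓕 a ξ = 𝓕⁻ a (-ξ) := fun a ξ => by
    rw [SchwartzMap.fourier_coe, SchwartzMap.fourierInv_coe, Real.fourierInv_eq_fourier_neg, neg_neg]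
  have hrk : ∀ ξ, 𝓕 (reflect k) ξ = 𝓕 k (-ξ) := fun ξ => by
    rw [SchwartzMap.fourier_coe, SchwartzMap.fourier_coe, Real.fourier_eq, Real.fourier_eq,
      ← integral_neg_eq_self]
    simp [reflect_apply]
  refine ext_fourier fun ξ => ?_
  rw [fourier_cnv, hr, FourierTransform.fourierInv_fourier_eq,
    SchwartzMap.smulLeftCLM_apply_apply hm, hrk, hk, hr u, smul_eq_mul]

/-- The regularized kernels are $K\cdot\check\rho(\varepsilon\,\cdot)$ and reproduce under
convolution with $\eta_{1/R}$, so the regularized operators act on $G = \eta_{1/R} * f$ instead of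
`f`. Since $\check\rho$ is bounded with $\check\rho(0) = 1$, dominated convergence in the double
integral gives a limit independent of `ρ`. -/
theorem exists_isBochnerRiesz {δ : ℝ} (hδ : 0 < δ) {R : ℝ} (hR : 0 < R) {η : 𝓢(Rn n, ℂ)}
    (hη : ∀ ξ, ‖ξ‖ ≤ 2 → 𝓕 η ξ = 1) (f : 𝓢'(Rn n, ℂ)) {C q s c : ℝ} {k : ℕ} (hC : 0 ≤ C)
    (hc : 0 ≤ c) (hK : ∀ v : Rn n, ‖𝓕⁻ (fun ξ => (symbol δ R ξ : ℂ)) v‖ ≤ C * ker q s v)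
    (hP : ∀ x, potential q s (fun z => ‖cv (dil η R⁻¹) f z‖ₑ) x ≤
      ENNReal.ofReal (c * (1 + ‖x‖) ^ k)) :
    ∃ g : 𝓢'(Rn n, ℂ), IsBochnerRiesz δ R f g ∧ ∀ u : 𝓢(Rn n, ℂ),
      g u = ∫ x, u x * kerConv (𝓕⁻ (fun ξ => (symbol δ R ξ : ℂ))) (cv (dil η R⁻¹) f) x := by
  have hRi : 0 < R⁻¹ := inv_pos.2 hR
  set K : Rn n → ℂ := 𝓕⁻ (fun ξ => (symbol δ R ξ : ℂ)) with hKdef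
  set G := cv (dil η R⁻¹) f with hGdef
  have hKc : Continuous K := continuous_fourierInv (integrable_symbol hδ hR)
  have hGc : Continuous G := continuous_cv _ _
  obtain ⟨g, hg⟩ := exists_distribution (stronglyMeasurable_kerConv hKc hGc).aestronglyMeasurable
    (norm_kerConv_le hC hc hK hP)
  refine ⟨g, fun ρ hρ u => ?_, hg⟩
  have hρi : Integrable ρ volume := hρ.1.continuous.integrable_of_hasCompactSupport hρ.2.1
  have hint := integrable_mul_ker_mul u hKc hGc hC hK hP
  have hρc : Continuous (𝓕⁻ ρ : Rn n → ℂ) := continuous_fourierInv hρi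
  have hρ0 : 𝓕⁻ ρ (0 : Rn n) = 1 := by
    rw [Real.fourierInv_eq]
    simpa using hρ.2.2
  have hρb : ∀ v : Rn n, ‖𝓕⁻ ρ v‖ ≤ ∫ z, ‖ρ z‖ := fun v => by
    rw [Real.fourierInv_eq]
    refine (norm_integral_le_integral_norm _).trans (le_of_eq ?_)
    simp
  have hlim : Tendsto (fun ε : ℝ => ∫ v : Rn n × Rn n,
      u v.1 * (K (v.1 - v.2) * 𝓕⁻ ρ (ε • (v.1 - v.2)) * G v.2) ∂volume.prod volume)
      (𝓝[>] 0) (𝓝 (∫ v : Rn n × Rn n, u v.1 * (K (v.1 - v.2) * G v.2) ∂volume.prod volume)) := by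
    refine tendsto_integral_filter_of_dominated_convergence
      (fun v => (∫ z, ‖ρ z‖) * ‖u v.1 * (K (v.1 - v.2) * G v.2)‖) ?_ ?_ (hint.norm.const_mul _) ?_
    · have hu := u.continuous
      exact Eventually.of_forall fun ε => Continuous.aestronglyMeasurable (by fun_prop)
    · refine Eventually.of_forall fun ε => Eventually.of_forall fun v => ?_
      have := hρb (ε • (v.1 - v.2))
      calc _ = ‖𝓕⁻ ρ (ε • (v.1 - v.2))‖ * ‖u v.1 * (K (v.1 - v.2) * G v.2)‖ := by
            simp only [norm_mul]
            ring
        _ ≤ _ := by gcongr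
    · refine Eventually.of_forall fun v => ?_
      have h1 : Continuous fun ε : ℝ =>
          u v.1 * (K (v.1 - v.2) * 𝓕⁻ ρ (ε • (v.1 - v.2)) * G v.2) := by fun_prop
      have := (h1.tendsto 0).mono_left (nhdsWithin_le_nhds (s := Set.Ioi 0))
      simpa [hρ0] using this
  rw [hg, integral_mul_kerConv_eq_prod u hint]
  obtain ⟨r, hr0, hr⟩ : ∃ r : ℝ, 0 < r ∧ ∀ z : Rn n, r < ‖z‖ → ρ z = 0 := by
    obtain ⟨r, hr0, hr⟩ := hρ.2.1.isBounded.exists_pos_norm_le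
    refine ⟨r, hr0, fun z hz => ?_⟩
    by_contra h
    exact absurd (hr z (subset_tsupport _ h)) (not_le.2 hz)
  refine hlim.congr' ?_
  -- For these `ε` the mollified symbol is supported in $|\xi| \le 2R$, where the transform of
  -- $\eta_{1/R}$ is 1.
  filter_upwards [Ioo_mem_nhdsGT (show 0 < R / r by positivity)] with ε hε
  have hε0 : 0 < ε := hε.1
  have hεr : ε * r ≤ R := by
    have := hε.2
    rw [lt_div_iff₀ hr0] at this
    exact this.le
  have htg := hasTemperateGrowth_mollSymbol hδ hR hρ hε0
  have hmc : HasCompactSupport (mollSymbol δ R ρ ε) :=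
    HasCompactSupport.convolution _ (hasCompactSupport_symbol hδ hR) (hasCompactSupport_dil hρ.2.1 hε0)
  obtain ⟨a, ha⟩ := exists_fourier_eq hmc htg.1
  have haK : ∀ x, a x = K x * 𝓕⁻ ρ (ε • x) := fun x => by
    have h1 : ⇑(𝓕 a : 𝓢(Rn n, ℂ)) = mollSymbol δ R ρ ε := funext ha
    rw [hKdef, ← fourierInv_mollSymbol hδ hR hρ hε0, ← h1, ← SchwartzMap.fourierInv_coe,
      FourierTransform.fourierInv_fourier_eq]
  have haη : cnv a (dil η R⁻¹) = a := by
    refine ext_fourier fun ξ => ?_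
    rw [fourier_cnv, ha, fourier_dil _ hRi]
    by_cases h : ‖ξ‖ ≤ 2 * R
    · rw [hη, mul_one]
      rw [norm_smul, norm_inv, Real.norm_of_nonneg hR.le, inv_mul_le_iff₀ hR]
      linarith
    · rw [mollSymbol_eq_zero hδ hR hr hε0 (by linarith), zero_mul]
  rw [fourierMultiplier_apply_eq htg ha]
  have hab : ∀ v, ‖a v‖ ≤ (∫ z, ‖ρ z‖) * C * ker q s v := fun v => by
    rw [haK, norm_mul]
    calc _ ≤ C * ker q s v * ∫ z, ‖ρ z‖ :=
          mul_le_mul (hK v) (hρb _) (norm_nonneg _) ((norm_nonneg _).trans (hK v))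
      _ = _ := by ring
  have hρn : 0 ≤ ∫ z, ‖ρ z‖ := integral_nonneg fun z => norm_nonneg _
  have h2 := integral_mul_kerConv_eq_prod u
    (integrable_mul_ker_mul u a.continuous hGc (mul_nonneg hρn hC) hab hP)
  have h3 : ∀ x, cv a f x = kerConv a G x := fun x => by
    rw [kerConv, hGdef, ← cv_cnv, haη]
  simp_rw [h3]
  rw [h2]
  simp_rw [haK]

section

open LineDeriv

/-! ### The grand maximal function of the Bochner–Riesz means -/

/-- With $L = N+1$ the decay exponent $N+n+1$ is $L+n$, so the class provides just the decay and the
order of smoothness used above. -/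
theorem norm_le_ker_of_mem_grandClass {N : ℕ} {ψ : 𝓢(Rn n, ℂ)} (h : ψ ∈ grandClass n N) {k : ℕ}
    (hk : k ≤ N + 1) (i : Fin k → Fin n) (x : Rn n) :
    ‖(∂^{fun j => EuclideanSpace.single (i j) (1 : ℝ)} ψ) x‖ ≤
      1 * ker ((N + 1 : ℕ) + n) 1 x := by
  have h1 := h k hk i x
  have hx : 0 < 1 + ‖x‖ := by positivity
  have h2 : ker ((N + 1 : ℕ) + n) 1 x = ((1 + ‖x‖) ^ (N + n + 1))⁻¹ := by
    rw [ker, br, div_one, one_pow, inv_one, one_mul, Real.rpow_neg hx.le, ← Real.rpow_natCast]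
    push_cast
    ring_nf
  rw [SchwartzMap.iteratedLineDerivOp_eq_iteratedFDeriv, h2, one_mul, ← one_div,
    le_div_iff₀ (by positivity)]
  linarith

/-- Averages of a potential are controlled by the potential. -/
theorem exists_enorm_integral_tr_mul_le {q L : ℝ} (hq : n < q) (hL : 0 < L) (hqL : q ≤ L + n) :
    ∃ D : ℝ≥0, ∀ (s t A C : ℝ), 0 < s → 0 < t → 0 ≤ A → 0 ≤ C → ∀ (g : Rn n → ℝ≥0∞) (H : Rn n → ℂ)
      (a : 𝓢(Rn n, ℂ)), Measurable g → (∀ u, ‖H u‖ₑ ≤ ENNReal.ofReal C * potential q s g u) →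
      (∀ v, ‖a v‖ ≤ A * min 1 ((s / t) ^ L) * ker (L + n) t v) → ∀ x y, ‖y - x‖ ≤ t →
        ‖∫ u, tr a y u * H u‖ₑ ≤ D * ENNReal.ofReal (A * C) * potential q s g x := by
  obtain ⟨D, hD⟩ := lintegral_ker_mul_ker_le hq hL hqL
  have hn0 : (0 : ℝ) ≤ n := n.cast_nonneg
  refine ⟨D * (2 ^ (L + n) : ℝ).toNNReal, fun s t A C hs ht hA hC g H a hg hH ha x y hxy => ?_⟩
  set μ : ℝ := min 1 ((s / t) ^ L) with hμ
  have hμ0 : 0 ≤ μ := le_min zero_le_one (by positivity)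
  have h2 : (0 : ℝ) ≤ 2 ^ (L + n) := by positivity
  have hm1 : Measurable fun v : Rn n × Rn n =>
      ENNReal.ofReal (ker (L + n) t (x - v.1)) * (ENNReal.ofReal (ker q s (v.1 - v.2)) * g v.2) :=
    (((continuous_ker _ ht).measurable.comp
      (measurable_const.sub measurable_fst)).ennreal_ofReal).mul (measurable_ker_sub_mul q hs hg)
  have hm2 : ∀ z, Measurable fun u : Rn n =>
      ENNReal.ofReal (ker (L + n) t (x - u)) * ENNReal.ofReal (ker q s (u - z)) := fun z =>
    (((continuous_ker _ ht).measurable.comp (measurable_const.sub measurable_id)).ennreal_ofReal).mul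
      (((continuous_ker _ hs).measurable.comp (measurable_id.sub measurable_const)).ennreal_ofReal)
  set c : ℝ≥0∞ := ENNReal.ofReal (A * C * 2 ^ (L + n)) with hc
  calc ‖∫ u, tr a y u * H u‖ₑ ≤ ∫⁻ u, ‖tr a y u * H u‖ₑ := enorm_integral_le_lintegral_enorm _
    _ ≤ ∫⁻ u, (c * ENNReal.ofReal μ) *
          (ENNReal.ofReal (ker (L + n) t (x - u)) * potential q s g u) := by
        refine lintegral_mono fun u => ?_
        have e1 : ‖tr a y u‖ ≤ A * μ * (2 ^ (L + n) * ker (L + n) t (x - u)) := by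
          rw [tr_apply]
          exact (ha _).trans (mul_le_mul_of_nonneg_left (ker_shift_le (by linarith) ht hxy u)
            (by positivity))
        rw [enorm_mul, ← ofReal_norm (tr a y u)]
        refine (mul_le_mul' (ENNReal.ofReal_le_ofReal e1) (hH u)).trans (le_of_eq ?_)
        rw [← mul_assoc, ← mul_assoc (c * _), hc, ← ENNReal.ofReal_mul' hC, ← ENNReal.ofReal_mul' hμ0,
          ← ENNReal.ofReal_mul' (ker_nonneg _ ht _)]
        congr 2
        ring
    _ = (c * ENNReal.ofReal μ) * ∫⁻ u, ∫⁻ z, ENNReal.ofReal (ker (L + n) t (x - u)) *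
          (ENNReal.ofReal (ker q s (u - z)) * g z) := by
        rw [lintegral_const_mul' _ _ (ENNReal.mul_ne_top ENNReal.ofReal_ne_top ENNReal.ofReal_ne_top)]
        congr 1
        refine lintegral_congr fun u => ?_
        rw [potential, lintegral_const_mul' _ _ ENNReal.ofReal_ne_top]
    _ = (c * ENNReal.ofReal μ) * ∫⁻ z, (∫⁻ u, ENNReal.ofReal (ker (L + n) t (x - u)) *
          ENNReal.ofReal (ker q s (u - z))) * g z := by
        rw [lintegral_lintegral_swap hm1.aemeasurable]
        congr 1
        refine lintegral_congr fun z => ?_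
        rw [← lintegral_mul_const _ (hm2 z)]
        simp only [mul_assoc]
    _ = c * ∫⁻ z, (ENNReal.ofReal μ * ∫⁻ u, ENNReal.ofReal (ker (L + n) t (x - u)) *
          ENNReal.ofReal (ker q s (u - z))) * g z := by
        rw [mul_assoc, ← lintegral_const_mul' _ _ ENNReal.ofReal_ne_top]
        simp only [mul_assoc]
    _ ≤ c * ∫⁻ z, D * (ENNReal.ofReal (ker q s (x - z)) * g z) := by
        refine mul_le_mul' le_rfl (lintegral_mono fun z => ?_)
        rw [← mul_assoc]
        exact mul_le_mul' (hD s t hs ht x z) le_rfl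
    _ = _ := by
        rw [lintegral_const_mul' _ _ ENNReal.coe_ne_top, hc, ENNReal.ofReal_mul' h2, potential]
        push_cast
        rw [show ((2 ^ (L + n) : ℝ).toNNReal : ℝ≥0∞) = ENNReal.ofReal (2 ^ (L + n)) from rfl]
        ring

/-- Averages of $T^\delta_R f$ at scale $t \le 1/R$ are bounded by the potential directly. At
coarser scales the low frequencies are handed back to `f` through the smooth kernel `κ`, and the
remaining annular part has cancellation against `ψ`. -/
theorem exists_enorm_cv_dil_le_potential (hn : 1 ≤ n) {δ q : ℝ} (hδ : 0 < δ)
    (hqδ : q = δ + (n + 1) / 2) (hq : n < q) {L : ℕ} (hL : 0 < L) (hqL : q ≤ L + n)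
    {η κ d : 𝓢(Rn n, ℂ)} (hd : IsAnnular d) (hκ : cnv κ η = κ)
    (hm : ∀ ξ, (symbol δ 1 ξ : ℂ) = 𝓕 κ ξ + 𝓕 d ξ * (symbol δ 1 ξ : ℂ)) :
    ∃ A : ℝ≥0, ∀ (f g : 𝓢'(Rn n, ℂ)) (R : ℝ), 0 < R → ∀ (C : ℝ≥0) (N : Rn n → ℝ≥0∞),
      (∀ (ψ : 𝓢(Rn n, ℂ)) (M : ℝ), 0 < M → (∀ x, ‖ψ x‖ ≤ M * ker (L + n) 1 x) →
        (∀ (i : Fin L → Fin n) x,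
          ‖(∂^{fun j => EuclideanSpace.single (i j) (1 : ℝ)} ψ) x‖ ≤ M * ker (L + n) 1 x) →
        ∀ t, 0 < t → ∀ x y, ‖y - x‖ ≤ t → ‖cv (dil ψ t) f y‖ₑ ≤ C * ENNReal.ofReal M * N x) →
      (∀ u : 𝓢(Rn n, ℂ), Integrable (fun v : Rn n × Rn n => u v.1 *
        (𝓕⁻ (fun ξ => (symbol δ R ξ : ℂ)) (v.1 - v.2) * cv (dil η R⁻¹) f v.2)) (volume.prod volume)) →
      (∀ u : 𝓢(Rn n, ℂ), g u =
        ∫ x, u x * kerConv (𝓕⁻ (fun ξ => (symbol δ R ξ : ℂ))) (cv (dil η R⁻¹) f) x) →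
      ∀ ψ : 𝓢(Rn n, ℂ), (∀ x, ‖ψ x‖ ≤ 1 * ker (L + n) 1 x) →
        (∀ (i : Fin L → Fin n) x,
          ‖(∂^{fun j => EuclideanSpace.single (i j) (1 : ℝ)} ψ) x‖ ≤ 1 * ker (L + n) 1 x) →
        ∀ t, 0 < t → ∀ x y, ‖y - x‖ ≤ t → ‖cv (dil ψ t) g y‖ₑ ≤
          A * potential q R⁻¹ (fun z => ‖cv (dil η R⁻¹) f z‖ₑ) x + C * A * N x := by
  have hB : (0 : ℝ) ≤ L + n := by positivity
  obtain ⟨CK, hCK, hK⟩ := exists_norm_fourierInv_symbol_le hn hδ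
  obtain ⟨D, hD⟩ := exists_enorm_integral_tr_mul_le (n := n) (L := L) hq (by exact_mod_cast hL) hqL
  obtain ⟨Cκ, hCκ, h1⟩ := norm_cnv_dil_le κ hB
  obtain ⟨Cd, hCd, h2⟩ := hd.norm_cnv_dil_le hB L
  refine ⟨D * (CK.toNNReal + (Cd * CK).toNNReal) + (Cκ + 1).toNNReal,
    fun f g R hR C N hN hint hg ψ hψ0 hψ t ht x y hxy => ?_⟩
  set s := R⁻¹ with hs
  have hs0 : 0 < s := inv_pos.2 hR
  set G := cv (dil η s) f with hG
  set K : Rn n → ℂ := 𝓕⁻ (fun ξ => (symbol δ R ξ : ℂ)) with hKdef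
  have hKb : ∀ v, ‖K v‖ ≤ CK * ker q s v := fun v => by
    rw [hqδ]
    exact hK R hR v
  have hGm : Measurable fun z => ‖G z‖ₑ := (continuous_cv _ _).measurable.enorm
  have hH := enorm_kerConv_le (G := G) hCK hKb
  have ecv : ∀ a : 𝓢(Rn n, ℂ), cv a g y = ∫ u, tr a y u * kerConv K G u := fun a => hg _
  set P := potential q s (fun z => ‖G z‖ₑ) x with hP
  push_cast
  -- For $t \le s$ the factor $\min(1,(s/t)^L)$ is 1, so the decay of `ψ` alone suffices.
  rcases le_total t s with hts | hst
  · have hmin : min 1 ((s / t) ^ (L : ℝ)) = 1 := by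
      refine min_eq_left (Real.one_le_rpow ?_ L.cast_nonneg)
      rwa [one_le_div ht]
    have h3 := hD s t 1 CK hs0 ht zero_le_one hCK _ _ (dil ψ t) hGm hH
      (fun v => by rw [hmin, one_mul]; exact norm_dil_le hψ0 ht v) x y hxy
    rw [ecv]
    refine h3.trans (le_trans ?_ le_self_add)
    rw [one_mul]
    refine mul_le_mul' (le_trans ?_ le_self_add) le_rfl
    exact mul_le_mul' le_rfl le_self_add
  · have hst0 : 0 < s / t := by positivity
    have hst1 : s / t ≤ 1 := by rwa [div_le_one ht]
    have ed : ∀ a : 𝓢(Rn n, ℂ), cnv (dil ψ t) (dil a s) = dil (cnv ψ (dil a (s / t))) t := fun a => by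
      rw [dil_cnv _ _ ht, dil_dil _ hst0 ht, div_mul_cancel₀ _ ht.ne']
    have hsplit : cv (dil ψ t) g y = cv (dil (cnv ψ (dil κ (s / t))) t) f y +
        ∫ u, tr (dil (cnv ψ (dil d (s / t))) t) y u * kerConv K G u := by
      rw [ecv, ← ed, ← ed]
      refine integral_tr_mul_kerConv (integrable_symbol hδ hR) (η := dil η s) (fun ξ => ?_) ?_ f hint _ y
      · rw [fourier_dil _ hs0, fourier_dil _ hs0, ← symbol_inv_smul δ hR]
        exact hm _
      · rw [← dil_cnv _ _ hs0, hκ]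
    -- The function $\psi * \kappa_{s/t}$ is again admissible, since its derivatives fall on `ψ`;
    -- the added 1 meets the requirement $M > 0$.
    have hk : ‖cv (dil (cnv ψ (dil κ (s / t))) t) f y‖ₑ ≤ C * ENNReal.ofReal (Cκ + 1) * N x := by
      refine hN _ _ (by positivity) (fun v => ?_) (fun i v => ?_) t ht x y hxy
      · refine (h1 ψ 1 zero_le_one hψ0 _ hst0 hst1 v).trans ?_
        have := ker_nonneg (L + n) one_pos v
        gcongr
        linarith
      · rw [iteratedLineDerivOp_cnv]
        refine (h1 _ 1 zero_le_one (hψ i) _ hst0 hst1 v).trans ?_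
        have := ker_nonneg (L + n) one_pos v
        gcongr
        linarith
    -- Here cancellation supplies the factor $(s/t)^L$ that averaging the potential at scale $t \ge
    -- s$ requires.
    have hdd := hD s t Cd CK hs0 ht hCd hCK _ _ (dil (cnv ψ (dil d (s / t))) t) hGm hH
      (fun v => by
        have hmin : min 1 ((s / t) ^ (L : ℝ)) = (s / t) ^ L := by
          rw [Real.rpow_natCast]
          exact min_eq_right (pow_le_one₀ hst0.le hst1)
        rw [hmin]
        refine norm_dil_le (fun v => ?_) ht v
        have := h2 ψ 1 zero_le_one hψ _ hst0 hst1 v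
        rwa [mul_one] at this) x y hxy
    rw [hsplit, add_comm (cv _ _ _)]
    refine (enorm_add_le _ _).trans (add_le_add (hdd.trans ?_) (hk.trans ?_))
    · refine mul_le_mul' (le_trans ?_ le_self_add) le_rfl
      exact mul_le_mul' le_rfl le_add_self
    · refine mul_le_mul' (mul_le_mul' le_rfl ?_) le_rfl
      exact le_add_self

/-! ### Weak type quasi-norm estimates. -/

theorem weakLpNorm_le_of_le {w : Rn n → ℝ} {p : ℝ} (hp : 0 < p) {g H N : Rn n → ℝ≥0∞} {E : ℝ≥0}
    (hE : 0 < E) (h : ∀ x, g x ≤ E * (H x + N x)) {a b : ℝ≥0∞}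
    (hH : ∀ l : ℝ, 0 < l → ENNReal.ofReal l ^ p * weightMeasure w {x | ENNReal.ofReal l < H x} ≤ a)
    (hN : ∀ l : ℝ, 0 < l → ENNReal.ofReal l ^ p * weightMeasure w {x | ENNReal.ofReal l < N x} ≤ b) :
    weakLpNorm p w g ≤ 2 * E * (a + b) ^ (1 / p) := by
  refine iSup₂_le fun l hl => ?_
  -- If $E(H+N)$ exceeds `l`, one of the two summands exceeds this level.
  set l' : ℝ≥0 := l / (2 * E) with hl'
  have hl0 : 0 < l' := by positivity
  have hll : l = 2 * E * l' := by
    rw [hl']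
    field_simp
  have hsub : {x | (l : ℝ≥0∞) < g x} ⊆
      {x | ENNReal.ofReal l' < H x} ∪ {x | ENNReal.ofReal l' < N x} := by
    intro x hx
    by_contra hcon
    simp only [Set.mem_union, Set.mem_ofPred_eq, not_or, not_lt, ENNReal.ofReal_coe_nnreal] at hcon hx
    refine absurd (hx.trans_le (h x)) (not_lt.2 ?_)
    calc _ ≤ (E : ℝ≥0∞) * (l' + l') := mul_le_mul' le_rfl (add_le_add hcon.1 hcon.2)
      _ = _ := by
        rw [hll]
        push_cast
        ring
  have h1 : (l' : ℝ≥0∞) ^ p * weightMeasure w {x | (l : ℝ≥0∞) < g x} ≤ a + b := by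
    refine (mul_le_mul' le_rfl ((measure_mono hsub).trans (measure_union_le _ _))).trans ?_
    rw [mul_add]
    have e1 := hH l' hl0
    have e2 := hN l' hl0
    rw [ENNReal.ofReal_coe_nnreal] at e1 e2
    rw [ENNReal.ofReal_coe_nnreal]
    exact add_le_add e1 e2
  have h2 := ENNReal.rpow_le_rpow h1 (show 0 ≤ 1 / p by positivity)
  rw [ENNReal.mul_rpow_of_nonneg _ _ (by positivity), ← ENNReal.rpow_mul, mul_one_div_cancel hp.ne',
    ENNReal.rpow_one] at h2
  calc _ = 2 * E * (l' * weightMeasure w {x | (l : ℝ≥0∞) < g x} ^ (1 / p)) := by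
        nth_rewrite 1 [hll]
        push_cast
        ring
    _ ≤ _ := mul_le_mul' le_rfl h2

theorem rpow_mul_measure_lt_le (w : Rn n → ℝ) {p : ℝ} (hp : 0 < p) {N : Rn n → ℝ≥0∞}
    (hN : Measurable N) (l : ℝ) : ENNReal.ofReal l ^ p * weightMeasure w {x | ENNReal.ofReal l < N x} ≤
      ∫⁻ x, N x ^ p ∂weightMeasure w := by
  refine (mul_le_mul' le_rfl (measure_mono fun x hx => ?_)).trans
    (mul_meas_ge_le_lintegral (hN.pow_const p) (ENNReal.ofReal l ^ p))
  exact ENNReal.rpow_le_rpow (le_of_lt hx) hp.le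

end

end BochnerRiesz

end

/-! ### The weak type theorem. -/

open BochnerRiesz
theorem theorem1p1 (n : ℕ) (hn : 1 ≤ n) (p δ : ℝ) (hp0 : 0 < p) (hp1 : p < 1)
    (hδ : δ = n / p - (n + 1) / 2)
    (hint : ∀ k : ℕ, 0 < k → (n : ℝ) * (1 / p - 1) ≠ k)
    (w : Rn n → ℝ) (hw : IsA1 w) (hw0 : ¬ w =ᵐ[volume] 0)
    (φ : 𝓢(Rn n, ℂ)) (hφ : ∫ x, φ x = 1) :
    ∃ C : ℝ≥0, 0 < C ∧ ∀ f : 𝓢'(Rn n, ℂ), hardyNorm φ p w f < ⊤ → ∀ R : ℝ, 0 < R →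
      ∃ g : 𝓢'(Rn n, ℂ), IsBochnerRiesz δ R f g ∧
        weakHardyNorm p w g ≤ C * hardyNorm φ p w f := by
  have hn1 : (1 : ℝ) ≤ n := by exact_mod_cast hn
  have hq : (n : ℝ) < n / p := by
    rw [lt_div_iff₀ hp0]
    nlinarith
  have hδ0 : 0 < δ := by linarith
  have hqδ : (n : ℝ) / p = δ + (n + 1) / 2 := by linarith
  set L : ℕ := grandOrder p w + 1 with hL
  have hqL : (n : ℝ) / p < L + n := by
    -- As $q_w = 1$, the definition of $N$ gives $n/p - n < N+1 = L$, the smoothness needed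
    -- throughout.
    have h := Nat.lt_floor_add_one ((n : ℝ) * (criticalIndex w / p - 1))
    have e : (n : ℝ) * (1 / p - 1) = n / p - n := by ring
    rw [hw.criticalIndex_eq_one hw0, e] at h
    rw [hL, grandOrder, hw.criticalIndex_eq_one hw0, e]
    push_cast
    linarith
  obtain ⟨η, κ, d, hd, hη, hκ, hm⟩ := exists_symbol_splitting n hδ0
  obtain ⟨C₁, hC₁⟩ := exists_maximalFunction hw hφ hn hp0 hp1 hqL
  obtain ⟨C₀, h0⟩ := hw.exists_isA1Ball
  obtain ⟨D, hD⟩ := h0.weak_potential hw.1 hn hp0 hp1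
  obtain ⟨A, hA⟩ := exists_enorm_cv_dil_le_potential hn hδ0 hqδ hq (Nat.succ_pos _) hqL.le hd hκ hm
  obtain ⟨CK, hCK, hK⟩ := exists_norm_fourierInv_symbol_le hn hδ0
  obtain ⟨M, hM0, hM1, hM2⟩ := exists_norm_iteratedLineDeriv_le_ker η (L + n) L
  set B : ℝ≥0 := C₁ * (M + 1).toNNReal with hB
  set E : ℝ≥0 := A + C₁ * A + 1 with hE
  have hE0 : 0 < E := by positivity
  -- The sum of the weak type constants of the potential and of `N`; the added 1 only makes the
  -- final constant positive.
  set S : ℝ≥0 := D * (B ^ p * C₁) + C₁ + 1 with hS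
  have hp1' : 0 ≤ 1 / p := by positivity
  refine ⟨2 * E * S ^ (1 / p), by positivity, fun f hf R hR => ?_⟩
  have hRi : 0 < R⁻¹ := inv_pos.2 hR
  set I := ∫⁻ x, radialMax φ f x ^ p ∂weightMeasure w with hI
  have hIt : I ≠ ⊤ := by
    intro h
    rw [hardyNorm, ← hI, h, ENNReal.top_rpow_of_pos (by positivity)] at hf
    exact lt_irrefl _ hf
  obtain ⟨N, hNm, hNI, hN⟩ := hC₁ f
  set G := cv (dil η R⁻¹) f with hG
  have hGm : Measurable fun z => ‖G z‖ₑ := (continuous_cv _ _).measurable.enorm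
  have hker : ∀ x : Rn n, 0 ≤ ker (L + n : ℝ) 1 x := ker_nonneg _ one_pos
  -- The nontangential control by `N`, with `η` as test function at scale $1/R$, is exactly the
  -- majorization that `IsA1Ball.weak_potential` asks for.
  have hGN : ∀ z u, ‖u - z‖ ≤ R⁻¹ → ‖G z‖ₑ ≤ B * N u := by
    intro z u hzu
    have h := hN η (M + 1) (by positivity)
      (fun x => (hM1 x).trans (mul_le_mul_of_nonneg_right (by linarith) (hker x)))
      (fun i x => (hM2 i x).trans (mul_le_mul_of_nonneg_right (by linarith) (hker x)))
      R⁻¹ hRi u z (by rwa [norm_sub_rev])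
    refine h.trans (le_of_eq ?_)
    rw [hB]
    push_cast
    rfl
  have hweak : ∀ l : ℝ, 0 < l → ENNReal.ofReal l ^ p *
      weightMeasure w {x | ENNReal.ofReal l < potential (n / p) R⁻¹ (fun z => ‖G z‖ₑ) x} ≤
        D * (B ^ p * C₁) * I := by
    intro l hl
    refine (hD R⁻¹ hRi _ (fun u => B * N u) hGm (hNm.const_mul _) hGN l hl).trans ?_
    simp_rw [ENNReal.mul_rpow_of_nonneg _ _ hp0.le]
    rw [lintegral_const_mul _ (hNm.pow_const p), mul_assoc, mul_assoc]
    exact mul_le_mul' le_rfl (mul_le_mul' le_rfl hNI)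
  have hBt : ((B : ℝ≥0∞) ^ p) ≠ ⊤ := ENNReal.rpow_ne_top_of_nonneg hp0.le ENNReal.coe_ne_top
  -- The quantitative weak bound also shows that the convolution defining $T^\delta_R f$ converges.
  obtain ⟨x₀, hx₀⟩ := exists_potential_lt_top hw hw0 hp0
    (ENNReal.mul_ne_top (ENNReal.mul_ne_top ENNReal.coe_ne_top
      (ENNReal.mul_ne_top hBt ENNReal.coe_ne_top)) hIt) hweak
  obtain ⟨k, c, hc, hP⟩ := exists_potential_le (by positivity) hRi hx₀
  have hKb : ∀ v : Rn n, ‖𝓕⁻ (fun ξ => (symbol δ R ξ : ℂ)) v‖ ≤ CK * ker (n / p) R⁻¹ v := fun v => by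
    rw [hqδ]
    exact hK R hR v
  obtain ⟨g, hg, hgu⟩ := exists_isBochnerRiesz hδ0 hR hη f hCK hc hKb hP
  have hprod := fun u : 𝓢(Rn n, ℂ) => integrable_mul_ker_mul u
    (continuous_fourierInv (integrable_symbol hδ0 hR)) (continuous_cv (dil η R⁻¹) f) hCK hKb hP
  refine ⟨g, hg, ?_⟩
  have hmax : ∀ x, grandMax p w g x ≤
      E * (potential (n / p) R⁻¹ (fun z => ‖G z‖ₑ) x + N x) := by
    intro x
    refine iSup₂_le fun ψ hψ => iSup₂_le fun t ht => iSup₂_le fun y hy => ?_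
    rw [convDil_eq]
    have h1 := hA f g R hR C₁ N hN hprod hgu ψ
      (fun v => by simpa using norm_le_ker_of_mem_grandClass hψ (Nat.zero_le _) Fin.elim0 v)
      (fun i v => norm_le_ker_of_mem_grandClass hψ le_rfl i v) t ht x y hy.le
    refine h1.trans ?_
    rw [mul_add, hE]
    push_cast
    refine add_le_add (mul_le_mul' ?_ le_rfl) (mul_le_mul' ?_ le_rfl)
    · rw [add_assoc]
      exact le_self_add
    · exact le_add_self.trans le_self_add
  have hfin := weakLpNorm_le_of_le hp0 hE0 hmax hweak
    fun l _ => (rpow_mul_measure_lt_le w hp0 hNm l).trans hNI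
  refine hfin.trans ?_
  have hSI : (D * (B ^ p * C₁) * I + C₁ * I : ℝ≥0∞) ≤ S * I := by
    rw [← add_mul, hS]
    push_cast
    rw [ENNReal.coe_rpow_of_nonneg _ hp0.le]
    exact mul_le_mul' le_self_add le_rfl
  rw [hardyNorm, ← hI]
  push_cast
  rw [ENNReal.coe_rpow_of_nonneg _ hp1', mul_assoc _ (_ ^ _) (I ^ _),
    ← ENNReal.mul_rpow_of_nonneg _ _ hp1']
  exact mul_le_mul' le_rfl (ENNReal.rpow_le_rpow hSI hp1')
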